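/- **Conventions.** All operads are unitary symmetric operads in groupoids. A *relative operad* over an operad $P$ is an operad $Q$ in right $P$-modules: groupoids $Q(n,m)$ of operations with $n$ open (terrestrial) inputs, $m$ closed (aerial) inputs and open output, with actions of $\Sigma_n\times\Sigma_m$, a unit in $Q(1,0)$, composition at open inputs, and compatible composition of operations of $P$ at closed inputs. A *categorical equivalence* is a morphism of relative operads that is an equivalence of categories in every arity, for both colours. * $\mathrm{CoP}_+(n)$ is the discrete groupoid on $\Sigma_n$ (words in $1,\dots,n$). $\mathrm{CoB}_+(n)$ is the groupoid of coloured braids: the fundamental groupoid of the configuration space of $n$ labelled points in the disk, restricted to one collinear base configuration for each element of $\Sigma_n$. $\mathrm{CoPB}_+(n,m)$ is the fundamental groupoid of the space of configurations of $n$ labelled points on the diameter and $m$ labelled points with positive imaginary part in the closed upper half disk, restricted to one base configuration for each word in the $n+m$ labels. Operadic compositions insert (coloured) braids in tubular neighbourhoods of the strands; composition with the nullary operations forgets strands. $\mathrm{CoPB}_+$ is relative over $\mathrm{CoB}_+$. * $\mathrm{Sh}_+(n,m)$ has the same objects as $\mathrm{CoPB}_+(n,m)$, with exactly one morphism between two words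 if they have the same subword of open labels and the same subword of closed labels, and none otherwise. * $\mathrm{PaP}_+$ and $\mathrm{PaB}_+$ are the pullbacks of $\mathrm{CoP}_+$ and $\mathrm{CoB}_+$ to parenthesized words (the magma operad with a strict unit $*_{\mathfrak c}$). $\mathrm{PaSh}_+$ is the pullback of $\mathrm{Sh}_+$ to the open part of the two-coloured operad freely generated by a closed product $\mu_{\mathfrak c}$, an open product $\mu_{\mathfrak o}$ and an operation $f$ from the closed to the open colour, with strict units $*_{\mathfrak c},*_{\mathfrak o}$ and $f(*_{\mathfrak c})=*_{\mathfrak o}$. On objects of $\mathrm{PaSh}_+$, the map $U$ removes $f$ and identifies the two products. * $\mathrm{PaPB}'_+(n,m)$ is the full subgroupoid of the coinvariants $(\mathrm{PaP}_+(n)\times\mathrm{PaB}_+(m))\times_{\Sigma_n\times\Sigma_m}\mathrm{PaSh}_+(n,m)$ on the classes $[u,x,\mu]$ such that $U(\mu(*_{\mathfrak o},\dots,*_{\mathfrak o}))=x\cdot\tau$ for some $\tau\in\Sigma_m$. Let $\rho[u,x,\mu]\in\mathrm{PaB}_+(n+m)$ be the shuffle-type braid that moves the open strands to the left, followed by the concatenation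 of the permutation $u$ (as a trivial braid) with $x$, followed by the shuffle-type braid that moves the open strands to their places; on objects it is $U(\mu)$. The structure of $\mathrm{PaPB}'_+$ is $$[u,x,\mu]\circ_i^{\mathfrak c}y=[u,\;x\circ_i y,\;\mu\circ_i^{\mathfrak c}1],\qquad [u,x,\mu]\bigl([v_1,y_1,\sigma_1],\dots,[v_n,y_n,\sigma_n]\bigr)=\bigl[u(v_1,\dots,v_n),\;\tau^{-1}\!\cdot\rho[u,x,\mu](y_1,\dots,y_n),\;\mu(\sigma_1,\dots,\sigma_n)\bigr],$$ where $\tau$ is the permutation above and only the parenthesizing of $y$ is inserted in $\mu\circ_i^{\mathfrak c}1$; the unit is $[\mathrm{id},*_{\mathfrak c},\mathrm{id}]$. **Statement.** With these structures, $\mathrm{CoPB}_+$ is a relative operad over $\mathrm{CoB}_+$ and $\mathrm{PaPB}'_+$ is a relative operad over $\mathrm{PaB}_+$. For all $n,m$, the functor $$\zeta:(\mathrm{CoP}_+(n)\times\mathrm{CoB}_+(m))\times_{\Sigma_n\times\Sigma_m}\mathrm{Sh}_+(n,m)\longrightarrow\mathrm{CoPB}_+(n,m),$$ which sends $[u,x,\mu]$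 to the shuffle that moves the open strands to the left, followed by the concatenation of $u$ and $x$, followed by the shuffle that moves the open strands to their places, is an isomorphism of groupoids. There is a categorical equivalence of relative operads $$\mathrm{PaPB}'_+\xrightarrow{\ \sim\ }\mathrm{CoPB}_+$$ that is the projection $\mathrm{PaB}_+\to\mathrm{CoB}_+$ on the closed colour, and that in arity $(n,m)$ is the restriction to $\mathrm{PaPB}'_+(n,m)$ of the composite $$(\mathrm{PaP}_+(n)\times\mathrm{PaB}_+(m))\times_{\Sigma_n\times\Sigma_m}\mathrm{PaSh}_+(n,m)\to(\mathrm{CoP}_+(n)\times\mathrm{CoB}_+(m))\times_{\Sigma_n\times\Sigma_m}\mathrm{Sh}_+(n,m)\xrightarrow[\zeta]{\cong}\mathrm{CoPB}_+(n,m).$$ -/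

import Mathlib

open CategoryTheory

noncomputable section

namespace SwissCheese

/-! ### Words -/

/-- A word on a finite set `I`: every element of `I` is listed exactly once.  For
`I = {1, …, n}` these are the permutations. -/
@[ext]
structure Word (I : Type) where
  list : List I
  nodup : list.Nodup
  complete : ∀ i, i ∈ list

namespace Word

variable {I J X T A B : Type}

/-- Relabelling of a word. -/
def map (e : I ≃ J) (w : Word I) : Word J where
  list := w.list.map e
  nodup := w.nodup.map e.injective
  complete j := List.mem_map.2 ⟨e.symm j, w.complete _, e.apply_symm_apply j⟩

/-- Block substitution: the letter `x` of `w` is replaced by the list `g x`, a listing of the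
fibre of `p` over `x`. -/
def bind (w : Word X) (p : T → X) (g : X → List T) (hn : ∀ x, (g x).Nodup)
    (hm : ∀ x t, t ∈ g x ↔ p t = x) : Word T where
  list := w.list.flatMap g
  nodup := List.nodup_flatMap.2 ⟨fun x _ => hn x, w.nodup.imp fun {x y} hxy t ht ht' =>
    hxy (((hm x t).1 ht).symm.trans ((hm y t).1 ht'))⟩
  complete t := List.mem_flatMap.2 ⟨p t, w.complete _, (hm _ _).2 rfl⟩

/-- The subword of letters of the first colour. -/
def resL (w : Word (A ⊕ B)) : Word A where
  list := w.list.filterMap Sum.getLeft?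
  nodup := w.nodup.filterMap (by
    rintro (a | b) (a' | b') c h h' <;> simp_all)
  complete a := List.mem_filterMap.2 ⟨Sum.inl a, w.complete _, rfl⟩

/-- The subword of letters of the second colour. -/
def resR (w : Word (A ⊕ B)) : Word B where
  list := w.list.filterMap Sum.getRight?
  nodup := w.nodup.filterMap (by
    rintro (a | b) (a' | b') c h h' <;> simp_all)
  complete b := List.mem_filterMap.2 ⟨Sum.inr b, w.complete _, rfl⟩

/-- Concatenation of two words. -/
def append (u : Word A) (x : Word B) : Word (A ⊕ B) where
  list := u.list.map Sum.inl ++ x.list.map Sum.inr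
  nodup := by
    refine List.nodup_append.2 ⟨u.nodup.map Sum.inl_injective, x.nodup.map Sum.inr_injective, ?_⟩
    simp
  complete := by
    rintro (a | b)
    · simp [u.complete a]
    · simp [x.complete b]

/-- The bijection from places to letters defined by a word on `{1, …, n}`. -/
def perm {n : ℕ} (w : Word (Fin n)) : Equiv.Perm (Fin n) :=
  (finCongr (by
    have h := Fintype.card_congr (List.Nodup.getEquivOfForallMemList w.list w.nodup w.complete)
    simpa using h.symm)).trans
    (List.Nodup.getEquivOfForallMemList w.list w.nodup w.complete)

/-- The real numbers `c i` increase along the word `w`. -/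
def Sorted (w : Word I) (c : I → ℝ) : Prop :=
  w.list.Pairwise fun i j => c i < c j

theorem Sorted.cases {w : Word I} {c c' : I → ℝ} (h : w.Sorted c) (h' : w.Sorted c') {i j : I}
    (hij : i ≠ j) : (c i < c j ∧ c' i < c' j) ∨ (c j < c i ∧ c' j < c' i) := by
  have h2 : w.list.Pairwise fun i j =>
      (c i < c j ∧ c' i < c' j) ∨ (c j < c i ∧ c' j < c' i) :=
    (List.Pairwise.and h h').imp fun {a b} hab => Or.inl hab
  have : Std.Symm fun i j => (c i < c j ∧ c' i < c' j) ∨ (c j < c i ∧ c' j < c' i) :=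
    ⟨fun _ _ => Or.symm⟩
  exact h2.forall (w.complete i) (w.complete j) hij

theorem Sorted.map {w : Word I} {c : I → ℝ} (h : w.Sorted c) (e : I ≃ J) :
    (w.map e).Sorted fun j => c (e.symm j) := by
  simpa [Sorted, Word.map, List.pairwise_map] using h

theorem Sorted.resL {w : Word (A ⊕ B)} {c : A ⊕ B → ℝ} (h : w.Sorted c) :
    w.resL.Sorted fun a => c (Sum.inl a) := by
  unfold Sorted Word.resL
  rw [List.pairwise_filterMap]
  refine List.Pairwise.imp ?_ h
  rintro (a | b) (a' | b') hab <;> simp_all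

theorem Sorted.resR {w : Word (A ⊕ B)} {c : A ⊕ B → ℝ} (h : w.Sorted c) :
    w.resR.Sorted fun b => c (Sum.inr b) := by
  unfold Sorted Word.resR
  rw [List.pairwise_filterMap]
  refine List.Pairwise.imp ?_ h
  rintro (a | b) (a' | b') hab <;> simp_all

theorem Sorted.append {u : Word A} {x : Word B} {c : A ⊕ B → ℝ}
    (hu : u.Sorted fun a => c (Sum.inl a)) (hx : x.Sorted fun b => c (Sum.inr b))
    (h : ∀ a b, c (Sum.inl a) < c (Sum.inr b)) : (u.append x).Sorted c := by
  unfold Sorted Word.append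
  simp only [List.pairwise_append, List.pairwise_map]
  refine ⟨hu, hx, ?_⟩
  simp only [List.mem_map]
  rintro _ ⟨a, -, rfl⟩ _ ⟨b, -, rfl⟩
  exact h a b

theorem Sorted.bind {w : Word X} {c : X → ℝ} {d : T → ℝ} {p : T → X} {g : X → List T}
    {hn : ∀ x, (g x).Nodup} {hm : ∀ x t, t ∈ g x ↔ p t = x} (hc : w.Sorted c)
    (hd : ∀ x, (g x).Pairwise fun s t => d s < d t)
    (h : ∀ s t, c (p s) < c (p t) → d s < d t) : (w.bind p g hn hm).Sorted d := by
  unfold Sorted Word.bind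
  rw [List.pairwise_flatMap]
  refine ⟨fun x _ => hd x, List.Pairwise.imp ?_ hc⟩
  intro x y hxy s hs t ht
  refine h s t ?_
  rwa [(hm x s).1 hs, (hm y t).1 ht]

open Classical in
/-- The position of a letter of a word, normalized to lie in the open interval `(0, 1)`. -/
def pos (w : Word I) (i : I) : ℝ := ((w.list.idxOf i : ℝ) + 1) / ((w.list.length : ℝ) + 1)

theorem pos_pos (w : Word I) (i : I) : 0 < w.pos i := by unfold pos; positivity

theorem pos_lt_one (w : Word I) (i : I) : w.pos i < 1 := by
  classical
  unfold pos
  rw [div_lt_one (by positivity)]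
  have : w.list.idxOf i < w.list.length := List.idxOf_lt_length_iff.2 (w.complete i)
  have h2 : (w.list.idxOf i : ℝ) < w.list.length := by exact_mod_cast this
  linarith

theorem pos_sorted (w : Word I) : w.Sorted w.pos := by
  classical
  unfold Sorted
  rw [List.pairwise_iff_getElem]
  intro i j hi hj hij
  unfold pos
  simp only [w.nodup.idxOf_getElem]
  have : (i : ℝ) < j := by exact_mod_cast hij
  gcongr

/-- Distinct positions are at distance at least `1 / (length + 1)`. -/
theorem pos_gap (w : Word I) {i j : I} (h : w.pos i < w.pos j) :
    w.pos i + 1 / ((w.list.length : ℝ) + 1) ≤ w.pos j := by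
  classical
  unfold pos at *
  rw [← add_div]
  have hp : (0 : ℝ) < (w.list.length : ℝ) + 1 := by positivity
  rw [div_lt_div_iff_of_pos_right hp] at h
  rw [div_le_div_iff_of_pos_right hp]
  have h1 : (w.list.idxOf i : ℝ) < w.list.idxOf j := by linarith
  have h2 : (w.list.idxOf i : ℝ) + 1 ≤ w.list.idxOf j := by exact_mod_cast h1
  linarith

theorem pos_inj (w : Word I) : Function.Injective w.pos := by
  intro i j h
  by_contra hij
  rcases w.pos_sorted.cases w.pos_sorted hij with h' | h' <;> linarith [h'.1]

end Word

/-! ### Parenthesized words -/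

/-- The free unital magma (nonassociative products with a strict unit) on a set. -/
abbrev UMagma (I : Type) : Type := WithOne (FreeMagma I)

namespace UMagma

variable {I J : Type}

/-- A generator. -/
def var (i : I) : UMagma I := ((FreeMagma.of i : FreeMagma I) : WithOne (FreeMagma I))

/-- The universal property of the free unital magma. -/
def lift {M : Type} [MulOneClass M] (g : I → M) : UMagma I →* M :=
  WithOne.lift (FreeMagma.lift g)

theorem lift_var {M : Type} [MulOneClass M] (g : I → M) (i : I) : lift g (var i) = g i := by
  simp [lift, var]

theorem hom_ext {M : Type} [MulOneClass M] {f g : UMagma I →* M}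
    (h : ∀ i, f (var i) = g (var i)) : f = g := by
  apply WithOne.lift.symm.injective
  apply FreeMagma.hom_ext
  funext i
  exact h i

/-- The underlying word: forget the parentheses. -/
def letters : UMagma I →* FreeMonoid I := lift FreeMonoid.of

/-- Substitution of `g i` for the generator `i`. -/
def bind (g : I → UMagma J) : UMagma I →* UMagma J := lift g

/-- The list of leaves. -/
def leaves (t : UMagma I) : List I := FreeMonoid.toList (letters t)

end UMagma

theorem toList_lift {I J : Type} (h : I → FreeMonoid J) (m : FreeMonoid I) :
    FreeMonoid.toList (FreeMonoid.lift h m)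
      = (FreeMonoid.toList m).flatMap fun i => FreeMonoid.toList (h i) := by
  induction m using FreeMonoid.inductionOn' with
  | one => rfl
  | of_mul x xs ih => simp [ih]

namespace UMagma

variable {I J K : Type}

theorem leaves_bind (g : I → UMagma J) (t : UMagma I) :
    leaves (bind g t) = (leaves t).flatMap fun i => leaves (g i) := by
  have h : letters.comp (bind g) = (FreeMonoid.lift fun i => letters (g i)).comp letters := by
    apply hom_ext
    intro i
    simp [letters, bind, lift_var]
  have h2 := congrArg FreeMonoid.toList (DFunLike.congr_fun h t)
  simpa [leaves, toList_lift] using h2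

theorem leaves_var (i : I) : leaves (var i) = [i] := by
  simp [leaves, letters, lift_var]

theorem bind_bind (g : I → UMagma J) (h : J → UMagma K) (t : UMagma I) :
    bind h (bind g t) = bind (fun i => bind h (g i)) t := by
  have : (bind h).comp (bind g) = bind fun i => bind h (g i) := by
    apply hom_ext
    intro i
    simp [bind, lift_var]
  exact DFunLike.congr_fun this t

theorem bind_var (t : UMagma I) : bind var t = t := by
  have : bind (var : I → UMagma I) = MonoidHom.id _ := by
    apply hom_ext
    intro i
    simp [bind, lift_var]
  exact DFunLike.congr_fun this t

theorem leaves_bind_var (e : I → J) (t : UMagma I) :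
    leaves (bind (fun i => var (e i)) t) = (leaves t).map e := by
  rw [leaves_bind]
  simp only [leaves_var]
  exact List.flatMap_pure_eq_map e (leaves t)

end UMagma

/-- Parenthesized words on `I`: the elements of the free unital magma on `I` that are linear in
each generator.  For `I = {1, …, n}` this is arity `n` of the unitary magma operad. -/
@[ext]
structure PWord (I : Type) where
  tree : UMagma I
  nodup : (UMagma.leaves tree).Nodup
  complete : ∀ i, i ∈ UMagma.leaves tree

namespace PWord

variable {I J X T : Type}

/-- The underlying word. -/
def word (t : PWord I) : Word I := ⟨UMagma.leaves t.tree, t.nodup, t.complete⟩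

/-- Substitution of `g x` for the leaf `x`; the leaves of `g x` are the fibre of `p` over `x`. -/
def bind (t : PWord X) (p : T → X) (g : X → UMagma T) (hn : ∀ x, (UMagma.leaves (g x)).Nodup)
    (hm : ∀ x s, s ∈ UMagma.leaves (g x) ↔ p s = x) : PWord T where
  tree := UMagma.bind g t.tree
  nodup := by
    rw [UMagma.leaves_bind]
    exact (t.word.bind p _ hn hm).nodup
  complete := by
    rw [UMagma.leaves_bind]
    exact (t.word.bind p _ hn hm).complete

theorem word_bind (t : PWord X) (p : T → X) (g : X → UMagma T)
    (hn : ∀ x, (UMagma.leaves (g x)).Nodup) (hm : ∀ x s, s ∈ UMagma.leaves (g x) ↔ p s = x) :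
    (t.bind p g hn hm).word = t.word.bind p (fun x => UMagma.leaves (g x)) hn hm := by
  ext1
  exact UMagma.leaves_bind _ _

/-- Relabelling. -/
def map (e : I ≃ J) (t : PWord I) : PWord J where
  tree := UMagma.bind (fun i => UMagma.var (e i)) t.tree
  nodup := by
    rw [UMagma.leaves_bind_var]
    exact (t.word.map e).nodup
  complete := by
    rw [UMagma.leaves_bind_var]
    exact (t.word.map e).complete

theorem word_map (e : I ≃ J) (t : PWord I) : (t.map e).word = t.word.map e := by
  ext1
  exact UMagma.leaves_bind_var _ _

end PWord

/-- Elements of open colour in the free algebra over the two-coloured magma operad: the free unital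
magma generated by `A` and by elements `f t`, for `t` a nonempty product of elements of `B`. -/
abbrev SMagma (A B : Type) : Type := UMagma (A ⊕ FreeMagma B)

namespace SMagma

variable {A B A' B' A'' B'' : Type}

/-- The generating operation from the closed to the open colour, with `f 1 = 1`. -/
def f (t : UMagma B) : SMagma A B :=
  WithOne.recOneCoe (motive := fun _ => SMagma A B) 1 (fun s => UMagma.var (Sum.inr s)) t

/-- An open generator. -/
def var (a : A) : SMagma A B := UMagma.var (Sum.inl a)

/-- The universal property: open generators go to `g`, and `f t` goes to `h t`. -/
def lift {M : Type} [MulOneClass M] (g : A → M) (h : FreeMagma B → M) : SMagma A B →* M :=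
  UMagma.lift (Sum.elim g h)

/-- The underlying bicoloured word. -/
def letters : SMagma A B →* FreeMonoid (A ⊕ B) :=
  lift (fun a => FreeMonoid.of (Sum.inl a))
    (fun t => FreeMonoid.map Sum.inr (UMagma.letters (t : UMagma B)))

/-- The list of leaves. -/
def leaves (t : SMagma A B) : List (A ⊕ B) := FreeMonoid.toList (letters t)

/-- Substitution at open and at closed leaves. -/
def bind (g : A → SMagma A' B') (h : B → UMagma B') : SMagma A B →* SMagma A' B' :=
  lift g (fun t => f (UMagma.bind h (t : UMagma B)))

/-- Forget the second level of parenthesizing: `f` is removed, and both products are identified. -/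
def U : SMagma A B →* UMagma (A ⊕ B) :=
  lift (fun a => UMagma.var (Sum.inl a))
    (fun t => UMagma.bind (fun b => UMagma.var (Sum.inr b)) (t : UMagma B))

/-- `U (μ (∗, …, ∗))`: the open leaves are filled with the nullary operation, that is, they are
replaced by the strict unit, and then the second level of parenthesizing is forgotten. -/
def aerial (t : SMagma A B) : UMagma B :=
  UMagma.bind (Sum.elim (fun _ => 1) UMagma.var) (U t)

theorem hom_ext {M : Type} [MulOneClass M] {φ ψ : SMagma A B →* M}
    (h : ∀ a, φ (var a) = ψ (var a)) (h' : ∀ t : UMagma B, φ (f t) = ψ (f t)) : φ = ψ := by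
  apply UMagma.hom_ext
  rintro (a | t)
  · exact h a
  · exact h' (t : UMagma B)

theorem lift_var {M : Type} [MulOneClass M] (g : A → M) (h : FreeMagma B → M) (a : A) :
    lift g h (var a) = g a := by simp [lift, var, UMagma.lift_var]

theorem lift_f {M : Type} [MulOneClass M] (g : A → M) (φ : UMagma B →* M) (t : UMagma B) :
    lift g (fun s => φ (s : UMagma B)) (f t) = φ t := by
  induction t using WithOne.recOneCoe with
  | one => simp [f]
  | coe s =>
    change lift g (fun s => φ (s : UMagma B)) (UMagma.var (Sum.inr s)) = _
    simp [lift, UMagma.lift_var]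

theorem letters_var (a : A) : letters (var a : SMagma A B) = FreeMonoid.of (Sum.inl a) :=
  lift_var _ _ _

theorem letters_f (t : UMagma B) :
    letters (f t : SMagma A B) = FreeMonoid.map Sum.inr (UMagma.letters t) :=
  lift_f _ ((FreeMonoid.map Sum.inr).comp UMagma.letters) t

theorem bind_dvar (g : A → SMagma A' B') (h : B → UMagma B') (a : A) : bind g h (var a) = g a :=
  lift_var _ _ _

theorem bind_f (g : A → SMagma A' B') (h : B → UMagma B') (t : UMagma B) :
    bind g h (f t) = f (UMagma.bind h t) := by
  induction t using WithOne.recOneCoe with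
  | one => simp [f]
  | coe s =>
    change lift g _ (UMagma.var (Sum.inr s)) = _
    simp [lift, UMagma.lift_var]

theorem U_var (a : A) : U (var a : SMagma A B) = UMagma.var (Sum.inl a) := lift_var _ _ _

theorem U_f (t : UMagma B) :
    U (f t : SMagma A B) = UMagma.bind (fun b => UMagma.var (Sum.inr b)) t :=
  lift_f _ (UMagma.bind fun b => UMagma.var (Sum.inr b)) t

theorem leaves_bind (g : A → SMagma A' B') (h : B → UMagma B') (t : SMagma A B) :
    leaves (bind g h t) = (leaves t).flatMap
      (Sum.elim (fun a => leaves (g a)) (fun b => (UMagma.leaves (h b)).map Sum.inr)) := by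
  have key : letters.comp (bind g h) = (FreeMonoid.lift (Sum.elim (fun a => letters (g a))
      (fun b => FreeMonoid.map Sum.inr (UMagma.letters (h b))))).comp letters := by
    apply hom_ext
    · intro a
      simp [bind_dvar, letters_var]
    · intro t
      simp only [MonoidHom.comp_apply, bind_f, letters_f]
      have : ((FreeMonoid.map (Sum.inr : B' → A' ⊕ B')).comp UMagma.letters).comp (UMagma.bind h)
          = ((FreeMonoid.lift (Sum.elim (fun a => letters (g a))
            (fun b => FreeMonoid.map Sum.inr (UMagma.letters (h b))))).comp
              (FreeMonoid.map Sum.inr)).comp UMagma.letters := by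
        apply UMagma.hom_ext
        intro b
        simp [UMagma.bind, UMagma.lift_var, UMagma.letters]
      exact DFunLike.congr_fun this t
  have h2 := congrArg FreeMonoid.toList (DFunLike.congr_fun key t)
  simp only [MonoidHom.comp_apply, toList_lift] at h2
  refine h2.trans ?_
  refine List.flatMap_congr fun x _ => ?_
  rcases x with a | b <;> rfl

theorem leaves_U (t : SMagma A B) : UMagma.leaves (U t) = leaves t := by
  have key : UMagma.letters.comp U = (letters : SMagma A B →* _) := by
    apply hom_ext
    · intro a
      simp [U_var, letters_var, UMagma.letters, UMagma.lift_var]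
    · intro t
      simp only [MonoidHom.comp_apply, U_f, letters_f]
      have : (UMagma.letters.comp (UMagma.bind fun b => UMagma.var (Sum.inr b : A ⊕ B)))
          = (FreeMonoid.map Sum.inr).comp UMagma.letters := by
        apply UMagma.hom_ext
        intro b
        simp [UMagma.bind, UMagma.lift_var, UMagma.letters]
      exact DFunLike.congr_fun this t
  exact congrArg FreeMonoid.toList (DFunLike.congr_fun key t)

/-- `U` turns a substitution into a substitution. -/
theorem U_bind (g : A → SMagma A' B') (h : B → UMagma B') (t : SMagma A B) :
    U (bind g h t) = UMagma.bind (Sum.elim (fun a => U (g a))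
      (fun b => UMagma.bind (fun b' => UMagma.var (Sum.inr b')) (h b))) (U t) := by
  have key : U.comp (bind g h) = (UMagma.bind (Sum.elim (fun a => U (g a))
      (fun b => UMagma.bind (fun b' => UMagma.var (Sum.inr b')) (h b)))).comp U := by
    apply hom_ext
    · intro a
      simp [bind_dvar, U_var, UMagma.bind, UMagma.lift_var]
    · intro t
      simp only [MonoidHom.comp_apply, bind_f, U_f, UMagma.bind_bind]
      rfl
  exact DFunLike.congr_fun key t

theorem aerial_bind (g : A → SMagma A' B') (h : B → UMagma B') (t : SMagma A B) :
    aerial (bind g h t) = UMagma.bind (Sum.elim (fun a => aerial (g a)) h) (U t) := by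
  unfold aerial
  rw [U_bind, UMagma.bind_bind]
  congr 1
  congr 1
  funext x
  rcases x with a | b
  · rfl
  · simp only [Sum.elim_inr, UMagma.bind_bind]
    conv_rhs => rw [← UMagma.bind_var (h b)]
    rfl

theorem leaves_aerial (t : SMagma A B) :
    UMagma.leaves (aerial t) = (leaves t).filterMap Sum.getRight? := by
  unfold aerial
  rw [UMagma.leaves_bind, leaves_U]
  induction leaves t with
  | nil => rfl
  | cons x xs ih =>
    rcases x with a | b
    · simp only [List.flatMap_cons, Sum.elim_inl, ih]
      rw [List.filterMap_cons_none rfl]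
      rfl
    · simp only [List.flatMap_cons, Sum.elim_inr, ih, UMagma.leaves_var]
      simp

end SMagma

/-! ### Configuration spaces -/

/-- Configurations of distinct points, labelled by `I`, in the closed unit disk. -/
abbrev Conf (I : Type) : Type :=
  {z : I → ℂ // Function.Injective z ∧ ∀ i, ‖z i‖ ≤ 1}

/-- Configurations in the closed upper half disk of "terrestrial" points on the real axis, labelled
by `A`, and of "aerial" points with positive imaginary part, labelled by `B`. -/
abbrev HConf (A B : Type) : Type :=
  {z : A ⊕ B → ℂ // Function.Injective z ∧ (∀ x, ‖z x‖ ≤ 1) ∧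
    (∀ a, (z (Sum.inl a)).im = 0) ∧ ∀ b, 0 < (z (Sum.inr b)).im}

theorem norm_convex {x y : ℂ} (hx : ‖x‖ ≤ 1) (hy : ‖y‖ ≤ 1) {t : ℝ} (h0 : 0 ≤ t) (h1 : t ≤ 1) :
    ‖(1 - t : ℂ) * x + t * y‖ ≤ 1 := by
  have h2 : ‖(1 - t : ℂ)‖ = 1 - t := by
    rw [show (1 - t : ℂ) = ((1 - t : ℝ) : ℂ) by push_cast; ring, Complex.norm_real,
      Real.norm_of_nonneg (by linarith)]
  have h3 : ‖(t : ℂ)‖ = t := by rw [Complex.norm_real, Real.norm_of_nonneg h0]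
  calc ‖(1 - t : ℂ) * x + t * y‖ ≤ ‖(1 - t : ℂ)‖ * ‖x‖ + ‖(t : ℂ)‖ * ‖y‖ := by
        rw [← norm_mul, ← norm_mul]; exact norm_add_le _ _
    _ ≤ (1 - t) * 1 + t * 1 := by rw [h2, h3]; gcongr
    _ = 1 := by ring

theorem re_convex (x y : ℂ) (t : ℝ) :
    ((1 - t : ℂ) * x + t * y).re = (1 - t) * x.re + t * y.re := by
  simp

theorem im_convex (x y : ℂ) (t : ℝ) :
    ((1 - t : ℂ) * x + t * y).im = (1 - t) * x.im + t * y.im := by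
  simp

theorem lt_convex {a b c d t : ℝ} (h : a < b) (h' : c < d) (h0 : 0 ≤ t) (h1 : t ≤ 1) :
    (1 - t) * a + t * c < (1 - t) * b + t * d := by
  rcases h0.eq_or_lt with rfl | h0
  · simpa using h
  · nlinarith

theorem ne_convex {I : Type} {w : Word I} {z z' : I → ℂ} (h : w.Sorted fun i => (z i).re)
    (h' : w.Sorted fun i => (z' i).re) {i j : I} (hij : i ≠ j) {t : ℝ} (h0 : 0 ≤ t) (h1 : t ≤ 1) :
    (1 - t : ℂ) * z i + t * z' i ≠ (1 - t : ℂ) * z j + t * z' j := by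
  intro heq
  have h2 := congrArg Complex.re heq
  rw [re_convex, re_convex] at h2
  rcases h.cases h' hij with hc | hc
  · exact (lt_convex hc.1 hc.2 h0 h1).ne h2
  · exact (lt_convex hc.1 hc.2 h0 h1).ne h2.symm

/-- The linear path between two configurations in which the points occur from left to right in the
same order `w`. -/
def Conf.segment {I : Type} (w : Word I) (z z' : Conf I) (h : w.Sorted fun i => (z.1 i).re)
    (h' : w.Sorted fun i => (z'.1 i).re) : Path z z' where
  toFun t := ⟨fun i => (1 - (t : ℝ) : ℂ) * z.1 i + (t : ℝ) * z'.1 i,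
    fun _ _ hij => by_contra fun hne => ne_convex h h' hne t.2.1 t.2.2 hij,
    fun i => norm_convex (z.2.2 i) (z'.2.2 i) t.2.1 t.2.2⟩
  continuous_toFun := by
    refine Continuous.subtype_mk (continuous_pi fun i => ?_) _
    fun_prop
  source' := by ext i; simp
  target' := by ext i; simp

/-- The linear path between two configurations in which the terrestrial points occur from left to
right in the same order `u`, and the aerial points in the same order `x`. -/
def HConf.segment {A B : Type} (u : Word A) (x : Word B) (z z' : HConf A B)
    (hu : u.Sorted fun a => (z.1 (Sum.inl a)).re) (hu' : u.Sorted fun a => (z'.1 (Sum.inl a)).re)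
    (hx : x.Sorted fun b => (z.1 (Sum.inr b)).re) (hx' : x.Sorted fun b => (z'.1 (Sum.inr b)).re) :
    Path z z' where
  toFun t := ⟨fun i => (1 - (t : ℝ) : ℂ) * z.1 i + (t : ℝ) * z'.1 i, by
    have him : ∀ b, 0 < (1 - (t : ℝ)) * (z.1 (Sum.inr b)).im
        + (t : ℝ) * (z'.1 (Sum.inr b)).im := fun b => by
      have := lt_convex (z.2.2.2.2 b) (z'.2.2.2.2 b) t.2.1 t.2.2
      simpa using this
    have him0 : ∀ a, (1 - (t : ℝ)) * (z.1 (Sum.inl a)).im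
        + (t : ℝ) * (z'.1 (Sum.inl a)).im = 0 := fun a => by
      rw [z.2.2.2.1 a, z'.2.2.2.1 a]; ring
    refine ⟨?_, fun i => norm_convex (z.2.2.1 i) (z'.2.2.1 i) t.2.1 t.2.2, fun a => ?_, fun b => ?_⟩
    · rintro (a | b) (a' | b') hij
      · by_contra hne
        exact ne_convex hu hu' (fun h => hne (congrArg Sum.inl h)) t.2.1 t.2.2 hij
      · have h2 := congrArg Complex.im hij
        simp only [im_convex] at h2
        linarith [him b', him0 a]
      · have h2 := congrArg Complex.im hij
        simp only [im_convex] at h2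
        linarith [him b, him0 a']
      · by_contra hne
        exact ne_convex hx hx' (fun h => hne (congrArg Sum.inr h)) t.2.1 t.2.2 hij
    · rw [im_convex]; exact him0 a
    · rw [im_convex]; exact him b⟩
  continuous_toFun := by
    refine Continuous.subtype_mk (continuous_pi fun i => ?_) _
    fun_prop
  source' := by ext i; simp
  target' := by ext i; simp

/-- The class of `Conf.segment`, as an isomorphism of the fundamental groupoid. -/
def Conf.iso {I : Type} (w : Word I) {z z' : Conf I} (h : w.Sorted fun i => (z.1 i).re)
    (h' : w.Sorted fun i => (z'.1 i).re) :
    (⟨z⟩ : FundamentalGroupoid (Conf I)) ≅ ⟨z'⟩ :=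
  Groupoid.isoEquivHom _ _ |>.symm
    (FundamentalGroupoid.fromPath (Path.Homotopic.Quotient.mk (Conf.segment w z z' h h')))

/-- The class of `HConf.segment`, as an isomorphism of the fundamental groupoid. -/
def HConf.iso {A B : Type} (u : Word A) (x : Word B) {z z' : HConf A B}
    (hu : u.Sorted fun a => (z.1 (Sum.inl a)).re) (hu' : u.Sorted fun a => (z'.1 (Sum.inl a)).re)
    (hx : x.Sorted fun b => (z.1 (Sum.inr b)).re) (hx' : x.Sorted fun b => (z'.1 (Sum.inr b)).re) :
    (⟨z⟩ : FundamentalGroupoid (HConf A B)) ≅ ⟨z'⟩ :=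
  Groupoid.isoEquivHom _ _ |>.symm
    (FundamentalGroupoid.fromPath
      (Path.Homotopic.Quotient.mk (HConf.segment u x z z' hu hu' hx hx')))

/-- The base configuration of a word: the points lie on the real axis, in the order of the word. -/
def Word.conf {I : Type} (w : Word I) : Conf I :=
  ⟨fun i => (w.pos i : ℂ), fun i j h => w.pos_inj (Complex.ofReal_injective h), fun i => by
    rw [Complex.norm_real, Real.norm_of_nonneg (w.pos_pos i).le]
    exact (w.pos_lt_one i).le⟩

theorem Word.conf_sorted {I : Type} (w : Word I) : w.Sorted fun i => (w.conf.1 i).re :=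
  w.pos_sorted

theorem Word.pos_le {I : Type} (w : Word I) (i : I) :
    w.pos i + 1 / ((w.list.length : ℝ) + 1) ≤ 1 := by
  classical
  unfold pos
  rw [← add_div, div_le_one (by positivity)]
  have : w.list.idxOf i < w.list.length := List.idxOf_lt_length_iff.2 (w.complete i)
  have h2 : (w.list.idxOf i : ℝ) + 1 ≤ w.list.length := by exact_mod_cast this
  linarith

/-- The base configuration of a bicoloured word: terrestrial and aerial points, with real parts in
the order of the word. -/
def Word.hconf {A B : Type} (w : Word (A ⊕ B)) : HConf A B :=
  ⟨fun x => ⟨w.pos x, Sum.elim (fun _ => 0) (fun _ => 1 / ((w.list.length : ℝ) + 1)) x⟩,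
    fun x y h => w.pos_inj (congrArg Complex.re h),
    fun x => by
      refine (Complex.norm_le_abs_re_add_abs_im _).trans ?_
      refine le_trans ?_ (w.pos_le x)
      have h1 : 0 ≤ 1 / ((w.list.length : ℝ) + 1) := by positivity
      rw [abs_of_nonneg (w.pos_pos x).le]
      rcases x with a | b
      · simpa using h1
      · simp only [Sum.elim_inr, abs_of_nonneg h1, le_refl],
    fun a => rfl, fun b => by
      change 0 < 1 / ((w.list.length : ℝ) + 1)
      positivity⟩

theorem Word.hconf_sorted {A B : Type} (w : Word (A ⊕ B)) :
    w.Sorted fun x => (w.hconf.1 x).re :=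
  w.pos_sorted

/-! ### Insertion of configurations -/

/-- A positive continuous function, smaller than an eighth of the distance of any two points of a
configuration in the unit disk: the width of the tubular neighbourhoods used for insertion. -/
def radius {X : Type} (z : X → ℂ) : ℝ :=
  (∏ᶠ q : {q : X × X // q.1 ≠ q.2}, ‖z q.1.1 - z q.1.2‖ / 2) / 4

/-- The width of the tubular neighbourhoods of aerial points. -/
def hradius {A B : Type} (z : A ⊕ B → ℂ) : ℝ :=
  radius z * ∏ᶠ b, (z (Sum.inr b)).im

section radius

variable {X T A B : Type}

theorem radius_pos [Finite X] {z : X → ℂ} (hz : Function.Injective z) : 0 < radius z := by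
  unfold radius
  have : 0 < ∏ᶠ q : {q : X × X // q.1 ≠ q.2}, ‖z q.1.1 - z q.1.2‖ / 2 := by
    have := Fintype.ofFinite {q : X × X // q.1 ≠ q.2}
    rw [finprod_eq_prod_of_fintype]
    refine Finset.prod_pos fun q _ => ?_
    have : 0 < ‖z q.1.1 - z q.1.2‖ := norm_pos_iff.2 (sub_ne_zero.2 fun h => q.2 (hz h))
    positivity
  positivity

theorem half_dist_le_one {z : X → ℂ} (hb : ∀ x, ‖z x‖ ≤ 1) (x y : X) : ‖z x - z y‖ / 2 ≤ 1 := by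
  have := norm_sub_le (z x) (z y)
  linarith [hb x, hb y]

theorem radius_le [Finite X] {z : X → ℂ} (hb : ∀ x, ‖z x‖ ≤ 1) {x y : X} (h : x ≠ y) :
    radius z ≤ ‖z x - z y‖ / 8 := by
  unfold radius
  have : ∏ᶠ q : {q : X × X // q.1 ≠ q.2}, ‖z q.1.1 - z q.1.2‖ / 2 ≤ ‖z x - z y‖ / 2 := by
    classical
    have := Fintype.ofFinite {q : X × X // q.1 ≠ q.2}
    rw [finprod_eq_prod_of_fintype,
      ← Finset.mul_prod_erase _ _ (Finset.mem_univ (⟨(x, y), h⟩ : {q : X × X // q.1 ≠ q.2}))]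
    refine mul_le_of_le_one_right (by positivity) ?_
    exact Finset.prod_le_one (fun _ _ => by positivity) fun q _ => half_dist_le_one hb _ _
  linarith

theorem radius_le_quarter [Finite X] {z : X → ℂ} (hb : ∀ x, ‖z x‖ ≤ 1) : radius z ≤ 1 / 4 := by
  unfold radius
  have : ∏ᶠ q : {q : X × X // q.1 ≠ q.2}, ‖z q.1.1 - z q.1.2‖ / 2 ≤ 1 := by
    have := Fintype.ofFinite {q : X × X // q.1 ≠ q.2}
    rw [finprod_eq_prod_of_fintype]
    exact Finset.prod_le_one (fun _ _ => by positivity) fun q _ => half_dist_le_one hb _ _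
  linarith

theorem continuous_radius [Finite X] : Continuous (radius : (X → ℂ) → ℝ) := by
  unfold radius
  refine Continuous.div_const (continuous_finprod (fun q => ?_) (locallyFinite_of_finite _)) _
  fun_prop

theorem im_prod [Finite B] (z : HConf A B) : 0 < ∏ᶠ b, (z.1 (Sum.inr b)).im ∧
    ∏ᶠ b, (z.1 (Sum.inr b)).im ≤ 1 ∧ ∀ b, ∏ᶠ b, (z.1 (Sum.inr b)).im ≤ (z.1 (Sum.inr b)).im := by
  classical
  have := Fintype.ofFinite B
  have h1 : ∀ b, (z.1 (Sum.inr b)).im ≤ 1 := fun b =>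
    (le_abs_self _).trans ((Complex.abs_im_le_norm _).trans (z.2.2.1 _))
  rw [finprod_eq_prod_of_fintype]
  refine ⟨Finset.prod_pos fun b _ => z.2.2.2.2 b,
    Finset.prod_le_one (fun b _ => (z.2.2.2.2 b).le) fun b _ => h1 b, fun b => ?_⟩
  rw [← Finset.mul_prod_erase _ _ (Finset.mem_univ b)]
  refine mul_le_of_le_one_right (z.2.2.2.2 b).le ?_
  exact Finset.prod_le_one (fun b _ => (z.2.2.2.2 b).le) fun b _ => h1 b

theorem hradius_pos [Finite A] [Finite B] (z : HConf A B) : 0 < hradius z.1 :=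
  mul_pos (radius_pos z.2.1) (im_prod z).1

theorem hradius_le [Finite A] [Finite B] (z : HConf A B) : hradius z.1 ≤ radius z.1 :=
  mul_le_of_le_one_right (radius_pos z.2.1).le (im_prod z).2.1

theorem hradius_le_im [Finite A] [Finite B] (z : HConf A B) (b : B) : hradius z.1 ≤ (z.1 (Sum.inr b)).im / 4 := by
  have h1 := (im_prod z).2.2 b
  have h2 := radius_le_quarter z.2.2.1
  have h3 := (radius_pos z.2.1).le
  have h4 := (im_prod z).1.le
  unfold hradius
  nlinarith

theorem continuous_hradius [Finite A] [Finite B] : Continuous (hradius : (A ⊕ B → ℂ) → ℝ) := by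
  unfold hradius
  refine continuous_radius.mul (continuous_finprod (fun b => ?_) (locallyFinite_of_finite _))
  fun_prop

/-- The point `t` is inserted, at the relative position `d t`, in a disk of radius `r` about the
point `z (p t)`; everything is then scaled by one half, in order to remain in the unit disk. -/
def insert (z : X → ℂ) (r : ℝ) (p : T → X) (d : T → ℂ) (t : T) : ℂ := (z (p t) + r * d t) / 2

theorem insert_injective [Finite X] {z : X → ℂ} (hb : ∀ x, ‖z x‖ ≤ 1) {r : ℝ}
    (hr : 0 < r) (hr' : r ≤ radius z) {p : T → X} {d : T → ℂ} (hd : ∀ t, ‖d t‖ ≤ 1)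
    (h : ∀ s t, p s = p t → d s = d t → s = t) : Function.Injective (insert z r p d) := by
  intro s t hst
  have h1 : z (p s) + r * d s = z (p t) + r * d t := by
    unfold insert at hst
    linear_combination 2 * hst
  by_cases hp : p s = p t
  · refine h s t hp ?_
    rw [hp] at h1
    have : (r : ℂ) ≠ 0 := by exact_mod_cast hr.ne'
    exact mul_left_cancel₀ this (add_left_cancel h1)
  · exfalso
    have h2 : z (p s) - z (p t) = r * (d t - d s) := by linear_combination h1
    have h3 : ‖z (p s) - z (p t)‖ ≤ r * 2 := by
      rw [h2, norm_mul, Complex.norm_real, Real.norm_of_nonneg hr.le]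
      have := norm_sub_le (d t) (d s)
      have := hd s
      have := hd t
      gcongr
      linarith
    have h4 := radius_le hb hp
    linarith

theorem insert_norm [Finite X] {z : X → ℂ} (hb : ∀ x, ‖z x‖ ≤ 1) {r : ℝ}
    (hr : 0 < r) (hr' : r ≤ radius z) {p : T → X} {d : T → ℂ} (hd : ∀ t, ‖d t‖ ≤ 1) (t : T) :
    ‖insert z r p d t‖ ≤ 1 := by
  unfold insert
  rw [norm_div]
  have h1 : ‖z (p t) + r * d t‖ ≤ ‖z (p t)‖ + r * ‖d t‖ := by
    refine (norm_add_le _ _).trans ?_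
    rw [norm_mul, Complex.norm_real, Real.norm_of_nonneg hr.le]
  have h2 := radius_le_quarter hb
  have h3 := hb (p t)
  have h4 := hd t
  have h5 : r * ‖d t‖ ≤ 1 / 4 * 1 := by gcongr; linarith
  rw [show ‖(2 : ℂ)‖ = 2 by simp]
  linarith

theorem insert_re (z : X → ℂ) (r : ℝ) (p : T → X) (d : T → ℂ) (t : T) :
    (insert z r p d t).re = ((z (p t)).re + r * (d t).re) / 2 := by
  unfold insert
  simp

theorem insert_im (z : X → ℂ) (r : ℝ) (p : T → X) (d : T → ℂ) (t : T) :
    (insert z r p d t).im = ((z (p t)).im + r * (d t).im) / 2 := by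
  unfold insert
  simp

theorem insert_sorted [Finite X] {w : Word X} {p : T → X} {g : X → List T}
    {hn : ∀ x, (g x).Nodup} {hm : ∀ x t, t ∈ g x ↔ p t = x} {z : X → ℂ} (hb : ∀ x, ‖z x‖ ≤ 1)
    {r : ℝ} (hr : 0 < r) (hr' : r ≤ radius z) {d : T → ℂ} (hd : ∀ t, ‖d t‖ ≤ 1)
    (hc : w.Sorted fun x => (z x).re)
    (hz : ∀ x y, (z x).re < (z y).re → ‖z x - z y‖ ≤ 2 * ((z y).re - (z x).re))
    (hg : ∀ x, (g x).Pairwise fun s t => (d s).re < (d t).re) :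
    (w.bind p g hn hm).Sorted fun t => (insert z r p d t).re := by
  refine Word.Sorted.bind hc (fun x => ?_) fun s t hst => ?_
  · refine List.Pairwise.imp_of_mem ?_ (hg x)
    intro s t hs ht hst
    rw [insert_re, insert_re, (hm x s).1 hs, (hm x t).1 ht]
    have := mul_lt_mul_of_pos_left hst hr
    linarith
  · rw [insert_re, insert_re]
    have h1 := hz _ _ hst
    have hne : p s ≠ p t := fun h => by rw [h] at hst; exact hst.false
    have h2 := radius_le hb hne
    have h3 : r * (d s).re ≤ r * 1 := by
      gcongr
      exact (Complex.re_le_norm _).trans (hd s)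
    have h4 : r * (-1) ≤ r * (d t).re := by
      gcongr
      have := (Complex.abs_re_le_norm (d t)).trans (hd t)
      linarith [neg_abs_le (d t).re]
    linarith

end radius

theorem Word.conf_spread {I : Type} (w : Word I) (i j : I)
    (h : (w.conf.1 i).re < (w.conf.1 j).re) :
    ‖w.conf.1 i - w.conf.1 j‖ ≤ 2 * ((w.conf.1 j).re - (w.conf.1 i).re) := by
  have h1 : w.pos i < w.pos j := h
  change ‖(w.pos i : ℂ) - (w.pos j : ℂ)‖ ≤ 2 * (w.pos j - w.pos i)
  rw [← Complex.ofReal_sub, Complex.norm_real, Real.norm_eq_abs, abs_of_neg (by linarith)]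
  linarith

theorem Word.hconf_spread {A B : Type} (w : Word (A ⊕ B)) (i j : A ⊕ B)
    (h : (w.hconf.1 i).re < (w.hconf.1 j).re) :
    ‖w.hconf.1 i - w.hconf.1 j‖ ≤ 2 * ((w.hconf.1 j).re - (w.hconf.1 i).re) := by
  have h1 : w.pos i < w.pos j := h
  have h2 := w.pos_gap h1
  have h0 : 0 ≤ 1 / ((w.list.length : ℝ) + 1) := by positivity
  refine (Complex.norm_le_abs_re_add_abs_im _).trans ?_
  have h3 : |(w.hconf.1 i - w.hconf.1 j).re| = w.pos j - w.pos i := by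
    change |w.pos i - w.pos j| = _
    rw [abs_of_neg (by linarith)]
    ring
  have h4 : |(w.hconf.1 i - w.hconf.1 j).im| ≤ 1 / ((w.list.length : ℝ) + 1) := by
    have him : ∀ x, 0 ≤ (w.hconf.1 x).im ∧ (w.hconf.1 x).im ≤ 1 / ((w.list.length : ℝ) + 1) := by
      rintro (a | b)
      · exact ⟨le_rfl, h0⟩
      · exact ⟨h0, le_rfl⟩
    rw [Complex.sub_im, abs_le]
    constructor <;> linarith [(him i).1, (him i).2, (him j).1, (him j).2]
  rw [h3]
  change _ ≤ 2 * (w.pos j - w.pos i)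
  linarith

/-! ### Relative operads in groupoids -/

/-- The underlying data of a two-coloured (relative) operad in groupoids, in the form indexed by
finite sets of inputs instead of numbers of inputs: `cl B` are the operations with closed inputs
`B` and closed output, and `op A B` are the operations with open inputs `A`, closed inputs `B` and
open output.  All structure maps are functors. -/
structure RelOperadData where
  cl : (B : Type) → [Finite B] → Type
  clGroupoid : (B : Type) → [Finite B] → Groupoid.{0} (cl B)
  op : (A B : Type) → [Finite A] → [Finite B] → Type
  opGroupoid : (A B : Type) → [Finite A] → [Finite B] → Groupoid.{0} (op A B)
  /-- action of bijections -/
  clMap : {B B' : Type} → [Finite B] → [Finite B'] → (B ≃ B') → (cl B ⥤ cl B')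
  /-- action of bijections -/
  opMap : {A A' B B' : Type} → [Finite A] → [Finite A'] → [Finite B] → [Finite B'] →
    (A ≃ A') → (B ≃ B') → (op A B ⥤ op A' B')
  clOne : cl Unit
  opOne : op Unit Empty
  /-- composition of closed operations -/
  clComp : (B : Type) → (D : B → Type) → [Finite B] → [∀ b, Finite (D b)] →
    (cl B × (∀ b, cl (D b)) ⥤ cl (Σ b, D b))
  /-- composition at all closed inputs of an operation with open output: the right module
  structure over the closed operad -/
  modComp : (A B : Type) → (D : B → Type) → [Finite A] → [Finite B] → [∀ b, Finite (D b)] →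
    (op A B × (∀ b, cl (D b)) ⥤ op A (Σ b, D b))
  /-- composition at all open inputs -/
  opComp : (A B : Type) → (C D : A → Type) → [Finite A] → [Finite B] → [∀ a, Finite (C a)] →
    [∀ a, Finite (D a)] → (op A B × (∀ a, op (C a) (D a)) ⥤ op (Σ a, C a) (B ⊕ Σ a, D a))

attribute [instance] RelOperadData.clGroupoid RelOperadData.opGroupoid

/-- The effect of a functor on arrows (objects being included through their identities). -/
def arr {C D : Type} [Category.{0} C] [Category.{0} D] (F : C ⥤ D) (f : Arrow C) : Arrow D :=
  F.mapArrow.obj f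

/-- The arrow of a product category given by an arrow `f` and a family of arrows `g`. -/
def arrTuple {C I : Type} {D : I → Type} [Category.{0} C] [∀ i, Category.{0} (D i)]
    (f : Arrow C) (g : ∀ i, Arrow (D i)) : Arrow (C × ∀ i, D i) :=
  Arrow.mk (X := (f.left, fun i => (g i).left)) (Y := (f.right, fun i => (g i).right))
    (f.hom, fun i => (g i).hom)

namespace RelOperadData

variable (P : RelOperadData) {A A' B B' : Type} [Finite A] [Finite A'] [Finite B] [Finite B']

/-- `clMap` on arrows. -/
def clM (e : B ≃ B') : Arrow (P.cl B) → Arrow (P.cl B') := arr (P.clMap e)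

/-- `opMap` on arrows. -/
def opM (e : A ≃ A') (e' : B ≃ B') : Arrow (P.op A B) → Arrow (P.op A' B') := arr (P.opMap e e')

/-- The closed unit. -/
def cl1 : Arrow (P.cl Unit) := Arrow.mk (𝟙 P.clOne)

/-- The open unit. -/
def op1 : Arrow (P.op Unit Empty) := Arrow.mk (𝟙 P.opOne)

/-- `clComp` on arrows. -/
def clC {D : B → Type} [∀ b, Finite (D b)] (f : Arrow (P.cl B)) (g : ∀ b, Arrow (P.cl (D b))) :
    Arrow (P.cl (Σ b, D b)) := arr (P.clComp B D) (arrTuple f g)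

/-- `modComp` on arrows. -/
def modC {D : B → Type} [∀ b, Finite (D b)] (q : Arrow (P.op A B))
    (g : ∀ b, Arrow (P.cl (D b))) : Arrow (P.op A (Σ b, D b)) :=
  arr (P.modComp A B D) (arrTuple q g)

/-- `opComp` on arrows. -/
def opC {C D : A → Type} [∀ a, Finite (C a)] [∀ a, Finite (D a)] (q : Arrow (P.op A B))
    (r : ∀ a, Arrow (P.op (C a) (D a))) : Arrow (P.op (Σ a, C a) (B ⊕ Σ a, D a)) :=
  arr (P.opComp A B C D) (arrTuple q r)

end RelOperadData

/-- The reindexing in the left unit law. -/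
def unitEquiv (B : Type) : B ≃ (Σ _ : Unit, B) := (Equiv.uniqueSigma fun _ : Unit => B).symm

/-- The reindexing in the right unit law. -/
def unitEquiv' (B : Type) : B ≃ (Σ _ : B, Unit) := (Equiv.sigmaUnique B fun _ => Unit).symm

/-- The reindexing of closed inputs in the right unit law for open operations. -/
def unitEquiv'' (A B : Type) : B ≃ B ⊕ (Σ _ : A, Empty) :=
  have : IsEmpty (Σ _ : A, Empty) := ⟨fun x => x.2.elim⟩
  (Equiv.sumEmpty B (Σ _ : A, Empty)).symm

/-- The reindexing of closed inputs in the associativity of open composition. -/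
def assocEquiv {A B : Type} {C D : A → Type} (F : ∀ a, C a → Type) :
    ((B ⊕ Σ a, D a) ⊕ Σ ac : (Σ a, C a), F ac.1 ac.2) ≃ B ⊕ Σ a, (D a ⊕ Σ c, F a c) :=
  (Equiv.sumAssoc _ _ _).trans (Equiv.sumCongr (Equiv.refl B)
    ((Equiv.sumCongr (Equiv.refl _) (Equiv.sigmaAssoc F)).trans
      (Equiv.sigmaSumDistrib D fun a => Σ c, F a c).symm))

/-- The reindexing of closed inputs when open composition is compatible with the right module
structure. -/
def modEquiv {A B : Type} {D : A → Type} (E : (B ⊕ Σ a, D a) → Type) :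
    (Σ x, E x) ≃ (Σ b, E (Sum.inl b)) ⊕ Σ a, Σ d, E (Sum.inr ⟨a, d⟩) :=
  (Equiv.sumSigmaDistrib E).trans (Equiv.sumCongr (Equiv.refl _)
    (Equiv.sigmaAssoc fun a d => E (Sum.inr ⟨a, d⟩)))

/-- The axioms of a relative operad in groupoids: `cl` is a symmetric operad, and `op` is a
symmetric operad in right modules over it.  All identities are identities between arrows, so that
they hold for objects and for morphisms. -/
structure RelOperadData.IsRelOperad (P : RelOperadData) : Prop where
  clM_refl : ∀ (B : Type) [Finite B] (f : Arrow (P.cl B)), P.clM (Equiv.refl B) f = f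
  clM_trans : ∀ (B B' B'' : Type) [Finite B] [Finite B'] [Finite B''] (e : B ≃ B') (e' : B' ≃ B'')
    (f : Arrow (P.cl B)), P.clM (e.trans e') f = P.clM e' (P.clM e f)
  clC_outer : ∀ (B B' : Type) (D : B' → Type) [Finite B] [Finite B'] [∀ b, Finite (D b)]
    (e : B ≃ B') (f : Arrow (P.cl B)) (g : ∀ b, Arrow (P.cl (D b))),
    P.clC (P.clM e f) g = P.clM (Equiv.sigmaCongrLeft e) (P.clC f fun b => g (e b))
  clC_inner : ∀ (B : Type) (D D' : B → Type) [Finite B] [∀ b, Finite (D b)] [∀ b, Finite (D' b)]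
    (e : ∀ b, D b ≃ D' b) (f : Arrow (P.cl B)) (g : ∀ b, Arrow (P.cl (D b))),
    P.clC f (fun b => P.clM (e b) (g b)) = P.clM (Equiv.sigmaCongrRight e) (P.clC f g)
  one_clC : ∀ (B : Type) [Finite B] (f : Arrow (P.cl B)),
    P.clC P.cl1 (fun _ => f) = P.clM (unitEquiv B) f
  clC_one : ∀ (B : Type) [Finite B] (f : Arrow (P.cl B)),
    P.clC f (fun _ => P.cl1) = P.clM (unitEquiv' B) f
  clC_assoc : ∀ (B : Type) (D : B → Type) (E : ∀ b, D b → Type) [Finite B] [∀ b, Finite (D b)]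
    [∀ b d, Finite (E b d)] (f : Arrow (P.cl B)) (g : ∀ b, Arrow (P.cl (D b)))
    (h : ∀ b d, Arrow (P.cl (E b d))),
    P.clM (Equiv.sigmaAssoc E) (P.clC (P.clC f g) fun bd => h bd.1 bd.2)
      = P.clC f fun b => P.clC (g b) (h b)
  opM_refl : ∀ (A B : Type) [Finite A] [Finite B] (q : Arrow (P.op A B)),
    P.opM (Equiv.refl A) (Equiv.refl B) q = q
  opM_trans : ∀ (A A' A'' B B' B'' : Type) [Finite A] [Finite A'] [Finite A''] [Finite B]
    [Finite B'] [Finite B''] (eA : A ≃ A') (eA' : A' ≃ A'') (eB : B ≃ B') (eB' : B' ≃ B'')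
    (q : Arrow (P.op A B)),
    P.opM (eA.trans eA') (eB.trans eB') q = P.opM eA' eB' (P.opM eA eB q)
  modC_outer : ∀ (A A' B B' : Type) (D : B' → Type) [Finite A] [Finite A'] [Finite B] [Finite B']
    [∀ b, Finite (D b)] (eA : A ≃ A') (eB : B ≃ B') (q : Arrow (P.op A B))
    (g : ∀ b, Arrow (P.cl (D b))),
    P.modC (P.opM eA eB q) g
      = P.opM eA (Equiv.sigmaCongrLeft eB) (P.modC q fun b => g (eB b))
  modC_inner : ∀ (A B : Type) (D D' : B → Type) [Finite A] [Finite B] [∀ b, Finite (D b)]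
    [∀ b, Finite (D' b)] (e : ∀ b, D b ≃ D' b) (q : Arrow (P.op A B))
    (g : ∀ b, Arrow (P.cl (D b))),
    P.modC q (fun b => P.clM (e b) (g b))
      = P.opM (Equiv.refl A) (Equiv.sigmaCongrRight e) (P.modC q g)
  modC_one : ∀ (A B : Type) [Finite A] [Finite B] (q : Arrow (P.op A B)),
    P.modC q (fun _ => P.cl1) = P.opM (Equiv.refl A) (unitEquiv' B) q
  modC_assoc : ∀ (A B : Type) (D : B → Type) (E : ∀ b, D b → Type) [Finite A] [Finite B]
    [∀ b, Finite (D b)] [∀ b d, Finite (E b d)] (q : Arrow (P.op A B))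
    (g : ∀ b, Arrow (P.cl (D b))) (h : ∀ b d, Arrow (P.cl (E b d))),
    P.opM (Equiv.refl A) (Equiv.sigmaAssoc E) (P.modC (P.modC q g) fun bd => h bd.1 bd.2)
      = P.modC q fun b => P.clC (g b) (h b)
  opC_outer : ∀ (A A' B B' : Type) (C D : A' → Type) [Finite A] [Finite A'] [Finite B] [Finite B']
    [∀ a, Finite (C a)] [∀ a, Finite (D a)] (eA : A ≃ A') (eB : B ≃ B') (q : Arrow (P.op A B))
    (r : ∀ a, Arrow (P.op (C a) (D a))),
    P.opC (P.opM eA eB q) r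
      = P.opM (Equiv.sigmaCongrLeft eA) (Equiv.sumCongr eB (Equiv.sigmaCongrLeft eA))
          (P.opC q fun a => r (eA a))
  opC_inner : ∀ (A B : Type) (C C' D D' : A → Type) [Finite A] [Finite B] [∀ a, Finite (C a)]
    [∀ a, Finite (C' a)] [∀ a, Finite (D a)] [∀ a, Finite (D' a)] (eC : ∀ a, C a ≃ C' a)
    (eD : ∀ a, D a ≃ D' a) (q : Arrow (P.op A B)) (r : ∀ a, Arrow (P.op (C a) (D a))),
    P.opC q (fun a => P.opM (eC a) (eD a) (r a))
      = P.opM (Equiv.sigmaCongrRight eC) (Equiv.sumCongr (Equiv.refl B) (Equiv.sigmaCongrRight eD))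
          (P.opC q r)
  one_opC : ∀ (A B : Type) [Finite A] [Finite B] (q : Arrow (P.op A B)),
    P.opC P.op1 (fun _ => q)
      = P.opM (unitEquiv A) ((unitEquiv B).trans (Equiv.emptySum Empty _).symm) q
  opC_one : ∀ (A B : Type) [Finite A] [Finite B] (q : Arrow (P.op A B)),
    P.opC q (fun _ => P.op1) = P.opM (unitEquiv' A) (unitEquiv'' A B) q
  opC_assoc : ∀ (A B : Type) (C D : A → Type) (C' D' : ∀ a, C a → Type) [Finite A] [Finite B]
    [∀ a, Finite (C a)] [∀ a, Finite (D a)] [∀ a c, Finite (C' a c)] [∀ a c, Finite (D' a c)]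
    (q : Arrow (P.op A B)) (r : ∀ a, Arrow (P.op (C a) (D a)))
    (s : ∀ a c, Arrow (P.op (C' a c) (D' a c))),
    P.opM (Equiv.sigmaAssoc C') (assocEquiv D') (P.opC (P.opC q r) fun ac => s ac.1 ac.2)
      = P.opC q fun a => P.opC (r a) (s a)
  modC_opC : ∀ (A B : Type) (C D : A → Type) (E : (B ⊕ Σ a, D a) → Type) [Finite A] [Finite B]
    [∀ a, Finite (C a)] [∀ a, Finite (D a)] [∀ x, Finite (E x)]
    (q : Arrow (P.op A B)) (r : ∀ a, Arrow (P.op (C a) (D a))) (g : ∀ x, Arrow (P.cl (E x))),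
    P.opM (Equiv.refl _) (modEquiv E) (P.modC (P.opC q r) g)
      = P.opC (P.modC q fun b => g (Sum.inl b))
          fun a => P.modC (r a) fun d => g (Sum.inr ⟨a, d⟩)

/-- Morphisms of relative operads in groupoids. -/
structure RelOperadHom (P Q : RelOperadData) where
  cl : (B : Type) → [Finite B] → (P.cl B ⥤ Q.cl B)
  op : (A B : Type) → [Finite A] → [Finite B] → (P.op A B ⥤ Q.op A B)
  map_clM : ∀ (B B' : Type) [Finite B] [Finite B'] (e : B ≃ B') (f : Arrow (P.cl B)),
    arr (cl B') (P.clM e f) = Q.clM e (arr (cl B) f)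
  map_opM : ∀ (A A' B B' : Type) [Finite A] [Finite A'] [Finite B] [Finite B'] (eA : A ≃ A')
    (eB : B ≃ B') (q : Arrow (P.op A B)),
    arr (op A' B') (P.opM eA eB q) = Q.opM eA eB (arr (op A B) q)
  map_cl1 : (cl Unit).obj P.clOne = Q.clOne
  map_op1 : (op Unit Empty).obj P.opOne = Q.opOne
  map_clC : ∀ (B : Type) (D : B → Type) [Finite B] [∀ b, Finite (D b)] (f : Arrow (P.cl B))
    (g : ∀ b, Arrow (P.cl (D b))),
    arr (cl _) (P.clC f g) = Q.clC (arr (cl B) f) fun b => arr (cl (D b)) (g b)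
  map_modC : ∀ (A B : Type) (D : B → Type) [Finite A] [Finite B] [∀ b, Finite (D b)]
    (q : Arrow (P.op A B)) (g : ∀ b, Arrow (P.cl (D b))),
    arr (op _ _) (P.modC q g) = Q.modC (arr (op A B) q) fun b => arr (cl (D b)) (g b)
  map_opC : ∀ (A B : Type) (C D : A → Type) [Finite A] [Finite B] [∀ a, Finite (C a)]
    [∀ a, Finite (D a)] (q : Arrow (P.op A B)) (r : ∀ a, Arrow (P.op (C a) (D a))),
    arr (op _ _) (P.opC q r) = Q.opC (arr (op A B) q) fun a => arr (op (C a) (D a)) (r a)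

/-- A categorical equivalence: an equivalence of categories in each arity, for both colours. -/
def RelOperadHom.IsCategoricalEquivalence {P Q : RelOperadData} (F : RelOperadHom P Q) : Prop :=
  (∀ (B : Type) [Finite B], (F.cl B).IsEquivalence) ∧
    ∀ (A B : Type) [Finite A] [Finite B], (F.op A B).IsEquivalence

/-! ### The operads of coloured braids and of coloured permutations and braids -/

/-- A functor to an induced category: a functor to the ambient category, together with chosen
objects of the induced category isomorphic to its values. -/
def liftTo {C D O : Type} [Category.{0} C] [Category.{0} D] (F : C ⥤ D) (p : O → D) (g : C → O)
    (e : ∀ c, F.obj c ≅ p (g c)) : C ⥤ InducedCategory D p where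
  obj := g
  map f := InducedCategory.homMk ((e _).inv ≫ F.map f ≫ (e _).hom)
  map_id c := by
    apply InducedCategory.hom_ext
    simp
  map_comp f f' := by
    apply InducedCategory.hom_ext
    simp

/-- The fundamental groupoid functor preserves binary products. -/
def piProd (X Y : Type) [TopologicalSpace X] [TopologicalSpace Y] :
    FundamentalGroupoid X × FundamentalGroupoid Y ⥤ FundamentalGroupoid (X × Y) where
  obj p := ⟨(p.1.as, p.2.as)⟩
  map f := Path.Homotopic.prod f.1 f.2
  map_id _ := rfl
  map_comp f g := (Path.Homotopic.comp_prod_eq_prod_comp f.1 f.2 g.1 g.2).symm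

/-- The fundamental groupoid functor preserves products. -/
def piPi {I : Type} (X : I → Type) [∀ i, TopologicalSpace (X i)] :
    (∀ i, FundamentalGroupoid (X i)) ⥤ FundamentalGroupoid (∀ i, X i) where
  obj p := ⟨fun i => (p i).as⟩
  map f := Path.Homotopic.pi f
  map_id p := by
    change (Path.Homotopic.pi fun i => Path.Homotopic.Quotient.mk (Path.refl (p i).as)) = _
    rw [Path.Homotopic.pi_lift]
    rfl
  map_comp f g := (Path.Homotopic.comp_pi_eq_pi_comp f g).symm

theorem continuous_point {X I : Type} [TopologicalSpace X] {P : (I → ℂ) → Prop}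
    {φ : X → {z : I → ℂ // P z}} (hφ : Continuous φ) (i : I) : Continuous fun x => (φ x).1 i :=
  (continuous_apply i).comp (continuous_subtype_val.comp hφ)

theorem continuous_insert {X I T : Type} [TopologicalSpace X] {z : X → I → ℂ} {r : X → ℝ}
    {p : T → I} {d : X → T → ℂ} (hz : ∀ i, Continuous fun x => z x i) (hr : Continuous r)
    (hd : ∀ t, Continuous fun x => d x t) (t : T) :
    Continuous fun x => insert (z x) (r x) p (d x) t :=
  ((hz (p t)).add ((Complex.continuous_ofReal.comp hr).mul (hd t))).div_const 2

/-- Coloured braids: the restriction of the fundamental groupoid of the configuration space of the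
disk to the base configurations of the words. -/
abbrev CoB (I : Type) : Type :=
  InducedCategory (FundamentalGroupoid (Conf I)) fun w : Word I => ⟨w.conf⟩

/-- Coloured permutations and braids: the restriction of the fundamental groupoid of the
configuration space of the half disk to the base configurations of the bicoloured words. -/
abbrev CoPB (A B : Type) : Type :=
  InducedCategory (FundamentalGroupoid (HConf A B)) fun w : Word (A ⊕ B) => ⟨w.hconf⟩

/-- An isomorphism between the points of `HConf A B` given by two configurations that have the same
left-to-right order `w` on all points. -/
def HConf.iso' {A B : Type} (w : Word (A ⊕ B)) {z z' : HConf A B}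
    (h : w.Sorted fun x => (z.1 x).re) (h' : w.Sorted fun x => (z'.1 x).re) :
    (⟨z⟩ : FundamentalGroupoid (HConf A B)) ≅ ⟨z'⟩ :=
  HConf.iso w.resL w.resR h.resL h'.resL h.resR h'.resR

namespace CoB

variable {I J B : Type} {D : B → Type}

/-- Relabelling of configurations. -/
def relabelMap (e : I ≃ J) : C(Conf I, Conf J) where
  toFun z := ⟨fun j => z.1 (e.symm j), z.2.1.comp e.symm.injective, fun j => z.2.2 _⟩
  continuous_toFun := by
    exact Continuous.subtype_mk (continuous_pi fun j => continuous_point continuous_id _) _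

/-- Relabelling of coloured braids. -/
def map (e : I ≃ J) : CoB I ⥤ CoB J :=
  liftTo (inducedFunctor _ ⋙ FundamentalGroupoid.map (relabelMap e)) _ (fun w => Word.map e w)
    fun w => Conf.iso (Word.map e w) (Word.conf_sorted w |>.map e) (Word.conf_sorted _)

/-- Block substitution of words. -/
def compWord (w : Word B) (v : ∀ b, Word (D b)) : Word (Σ b, D b) :=
  w.bind Sigma.fst (fun b => (v b).list.map (Sigma.mk b))
    (fun b => (v b).nodup.map sigma_mk_injective) (by
      rintro b ⟨b', d⟩
      constructor
      · intro h
        obtain ⟨d', -, h2⟩ := List.mem_map.1 h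
        exact (congrArg Sigma.fst h2).symm
      · rintro rfl
        exact List.mem_map.2 ⟨d, (v _).complete d, rfl⟩)

/-- Insertion of configurations in the neighbourhoods of the points of a configuration. -/
def compMap (D : B → Type) [Finite B] : C(Conf B × (∀ b, Conf (D b)), Conf (Σ b, D b)) where
  toFun q := ⟨insert q.1.1 (radius q.1.1) Sigma.fst fun t => (q.2 t.1).1 t.2,
    insert_injective q.1.2.2 (radius_pos q.1.2.1) le_rfl (fun t => (q.2 t.1).2.2 t.2) (by
      rintro ⟨b, d⟩ ⟨b', d'⟩ h h'
      obtain rfl : b = b' := h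
      exact congrArg _ ((q.2 b).2.1 h')),
    insert_norm q.1.2.2 (radius_pos q.1.2.1) le_rfl fun t => (q.2 t.1).2.2 t.2⟩
  continuous_toFun := by
    have hr : Continuous fun q : Conf B × (∀ b, Conf (D b)) => radius q.1.1 :=
      continuous_radius.comp (continuous_subtype_val.comp continuous_fst)
    exact Continuous.subtype_mk (continuous_pi fun t => continuous_insert
      (fun _ => continuous_point continuous_fst _) hr
      (fun t => continuous_point ((continuous_apply t.1).comp continuous_snd) _) t) _

/-- Operadic composition of coloured braids: insertion in tubular neighbourhoods of the strands. -/
def comp (D : B → Type) [Finite B] : CoB B × (∀ b, CoB (D b)) ⥤ CoB (Σ b, D b) :=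
  liftTo ((inducedFunctor _).prod (Functor.pi fun _ => inducedFunctor _) ⋙
      (𝟭 _).prod (piPi fun b => Conf (D b)) ⋙ piProd _ _ ⋙ FundamentalGroupoid.map (compMap D)) _
    (fun q => compWord q.1 q.2)
    fun q => Conf.iso (compWord q.1 q.2)
      (insert_sorted (Word.conf q.1).2.2 (radius_pos (Word.conf q.1).2.1) le_rfl
        (fun t => (Word.conf (q.2 t.1)).2.2 t.2) (Word.conf_sorted q.1) (Word.conf_spread q.1)
        fun b => List.pairwise_map.2 (Word.conf_sorted (q.2 b)))
      (Word.conf_sorted _)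

/-- Two configurations are placed side by side. -/
def appendMap (A B : Type) : C(Conf A × Conf B, Conf (A ⊕ B)) where
  toFun q := ⟨Sum.elim (fun a => q.1.1 a / 4 - 1 / 2) (fun b => q.2.1 b / 4 + 1 / 2), by
      have ha : ∀ a, (q.1.1 a / 4 - 1 / 2 : ℂ).re < 0 := fun a => by
        have := (Complex.re_le_norm _).trans (q.1.2.2 a)
        simp
        linarith
      have hb : ∀ b, 0 < (q.2.1 b / 4 + 1 / 2 : ℂ).re := fun b => by
        have h1 := (Complex.abs_re_le_norm _).trans (q.2.2.2 b)
        have h2 := neg_abs_le (q.2.1 b).re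
        simp
        linarith
      rintro (a | b) (a' | b') h
      · refine congrArg _ (q.1.2.1 ?_)
        simp only [Sum.elim_inl] at h
        linear_combination 4 * h
      · have := congrArg Complex.re h
        simp only [Sum.elim_inl, Sum.elim_inr] at this
        linarith [ha a, hb b']
      · have := congrArg Complex.re h
        simp only [Sum.elim_inl, Sum.elim_inr] at this
        linarith [ha a', hb b]
      · refine congrArg _ (q.2.2.1 ?_)
        simp only [Sum.elim_inr] at h
        linear_combination 4 * h, by
      rintro (a | b)
      · refine (norm_sub_le _ _).trans ?_
        have := q.1.2.2 a
        rw [norm_div]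
        norm_num
        linarith
      · refine (norm_add_le _ _).trans ?_
        have := q.2.2.2 b
        rw [norm_div]
        norm_num
        linarith⟩
  continuous_toFun := by
    refine Continuous.subtype_mk (continuous_pi fun t => ?_) _
    rcases t with a | b
    · exact ((continuous_point continuous_fst a).div_const 4).sub continuous_const
    · exact ((continuous_point continuous_snd b).div_const 4).add continuous_const

/-- Concatenation of coloured braids. -/
def append (A B : Type) : CoB A × CoB B ⥤ CoB (A ⊕ B) :=
  liftTo ((inducedFunctor _).prod (inducedFunctor _) ⋙ piProd _ _ ⋙
      FundamentalGroupoid.map (appendMap A B)) _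
    (fun q => Word.append q.1 q.2)
    fun q => Conf.iso (Word.append q.1 q.2)
      (Word.Sorted.append
        ((Word.conf_sorted q.1).imp fun {a b} h => by
          change ((Word.conf q.1).1 a / 4 - 1 / 2 : ℂ).re < ((Word.conf q.1).1 b / 4 - 1 / 2 : ℂ).re
          have h' : ((Word.conf q.1).1 a).re < ((Word.conf q.1).1 b).re := h
          simp
          linarith)
        ((Word.conf_sorted q.2).imp fun {a b} h => by
          change ((Word.conf q.2).1 a / 4 + 1 / 2 : ℂ).re < ((Word.conf q.2).1 b / 4 + 1 / 2 : ℂ).re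
          have h' : ((Word.conf q.2).1 a).re < ((Word.conf q.2).1 b).re := h
          simp
          linarith)
        fun a b => by
          have h1 := (Complex.re_le_norm _).trans ((Word.conf q.1).2.2 a)
          have h2 := (Complex.abs_re_le_norm _).trans ((Word.conf q.2).2.2 b)
          have h3 := neg_abs_le ((Word.conf q.2).1 b).re
          change ((Word.conf q.1).1 a / 4 - 1 / 2 : ℂ).re < ((Word.conf q.2).1 b / 4 + 1 / 2 : ℂ).re
          simp
          linarith)
      (Word.conf_sorted _)

end CoB

namespace CoPB

variable {A A' B B' : Type}

/-- Relabelling of configurations. -/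
def relabelMap (e : A ≃ A') (e' : B ≃ B') : C(HConf A B, HConf A' B') where
  toFun z := ⟨fun x => z.1 ((Equiv.sumCongr e e').symm x),
    z.2.1.comp (Equiv.sumCongr e e').symm.injective, fun x => z.2.2.1 _,
    fun a => z.2.2.2.1 (e.symm a), fun b => z.2.2.2.2 (e'.symm b)⟩
  continuous_toFun := by
    exact Continuous.subtype_mk (continuous_pi fun j => continuous_point continuous_id _) _

/-- Relabelling. -/
def map (e : A ≃ A') (e' : B ≃ B') : CoPB A B ⥤ CoPB A' B' :=
  liftTo (inducedFunctor _ ⋙ FundamentalGroupoid.map (relabelMap e e')) _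
    (fun w => Word.map (Equiv.sumCongr e e') w)
    fun w => HConf.iso' (Word.map (Equiv.sumCongr e e') w)
      ((Word.hconf_sorted w).map (Equiv.sumCongr e e')) (Word.hconf_sorted _)

/-- Substitution of words for the aerial letters. -/
def modCompWord {D : B → Type} (w : Word (A ⊕ B)) (v : ∀ b, Word (D b)) : Word (A ⊕ Σ b, D b) :=
  w.bind (Sum.map id Sigma.fst)
    (Sum.elim (fun a => [Sum.inl a]) fun b => (v b).list.map fun d => Sum.inr ⟨b, d⟩)
    (by
      rintro (a | b)
      · exact List.nodup_singleton _
      · exact (v b).nodup.map (Sum.inr_injective.comp sigma_mk_injective))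
    (by
      rintro (a | b) (a' | ⟨b', d⟩)
      · simp
      · simp
      · simp
      · simp only [Sum.elim_inr, List.mem_map, Sum.map_inr, Sum.inr.injEq]
        constructor
        · rintro ⟨d', -, h⟩
          exact (congrArg Sigma.fst h).symm
        · rintro rfl
          exact ⟨d, (v _).complete d, rfl⟩)

/-- Substitution of bicoloured words for the terrestrial letters. -/
def opCompWord {C D : A → Type} (w : Word (A ⊕ B)) (v : ∀ a, Word (C a ⊕ D a)) :
    Word ((Σ a, C a) ⊕ (B ⊕ Σ a, D a)) :=
  w.bind (Sum.elim (fun t => Sum.inl t.1) (Sum.elim Sum.inr fun t => Sum.inl t.1))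
    (Sum.elim (fun a => (v a).list.map (Sum.map (Sigma.mk a) fun d => Sum.inr ⟨a, d⟩))
      fun b => [Sum.inr (Sum.inl b)])
    (by
      rintro (a | b)
      · exact (v a).nodup.map (Function.Injective.sumMap sigma_mk_injective
          (Sum.inr_injective.comp sigma_mk_injective))
      · exact List.nodup_singleton _)
    (by
      rintro (a | b) (⟨a', c⟩ | (b' | ⟨a', d⟩))
      · simp only [Sum.elim_inl, List.mem_map, Sum.inl.injEq]
        constructor
        · rintro ⟨(c' | d'), -, h⟩
          · exact (congrArg Sigma.fst (Sum.inl_injective h)).symm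
          · simp at h
        · rintro rfl
          exact ⟨Sum.inl c, (v _).complete _, rfl⟩
      · simp
      · simp only [Sum.elim_inl, Sum.elim_inr, List.mem_map, Sum.inl.injEq]
        constructor
        · rintro ⟨(c' | d'), -, h⟩
          · simp at h
          · exact (congrArg Sigma.fst (Sum.inr_injective (Sum.inr_injective h))).symm
        · rintro rfl
          exact ⟨Sum.inr d, (v _).complete _, rfl⟩
      · simp
      · simp [eq_comm]
      · simp)

/-- Insertion of configurations of the disk in neighbourhoods of the aerial points. -/
def modCompMap (A : Type) (D : B → Type) [Finite A] [Finite B] :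
    C(HConf A B × (∀ b, Conf (D b)), HConf A (Σ b, D b)) where
  toFun q := ⟨insert q.1.1 (hradius q.1.1) (Sum.map id Sigma.fst)
      (Sum.elim (fun _ => 0) fun t => (q.2 t.1).1 t.2), by
    have hd : ∀ t : A ⊕ Σ b, D b, ‖(Sum.elim (fun _ => 0) fun t => (q.2 t.1).1 t.2 :
        A ⊕ (Σ b, D b) → ℂ) t‖ ≤ 1 := by
      rintro (a | t)
      · simp
      · exact (q.2 t.1).2.2 t.2
    refine ⟨insert_injective q.1.2.2.1 (hradius_pos q.1) (hradius_le q.1) hd ?_,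
      insert_norm q.1.2.2.1 (hradius_pos q.1) (hradius_le q.1) hd, fun a => ?_, ?_⟩
    · rintro (a | ⟨b, d⟩) (a' | ⟨b', d'⟩) h h'
      · simpa using h
      · simp at h
      · simp at h
      · obtain rfl : b = b' := by simpa using h
        exact congrArg _ (congrArg _ ((q.2 b).2.1 h'))
    · rw [insert_im]
      simp [q.1.2.2.2.1 a]
    · rintro ⟨b, d⟩
      rw [insert_im]
      simp only [Sum.map_inr, Sum.elim_inr]
      have h1 := hradius_le_im q.1 b
      have h2 := hradius_pos q.1
      have h3 := (Complex.abs_im_le_norm _).trans ((q.2 b).2.2 d)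
      have h4 := neg_abs_le ((q.2 b).1 d).im
      have h5 := q.1.2.2.2.2 b
      nlinarith⟩
  continuous_toFun := by
    have hr : Continuous fun q : HConf A B × (∀ b, Conf (D b)) => hradius q.1.1 :=
      continuous_hradius.comp (continuous_subtype_val.comp continuous_fst)
    refine Continuous.subtype_mk (continuous_pi fun t => continuous_insert
      (fun _ => continuous_point continuous_fst _) hr ?_ t) _
    rintro (a | t)
    · exact continuous_const
    · exact continuous_point ((continuous_apply t.1).comp continuous_snd) _

/-- The right module structure: coloured braids are inserted in tubular neighbourhoods of the
aerial strands. -/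
def modComp (A : Type) (D : B → Type) [Finite A] [Finite B] :
    CoPB A B × (∀ b, CoB (D b)) ⥤ CoPB A (Σ b, D b) :=
  liftTo ((inducedFunctor _).prod (Functor.pi fun _ => inducedFunctor _) ⋙
      (𝟭 _).prod (piPi fun b => Conf (D b)) ⋙ piProd _ _ ⋙
      FundamentalGroupoid.map (modCompMap A D)) _
    (fun q => modCompWord q.1 q.2)
    fun q => HConf.iso' (modCompWord q.1 q.2)
      (insert_sorted (Word.hconf q.1).2.2.1 (hradius_pos (Word.hconf q.1))
        (hradius_le (Word.hconf q.1))
        (by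
          rintro (a | t)
          · simp
          · exact (Word.conf (q.2 t.1)).2.2 t.2)
        (Word.hconf_sorted q.1) (Word.hconf_spread q.1)
        (by
          rintro (a | b)
          · exact List.pairwise_singleton _ _
          · exact List.pairwise_map.2 (Word.conf_sorted (q.2 b))))
      (Word.hconf_sorted _)

/-- Insertion of configurations of the half disk in neighbourhoods of the terrestrial points. -/
def opCompMap (B : Type) (C D : A → Type) [Finite A] [Finite B] :
    C(HConf A B × (∀ a, HConf (C a) (D a)), HConf (Σ a, C a) (B ⊕ Σ a, D a)) where
  toFun q := ⟨insert q.1.1 (radius q.1.1)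
      (Sum.elim (fun t => Sum.inl t.1) (Sum.elim Sum.inr fun t => Sum.inl t.1))
      (Sum.elim (fun t => (q.2 t.1).1 (Sum.inl t.2))
        (Sum.elim (fun _ => 0) fun t => (q.2 t.1).1 (Sum.inr t.2))), by
    have hd : ∀ t : (Σ a, C a) ⊕ (B ⊕ Σ a, D a),
        ‖(Sum.elim (fun t => (q.2 t.1).1 (Sum.inl t.2)) (Sum.elim (fun _ => 0)
          fun t => (q.2 t.1).1 (Sum.inr t.2)) : (Σ a, C a) ⊕ (B ⊕ Σ a, D a) → ℂ) t‖ ≤ 1 := by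
      rintro (t | (b | t))
      · exact (q.2 t.1).2.2.1 _
      · simp
      · exact (q.2 t.1).2.2.1 _
    refine ⟨insert_injective q.1.2.2.1 (radius_pos q.1.2.1) le_rfl hd ?_,
      insert_norm q.1.2.2.1 (radius_pos q.1.2.1) le_rfl hd, ?_, ?_⟩
    · rintro (⟨a, c⟩ | (b | ⟨a, d⟩)) (⟨a', c'⟩ | (b' | ⟨a', d'⟩)) h h'
      · obtain rfl : a = a' := by simpa using h
        have hc : c = c' := Sum.inl_injective ((q.2 a).2.1 h')
        rw [hc]
      · simp at h
      · obtain rfl : a = a' := by simpa using h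
        have := (q.2 a).2.1 h'
        simp at this
      · simp at h
      · have : b = b' := by simpa using h
        rw [this]
      · simp at h
      · obtain rfl : a = a' := by simpa using h
        have := (q.2 a).2.1 h'
        simp at this
      · simp at h
      · obtain rfl : a = a' := by simpa using h
        have hc : d = d' := Sum.inr_injective ((q.2 a).2.1 h')
        rw [hc]
    · rintro ⟨a, c⟩
      rw [insert_im]
      simp [q.1.2.2.2.1 a, (q.2 a).2.2.2.1 c]
    · rintro (b | ⟨a, d⟩)
      · rw [insert_im]
        simp [q.1.2.2.2.2 b]
      · rw [insert_im]
        have := mul_pos (radius_pos q.1.2.1) ((q.2 a).2.2.2.2 d)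
        simp only [Sum.elim_inr, q.1.2.2.2.1 a]
        linarith⟩
  continuous_toFun := by
    have hr : Continuous fun q : HConf A B × (∀ a, HConf (C a) (D a)) => radius q.1.1 :=
      continuous_radius.comp (continuous_subtype_val.comp continuous_fst)
    refine Continuous.subtype_mk (continuous_pi fun t => continuous_insert
      (fun _ => continuous_point continuous_fst _) hr ?_ t) _
    rintro (t | (b | t))
    · exact continuous_point ((continuous_apply t.1).comp continuous_snd) _
    · exact continuous_const
    · exact continuous_point ((continuous_apply t.1).comp continuous_snd) _

/-- Open composition: insertion in tubular neighbourhoods of the terrestrial strands. -/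
def opComp (B : Type) (C D : A → Type) [Finite A] [Finite B] :
    CoPB A B × (∀ a, CoPB (C a) (D a)) ⥤ CoPB (Σ a, C a) (B ⊕ Σ a, D a) :=
  liftTo ((inducedFunctor _).prod (Functor.pi fun _ => inducedFunctor _) ⋙
      (𝟭 _).prod (piPi fun a => HConf (C a) (D a)) ⋙ piProd _ _ ⋙
      FundamentalGroupoid.map (opCompMap B C D)) _
    (fun q => opCompWord q.1 q.2)
    fun q => HConf.iso' (opCompWord q.1 q.2)
      (insert_sorted (Word.hconf q.1).2.2.1 (radius_pos (Word.hconf q.1).2.1) le_rfl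
        (by
          rintro (t | (b | t))
          · exact (Word.hconf (q.2 t.1)).2.2.1 _
          · simp
          · exact (Word.hconf (q.2 t.1)).2.2.1 _)
        (Word.hconf_sorted q.1) (Word.hconf_spread q.1)
        (by
          rintro (a | b)
          · refine List.pairwise_map.2 ((Word.hconf_sorted (q.2 a)).imp ?_)
            rintro (c | d) (c' | d') h <;> exact h
          · exact List.pairwise_singleton _ _))
      (Word.hconf_sorted _)

/-- Forgetting the colours of the points. -/
def forgetMap (A B : Type) : C(HConf A B, Conf (A ⊕ B)) where
  toFun z := ⟨z.1, z.2.1, z.2.2.1⟩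
  continuous_toFun := by
    exact Continuous.subtype_mk continuous_subtype_val _

/-- Forgetting the colours of the strands. -/
def forget (A B : Type) : CoPB A B ⥤ CoB (A ⊕ B) :=
  liftTo (inducedFunctor _ ⋙ FundamentalGroupoid.map (forgetMap A B)) _ (fun w => w)
    fun w => Conf.iso w (Word.hconf_sorted w) (Word.conf_sorted w)

/-- The shuffle-type morphism between two words with the same terrestrial and the same aerial
subword: it is represented by the linear path, so the aerial strands do not cross each other. -/
def shuffle (w w' : Word (A ⊕ B)) (h : w.resL = w'.resL) (h' : w.resR = w'.resR) :
    (show CoPB A B from w) ≅ (show CoPB A B from w') :=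
  InducedCategory.isoMk (HConf.iso w.resL w.resR w.hconf_sorted.resL
    (by rw [h]; exact w'.hconf_sorted.resL) w.hconf_sorted.resR
    (by rw [h']; exact w'.hconf_sorted.resR))

end CoPB

/-- The relative operad `CoPB₊` over `CoB₊`.  The unit operations are the one-letter words;
composition with the nullary operations forgets strands. -/
def CoPBPlus : RelOperadData where
  cl B := CoB B
  clGroupoid _ := inferInstance
  op A B := CoPB A B
  opGroupoid _ _ := inferInstance
  clMap e := CoB.map e
  opMap e e' := CoPB.map e e'
  clOne := (⟨[()], List.nodup_singleton _, fun _ => List.mem_singleton.2 rfl⟩ : Word Unit)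
  opOne := (⟨[Sum.inl ()], List.nodup_singleton _, by rintro (⟨⟩ | ⟨⟨⟩⟩); simp⟩ :
    Word (Unit ⊕ Empty))
  clComp _ D := CoB.comp D
  modComp A _ D := CoPB.modComp A D
  opComp _ B C D := CoPB.opComp B C D

/-! ### Parenthesized permutations and parenthesized braids -/

/-- The permutation operad in arity `I`, as a discrete groupoid. -/
abbrev CoP (I : Type) : Type := Discrete (Word I)

/-- Parenthesized permutations: the pullback of `CoP` to parenthesized words. -/
abbrev PaP (I : Type) : Type :=
  InducedCategory (CoP I) fun t : PWord I => (⟨t.word⟩ : CoP I)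

/-- Parenthesized braids: the pullback of `CoB` to parenthesized words. -/
abbrev PaB (I : Type) : Type :=
  InducedCategory (CoB I) fun t : PWord I => (t.word : CoB I)

namespace PWord

variable {I J B : Type} {D : B → Type}

/-- Operadic composition of parenthesized words. -/
def comp (t : PWord B) (v : ∀ b, PWord (D b)) : PWord (Σ b, D b) :=
  t.bind Sigma.fst (fun b => UMagma.bind (fun d => UMagma.var ⟨b, d⟩) (v b).tree)
    (fun b => by
      rw [UMagma.leaves_bind_var]
      exact (v b).nodup.map sigma_mk_injective)
    (by
      rintro b ⟨b', d⟩
      rw [UMagma.leaves_bind_var]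
      constructor
      · intro h
        obtain ⟨d', -, h2⟩ := List.mem_map.1 h
        exact (congrArg Sigma.fst h2).symm
      · rintro rfl
        exact List.mem_map.2 ⟨d, (v _).complete d, rfl⟩)

theorem word_comp (t : PWord B) (v : ∀ b, PWord (D b)) :
    (t.comp v).word = CoB.compWord t.word fun b => (v b).word := by
  ext1
  refine (UMagma.leaves_bind _ _).trans ?_
  refine List.flatMap_congr fun b _ => ?_
  exact UMagma.leaves_bind_var _ _

/-- The one-letter word. -/
def one : PWord Unit where
  tree := UMagma.var ()
  nodup := by
    rw [UMagma.leaves_var]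
    exact List.nodup_singleton _
  complete _ := by
    rw [UMagma.leaves_var]
    exact List.mem_singleton.2 rfl

end PWord

namespace CoP

variable {I J B : Type} {D : B → Type}

/-- Relabelling. -/
def map (e : I ≃ J) : CoP I ⥤ CoP J := Discrete.functor fun w => ⟨w.map e⟩

/-- Operadic composition: block substitution. -/
def comp (D : B → Type) : CoP B × (∀ b, CoP (D b)) ⥤ CoP (Σ b, D b) where
  obj q := ⟨CoB.compWord q.1.as fun b => (q.2 b).as⟩
  map {q q'} f := eqToHom (by
    rw [Discrete.eq_of_hom f.1]
    congr 2
    funext b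
    exact Discrete.eq_of_hom (f.2 b))
  map_id _ := Subsingleton.elim _ _
  map_comp _ _ := Subsingleton.elim _ _

/-- The inclusion of permutations in coloured braids, as the objects. -/
def ι (I : Type) : CoP I ⥤ CoB I := Discrete.functor fun w => (w : CoB I)

end CoP

namespace PaP

variable {I J B : Type}

/-- Relabelling. -/
def map (e : I ≃ J) : PaP I ⥤ PaP J :=
  liftTo (inducedFunctor _ ⋙ CoP.map e) _ (fun t => PWord.map e t)
    fun t => eqToIso (congrArg Discrete.mk (PWord.word_map e t).symm)

/-- Operadic composition. -/
def comp (D : B → Type) : PaP B × (∀ b, PaP (D b)) ⥤ PaP (Σ b, D b) :=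
  liftTo ((inducedFunctor _).prod (Functor.pi fun _ => inducedFunctor _) ⋙ CoP.comp D) _
    (fun q => PWord.comp q.1 q.2)
    fun q => eqToIso (congrArg Discrete.mk (PWord.word_comp q.1 q.2).symm)

end PaP

namespace PaB

variable {I J B : Type}

/-- Relabelling. -/
def map (e : I ≃ J) : PaB I ⥤ PaB J :=
  liftTo (inducedFunctor _ ⋙ CoB.map e) _ (fun t => PWord.map e t)
    fun t => eqToIso (PWord.word_map e t).symm

/-- Operadic composition. -/
def comp (D : B → Type) [Finite B] : PaB B × (∀ b, PaB (D b)) ⥤ PaB (Σ b, D b) :=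
  liftTo ((inducedFunctor _).prod (Functor.pi fun _ => inducedFunctor _) ⋙ CoB.comp D) _
    (fun q => PWord.comp q.1 q.2)
    fun q => eqToIso (PWord.word_comp q.1 q.2).symm

end PaB

/-! ### Shuffles -/

theorem filterMap_inr {A B : Type} (b : B) (l : List (A ⊕ B)) :
    (Sum.inr b :: l).filterMap Sum.getLeft? = l.filterMap Sum.getLeft? :=
  List.filterMap_cons_none rfl

theorem filterMap_inl {A B : Type} (a : A) (l : List (A ⊕ B)) :
    (Sum.inl a :: l).filterMap Sum.getRight? = l.filterMap Sum.getRight? :=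
  List.filterMap_cons_none rfl

theorem filterMap_getLeft_flatMap {A B A' B' : Type} (l : List (A ⊕ B))
    (k : A ⊕ B → List (A' ⊕ B')) (hk : ∀ b, (k (Sum.inr b)).filterMap Sum.getLeft? = []) :
    (l.flatMap k).filterMap Sum.getLeft?
      = (l.filterMap Sum.getLeft?).flatMap fun a => (k (Sum.inl a)).filterMap Sum.getLeft? := by
  induction l with
  | nil => rfl
  | cons x xs ih =>
    rcases x with a | b
    · simp [ih]
    · simp [ih, hk, filterMap_inr]

theorem filterMap_getLeft_map {A B A' B' : Type} (l : List (A ⊕ B)) (i : A → A') (j : B → B') :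
    (l.map (Sum.map i j)).filterMap Sum.getLeft? = (l.filterMap Sum.getLeft?).map i := by
  induction l with
  | nil => rfl
  | cons x xs ih => rcases x with a | b <;> simp [ih, filterMap_inr]

theorem filterMap_getRight_map {A B A' B' : Type} (l : List (A ⊕ B)) (i : A → A') (j : B → B') :
    (l.map (Sum.map i j)).filterMap Sum.getRight? = (l.filterMap Sum.getRight?).map j := by
  induction l with
  | nil => rfl
  | cons x xs ih => rcases x with a | b <;> simp [ih, filterMap_inl]

namespace Word

variable {A A' B B' : Type}

theorem resL_map (e : A ≃ A') (e' : B ≃ B') (w : Word (A ⊕ B)) :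
    (w.map (Equiv.sumCongr e e')).resL = w.resL.map e := by
  ext1
  exact filterMap_getLeft_map _ _ _

theorem resR_map (e : A ≃ A') (e' : B ≃ B') (w : Word (A ⊕ B)) :
    (w.map (Equiv.sumCongr e e')).resR = w.resR.map e' := by
  ext1
  exact filterMap_getRight_map _ _ _

theorem resL_append (u : Word A) (x : Word B) : (u.append x).resL = u := by
  ext1
  simp [Word.resL, Word.append, List.filterMap_append, List.filterMap_map, Function.comp_def]

theorem resR_append (u : Word A) (x : Word B) : (u.append x).resR = x := by
  ext1
  simp [Word.resR, Word.append, List.filterMap_append, List.filterMap_map, Function.comp_def]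

end Word

/-- Parenthesized shuffles on `A` and `B`: the elements of open colour of the free algebra over the
two-coloured magma operad that are linear in each generator. -/
@[ext]
structure SWord (A B : Type) where
  tree : SMagma A B
  nodup : (SMagma.leaves tree).Nodup
  complete : ∀ i, i ∈ SMagma.leaves tree

namespace SMagma

variable {A B A' B' A'' B'' : Type}

theorem leaves_var (a : A) : leaves (var a : SMagma A B) = [Sum.inl a] := by
  simp [leaves, letters_var]

theorem leaves_relabel (i : A → A') (j : B → B') (t : SMagma A B) :
    leaves (bind (fun a => var (i a)) (fun b => UMagma.var (j b)) t)
      = (leaves t).map (Sum.map i j) := by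
  rw [leaves_bind, ← List.flatMap_pure_eq_map]
  refine List.flatMap_congr fun x _ => ?_
  rcases x with a | b
  · simp [leaves_var]
  · simp [UMagma.leaves_var]

theorem aerial_var (a : A) : aerial (var a : SMagma A B) = 1 := by
  simp [aerial, U_var, UMagma.bind, UMagma.lift_var]

/-- Substituting only at aerial leaves. -/
theorem aerial_bind_of_aerial (g : A → SMagma A' B') (h : B → UMagma B')
    (hg : ∀ a, aerial (g a) = 1) (t : SMagma A B) :
    aerial (bind g h t) = UMagma.bind h (aerial t) := by
  rw [aerial_bind]
  unfold aerial
  rw [UMagma.bind_bind]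
  congr 1
  congr 1
  funext x
  rcases x with a | b
  · exact (hg a).trans (by simp)
  · simp [UMagma.bind, UMagma.lift_var]

end SMagma

namespace SWord

variable {A A' B B' : Type}

/-- The underlying bicoloured word. -/
def word (t : SWord A B) : Word (A ⊕ B) := ⟨SMagma.leaves t.tree, t.nodup, t.complete⟩

/-- Forget the second level of parenthesizing. -/
def U (t : SWord A B) : PWord (A ⊕ B) where
  tree := SMagma.U t.tree
  nodup := by
    rw [SMagma.leaves_U]
    exact t.nodup
  complete := by
    rw [SMagma.leaves_U]
    exact t.complete

theorem word_U (t : SWord A B) : t.U.word = t.word := by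
  ext1
  exact SMagma.leaves_U _

/-- Relabelling. -/
def map (e : A ≃ A') (e' : B ≃ B') (t : SWord A B) : SWord A' B' where
  tree := SMagma.bind (fun a => SMagma.var (e a)) (fun b => UMagma.var (e' b)) t.tree
  nodup := by
    rw [SMagma.leaves_relabel]
    exact (t.word.map (Equiv.sumCongr e e')).nodup
  complete := by
    rw [SMagma.leaves_relabel]
    exact (t.word.map (Equiv.sumCongr e e')).complete

theorem word_map (e : A ≃ A') (e' : B ≃ B') (t : SWord A B) :
    (t.map e e').word = t.word.map (Equiv.sumCongr e e') := by
  ext1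
  exact SMagma.leaves_relabel _ _ _

/-- The one-letter word. -/
def one : SWord Unit Empty where
  tree := SMagma.var ()
  nodup := by
    rw [SMagma.leaves_var]
    exact List.nodup_singleton _
  complete := by
    rintro (⟨⟩ | ⟨⟨⟩⟩)
    rw [SMagma.leaves_var]
    exact List.mem_singleton.2 rfl

theorem leaves_modComp {D : B → Type} (t : SWord A B) (v : ∀ b, PWord (D b)) :
    SMagma.leaves (SMagma.bind SMagma.var
      (fun b => UMagma.bind (fun d => UMagma.var ⟨b, d⟩) (v b).tree) t.tree)
    = (CoPB.modCompWord t.word fun b => (v b).word).list := by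
  rw [SMagma.leaves_bind]
  refine List.flatMap_congr fun x _ => ?_
  rcases x with a | b
  · exact SMagma.leaves_var a
  · simp only [Sum.elim_inr, UMagma.leaves_bind_var, List.map_map]
    rfl

/-- Composition with parenthesized words at the aerial leaves. -/
def modComp {D : B → Type} (t : SWord A B) (v : ∀ b, PWord (D b)) : SWord A (Σ b, D b) where
  tree := SMagma.bind SMagma.var
    (fun b => UMagma.bind (fun d => UMagma.var ⟨b, d⟩) (v b).tree) t.tree
  nodup := by
    rw [leaves_modComp]
    exact Word.nodup _
  complete := by
    rw [leaves_modComp]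
    exact Word.complete _

theorem leaves_opComp {C D : A → Type} (t : SWord A B) (v : ∀ a, SWord (C a) (D a)) :
    SMagma.leaves (SMagma.bind
      (fun a => SMagma.bind (fun c => SMagma.var (Sigma.mk a c))
        (fun d => UMagma.var (Sum.inr (Sigma.mk a d))) (v a).tree)
      (fun b => UMagma.var (Sum.inl b)) t.tree)
    = (CoPB.opCompWord t.word fun a => (v a).word).list := by
  rw [SMagma.leaves_bind]
  refine List.flatMap_congr fun x _ => ?_
  rcases x with a | b
  · exact SMagma.leaves_relabel _ _ _
  · simp only [Sum.elim_inr, UMagma.leaves_var]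
    rfl

/-- Composition with parenthesized shuffles at the terrestrial leaves. -/
def opComp {C D : A → Type} (t : SWord A B) (v : ∀ a, SWord (C a) (D a)) :
    SWord (Σ a, C a) (B ⊕ Σ a, D a) where
  tree := SMagma.bind
    (fun a => SMagma.bind (fun c => SMagma.var (Sigma.mk a c))
      (fun d => UMagma.var (Sum.inr (Sigma.mk a d))) (v a).tree)
    (fun b => UMagma.var (Sum.inl b)) t.tree
  nodup := by
    rw [leaves_opComp]
    exact Word.nodup _
  complete := by
    rw [leaves_opComp]
    exact Word.complete _

/-- The order of the terrestrial leaves of a composition at the terrestrial leaves. -/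
theorem resL_opComp {C D : A → Type} (t : SWord A B) (v : ∀ a, SWord (C a) (D a)) :
    (t.opComp v).word.resL = CoB.compWord t.word.resL fun a => (v a).word.resL := by
  ext1
  change (SMagma.leaves (t.opComp v).tree).filterMap Sum.getLeft? = _
  unfold opComp
  rw [leaves_opComp]
  unfold CoPB.opCompWord Word.bind
  dsimp only
  rw [filterMap_getLeft_flatMap _ _ fun b => rfl]
  refine List.flatMap_congr fun a _ => ?_
  exact filterMap_getLeft_map _ _ _

/-- The order of the terrestrial leaves of a composition at the aerial leaves. -/
theorem resL_modComp {D : B → Type} (t : SWord A B) (v : ∀ b, PWord (D b)) :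
    (t.modComp v).word.resL = t.word.resL := by
  ext1
  change (SMagma.leaves (t.modComp v).tree).filterMap Sum.getLeft? = _
  unfold modComp
  rw [leaves_modComp]
  unfold CoPB.modCompWord Word.bind
  dsimp only
  rw [filterMap_getLeft_flatMap _ _ fun b => ?_]
  · simp [Word.resL]
  · simp only [Sum.elim_inr, List.filterMap_map]
    exact List.filterMap_eq_nil_iff.2 fun _ _ => rfl

/-- `U (μ (∗, …, ∗))`: the terrestrial leaves are filled with the nullary operation, and the second
level of parenthesizing is forgotten. -/
def aerial (t : SWord A B) : PWord B where
  tree := SMagma.aerial t.tree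
  nodup := by
    rw [SMagma.leaves_aerial]
    exact t.word.resR.nodup
  complete := by
    rw [SMagma.leaves_aerial]
    exact t.word.resR.complete

theorem word_aerial (t : SWord A B) : t.aerial.word = t.word.resR := by
  ext1
  exact SMagma.leaves_aerial _

theorem aerial_modComp {D : B → Type} (t : SWord A B) (v : ∀ b, PWord (D b)) :
    (t.modComp v).aerial = t.aerial.comp v := by
  ext1
  exact SMagma.aerial_bind_of_aerial _ _ SMagma.aerial_var _

theorem aerial_map (e : A ≃ A') (e' : B ≃ B') (t : SWord A B) :
    (t.map e e').aerial = t.aerial.map e' := by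
  ext1
  exact SMagma.aerial_bind_of_aerial _ _ (fun a => SMagma.aerial_var _) _

end SWord

/-- A parenthesized word is determined by its word and its parenthesizing: two parenthesized words
with the same underlying word that agree up to relabelling are equal. -/
theorem PWord.eq_of_map {B : Type} {t x : PWord B} {τ : Equiv.Perm B} (h : t = x.map τ)
    (hw : t.word = x.word) : t = x := by
  have h1 : (x.word.list).map τ = x.word.list.map id := by
    have h2 := congrArg Word.list hw
    rw [h, PWord.word_map] at h2
    simpa [Word.map] using h2
  have h3 : ∀ b, τ b = b := fun b => List.map_inj_left.1 h1 b (x.complete b)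
  have h4 : τ = Equiv.refl B := Equiv.ext h3
  subst h4
  rw [h]
  ext1
  exact UMagma.bind_var _

/-- Shuffles: the groupoid whose objects are the bicoloured words, with a single morphism between
two words if they have the same terrestrial subword and the same aerial subword. -/
abbrev Sh (A B : Type) : Type :=
  InducedCategory (Discrete (Word A × Word B)) fun w : Word (A ⊕ B) =>
    (⟨(w.resL, w.resR)⟩ : Discrete (Word A × Word B))

/-- Parenthesized shuffles: the pullback of `Sh` to the parenthesized bicoloured words. -/
abbrev PaSh (A B : Type) : Type :=
  InducedCategory (Sh A B) fun t : SWord A B => (t.word : Sh A B)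

/-! ### The balanced product for coloured braids, and its identification with `CoPB` -/

/-- The balanced product of `CoP × CoB` and `Sh` over the symmetric groups.  The classes have
canonical representatives: a class is given by a bicoloured word, carrying the labels that result
from the compositions of permutations, and its components in `CoP` and in `CoB` are then its
subwords; the component in `Sh` of a morphism is unique. -/
abbrev CoBal (A B : Type) : Type :=
  InducedCategory (CoP A × CoB B) fun w : Word (A ⊕ B) =>
    ((⟨w.resL⟩ : CoP A), (w.resR : CoB B))

/-- The terrestrial points are placed on the left in a fixed order `u`, and a configuration of
the disk is placed on the right as a configuration of aerial points. -/
def HConf.append {A B : Type} (u : Word A) : C(Conf B, HConf A B) where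
  toFun z := ⟨Sum.elim (fun a => ((u.pos a - 1 : ℝ) : ℂ))
      (fun b => z.1 b / 4 + (1 / 2 + Complex.I / 2)), by
    have ha : ∀ a, u.pos a - 1 < 0 := fun a => by
      have := u.pos_lt_one a
      linarith
    have hb : ∀ b, 0 < (z.1 b / 4 + (1 / 2 + Complex.I / 2) : ℂ).im := fun b => by
      have h1 := (Complex.abs_im_le_norm _).trans (z.2.2 b)
      have h2 := neg_abs_le (z.1 b).im
      simp
      linarith
    refine ⟨?_, ?_, fun a => Complex.ofReal_im _, hb⟩
    · rintro (a | b) (a' | b') h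
      · refine congrArg _ (u.pos_inj ?_)
        have := Complex.ofReal_injective h
        linarith
      · have := congrArg Complex.im h
        rw [Sum.elim_inl, Sum.elim_inr, Complex.ofReal_im] at this
        linarith [hb b']
      · have := congrArg Complex.im h
        rw [Sum.elim_inl, Sum.elim_inr, Complex.ofReal_im] at this
        linarith [hb b]
      · refine congrArg _ (z.2.1 ?_)
        simp only [Sum.elim_inr] at h
        linear_combination 4 * h
    · rintro (a | b)
      · rw [Sum.elim_inl, Complex.norm_real, Real.norm_eq_abs, abs_le]
        constructor <;> linarith [ha a, u.pos_pos a]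
      · refine (norm_add_le _ _).trans ?_
        have h1 : ‖(1 / 2 + Complex.I / 2 : ℂ)‖ ≤ 3 / 4 := by
          rw [Complex.norm_def, Real.sqrt_le_left (by norm_num)]
          simp [Complex.normSq_apply]
          norm_num
        have h2 := z.2.2 b
        have h3 : ‖z.1 b / 4‖ ≤ 1 / 4 := by
          rw [norm_div]
          norm_num
          linarith
        linarith⟩
  continuous_toFun := by
    refine Continuous.subtype_mk (continuous_pi fun t => ?_) _
    rcases t with a | b
    · exact continuous_const
    · exact ((continuous_point continuous_id b).div_const 4).add continuous_const

/-- The functor `ζ`: shuffle the terrestrial strands to the left, concatenate, shuffle back. -/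
def zeta (A B : Type) : CoBal A B ⥤ CoPB A B :=
  liftTo (inducedFunctor _ ⋙ Functor.uncurry.obj (Discrete.functor fun u : Word A =>
      inducedFunctor (fun w : Word B => (⟨w.conf⟩ : FundamentalGroupoid (Conf B))) ⋙
        FundamentalGroupoid.map (HConf.append u))) _ (fun w => w)
    fun w => HConf.iso (Word.resL w) (Word.resR w)
      ((Word.pos_sorted (Word.resL w)).imp fun {a b} h => by
        change (((Word.resL w).pos a - 1 : ℝ) : ℂ).re < (((Word.resL w).pos b - 1 : ℝ) : ℂ).re
        rw [Complex.ofReal_re, Complex.ofReal_re]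
        linarith)
      (Word.hconf_sorted w).resL
      ((Word.conf_sorted (Word.resR w)).imp fun {a b} h => by
        change ((Word.resR w).conf.1 a / 4 + (1 / 2 + Complex.I / 2) : ℂ).re
          < ((Word.resR w).conf.1 b / 4 + (1 / 2 + Complex.I / 2) : ℂ).re
        have h' : ((Word.resR w).conf.1 a).re < ((Word.resR w).conf.1 b).re := h
        simp
        linarith)
      (Word.hconf_sorted w).resR

/-- The shuffle-type braid from `m(u, x)` to the word `w` with subwords `u` and `x`. -/
def appendIso {A B : Type} (w : Word (A ⊕ B)) :
    (show CoB (A ⊕ B) from Word.append w.resL w.resR) ≅ (show CoB (A ⊕ B) from w) :=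
  (CoPB.forget A B).mapIso
    (CoPB.shuffle (w.resL.append w.resR) w (Word.resL_append _ _) (Word.resR_append _ _))

/-- The functor underlying `ρ`: shuffle the terrestrial strands to the left, concatenate the
permutation (as a trivial braid) and the braid, shuffle back. -/
def rhoCo (A B : Type) : CoBal A B ⥤ CoB (A ⊕ B) :=
  ((inducedFunctor _ : CoBal A B ⥤ CoP A × CoB B) ⋙
    (CoP.ι A).prod (𝟭 (CoB B)) ⋙ CoB.append A B).copyObj (fun w => w) appendIso

/-! ### The operad of parenthesized permutations and braids -/

/-- Canonical representatives of the classes `[u, x, μ]` of objects: the labels of `u` and of `x` are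
those of the terrestrial and aerial leaves of `μ`. -/
structure PaTriple (A B : Type) where
  u : PWord A
  x : PWord B
  μ : SWord A B
  hu : μ.word.resL = u.word
  hx : μ.word.resR = x.word

/-- The balanced product of `PaP × PaB` and `PaSh` over the symmetric groups, in terms of canonical
representatives; the component in `PaSh` of a morphism is unique. -/
abbrev PaBal (A B : Type) : Type :=
  InducedCategory (PaP A × PaB B) fun o : PaTriple A B => ((o.u : PaP A), (o.x : PaB B))

/-- The functor induced by `PaP → CoP`, `PaB → CoB` and `PaSh → Sh` on the balanced products. -/
def balMap (A B : Type) : PaBal A B ⥤ CoBal A B :=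
  liftTo (inducedFunctor _ ⋙ (inducedFunctor _).prod (inducedFunctor _)) _ (fun o => o.μ.word)
    fun o => eqToIso (Prod.ext (congrArg Discrete.mk o.hu.symm) o.hx.symm)

/-- The full subgroupoid of the classes `[u, x, μ]` such that `U (μ (∗, …, ∗))` is obtained from `x`
by a permutation. -/
abbrev PaPB' (A B : Type) : Type :=
  InducedCategory (PaBal A B)
    fun o : {o : PaTriple A B // ∃ τ : Equiv.Perm B, o.μ.aerial = o.x.map τ} => (o.1 : PaBal A B)

namespace PaPB'

variable {A A' B B' : Type}

theorem aerial_eq (o : PaPB' A B) : o.1.μ.aerial = o.1.x :=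
  o.2.elim fun _ h => PWord.eq_of_map h (o.1.μ.word_aerial.trans o.1.hx)

/-- The object `[u, x, μ]`, where `x` is `U (μ (∗, …, ∗))`. -/
def mk' (u : PWord A) (x : PWord B) (μ : SWord A B) (hu : μ.word.resL = u.word)
    (hx : μ.aerial = x) : PaPB' A B :=
  ⟨⟨u, x, μ, hu, μ.word_aerial.symm.trans (congrArg PWord.word hx)⟩, Equiv.refl B, by
    refine hx.trans ?_
    ext1
    exact (UMagma.bind_var _).symm⟩

/-- The functor that remembers the morphisms of `PaP` and of `PaB`. -/
def base (A B : Type) : PaPB' A B ⥤ PaP A × PaB B := inducedFunctor _ ⋙ inducedFunctor _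

/-- Functors to `PaPB'` are given by functors to `PaP × PaB` and by objects. -/
def lift {C : Type} [Category.{0} C] (F : C ⥤ PaP A × PaB B) (g : C → PaPB' A B)
    (h : ∀ c, F.obj c = (base A B).obj (g c)) : C ⥤ PaPB' A B :=
  liftTo (liftTo F _ (fun c => (g c).1) fun c => eqToIso (h c)) _ g fun _ => Iso.refl _

/-- The restriction of the functor between the balanced products. -/
def toCoBal (A B : Type) : PaPB' A B ⥤ CoBal A B := inducedFunctor _ ⋙ balMap A B

/-- The morphism `ρ` to the shifted operad of parenthesized braids. -/
def rho (A B : Type) : PaPB' A B ⥤ PaB (A ⊕ B) :=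
  liftTo (toCoBal A B ⋙ rhoCo A B) _ (fun o => o.1.μ.U) fun o => eqToIso o.1.μ.word_U.symm

/-- Relabelling. -/
def map (e : A ≃ A') (e' : B ≃ B') : PaPB' A B ⥤ PaPB' A' B' :=
  lift (base A B ⋙ (PaP.map e).prod (PaB.map e'))
    (fun o => mk' (o.1.u.map e) (o.1.x.map e') (o.1.μ.map e e')
      (by rw [SWord.word_map, Word.resL_map, o.1.hu, PWord.word_map])
      (by rw [SWord.aerial_map, aerial_eq]))
    fun _ => rfl

/-- The identity of the operad. -/
def one : PaPB' Unit Empty :=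
  mk' PWord.one
    { tree := 1
      nodup := List.nodup_nil
      complete := fun i => i.elim } SWord.one
    (by
      ext1
      change (SMagma.leaves (SMagma.var ())).filterMap Sum.getLeft? = UMagma.leaves (UMagma.var ())
      rw [SMagma.leaves_var, UMagma.leaves_var]
      rfl)
    (by
      ext1
      exact SMagma.aerial_var ())

/-- The right module structure over parenthesized braids: `[u, x, μ] ∘ y = [u, x ∘ y, μ ∘ 1]`, where
in the last component only the parenthesizing of `y` is inserted. -/
def modComp (A : Type) (D : B → Type) [Finite B] :
    PaPB' A B × (∀ b, PaB (D b)) ⥤ PaPB' A (Σ b, D b) :=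
  lift ((base A B).prod (𝟭 _) ⋙ prod.associator _ _ _ ⋙ (𝟭 _).prod (PaB.comp D))
    (fun q => mk' q.1.1.u (q.1.1.x.comp q.2) (q.1.1.μ.modComp q.2)
      (by rw [SWord.resL_modComp, q.1.1.hu])
      (by rw [SWord.aerial_modComp, aerial_eq]))
    fun _ => rfl

/-- The numbers of inputs that are substituted in `ρ [u, x, μ]`. -/
abbrev opInputs (B : Type) (D : A → Type) : A ⊕ B → Type := Sum.elim D fun _ => Unit

/-- The braids `y₁, …, y_r`, to be substituted at the terrestrial inputs, and identities, to be
substituted at the aerial inputs. -/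
def opFamily (B : Type) (C D : A → Type) :
    (∀ a, PaPB' (C a) (D a)) ⥤ ∀ x, PaB (opInputs B D x) :=
  Functor.pi' fun x => match x with
    | Sum.inl a => Pi.eval _ a ⋙ base (C a) (D a) ⋙ CategoryTheory.Prod.snd _ _
    | Sum.inr _ => (Functor.const _).obj PWord.one

/-- The identification of the inputs of `ρ [u, x, μ] (y₁, …, y_r)`. -/
def opEquiv (B : Type) (D : A → Type) : (Σ x, opInputs B D x) ≃ B ⊕ Σ a, D a :=
  (Equiv.sumSigmaDistrib _).trans ((Equiv.sumComm _ _).trans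
    (Equiv.sumCongr (unitEquiv' B).symm (Equiv.refl _)))

/-- Operadic composition: `[u, x, μ] ([v₁, y₁, σ₁], …, [v_r, y_r, σ_r])` is
`[u (v₁, …, v_r), ρ [u, x, μ] (y₁, …, y_r), μ (σ₁, …, σ_r)]`. -/
def opComp (B : Type) (C D : A → Type) [Finite A] [Finite B] :
    PaPB' A B × (∀ a, PaPB' (C a) (D a)) ⥤ PaPB' (Σ a, C a) (B ⊕ Σ a, D a) :=
  lift (Functor.prod'
      ((base A B ⋙ CategoryTheory.Prod.fst _ _).prod
        (Functor.pi fun a => base (C a) (D a) ⋙ CategoryTheory.Prod.fst _ _) ⋙ PaP.comp C)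
      ((rho A B).prod (opFamily B C D) ⋙ PaB.comp _ ⋙ PaB.map (opEquiv B D)))
    (fun q => mk' (q.1.1.u.comp fun a => (q.2 a).1.u)
      ((q.1.1.μ.U.comp ((opFamily B C D).obj q.2)).map (opEquiv B D))
      (q.1.1.μ.opComp fun a => (q.2 a).1.μ)
      (by
        rw [SWord.resL_opComp, PWord.word_comp, q.1.1.hu]
        congr 1
        funext a
        exact (q.2 a).1.hu)
      (by
        ext1
        change SMagma.aerial (SMagma.bind _ _ _) = UMagma.bind _ (UMagma.bind _ _)
        rw [SMagma.aerial_bind, UMagma.bind_bind]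
        congr 1
        congr 1
        funext x
        rcases x with a | b
        · refine (SMagma.aerial_bind_of_aerial _ _ (fun c => SMagma.aerial_var _) _).trans ?_
          have h : SMagma.aerial (q.2 a).1.μ.tree = (q.2 a).1.x.tree :=
            congrArg PWord.tree (aerial_eq (q.2 a))
          rw [h]
          exact (UMagma.bind_bind (fun d => UMagma.var (Sigma.mk (Sum.inl a) d))
            (fun i => UMagma.var (opEquiv B D i)) (q.2 a).1.x.tree).symm
        · rfl))
    fun _ => rfl

end PaPB'

/-- The relative operad `PaPB'₊` over `PaB₊`. -/
def PaPBPrimePlus : RelOperadData where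
  cl B := PaB B
  clGroupoid _ := inferInstance
  op A B := PaPB' A B
  opGroupoid _ _ := inferInstance
  clMap e := PaB.map e
  opMap e e' := PaPB'.map e e'
  clOne := PWord.one
  opOne := PaPB'.one
  clComp _ D := PaB.comp D
  modComp A _ D := PaPB'.modComp A D
  opComp _ B C D := PaPB'.opComp B C D

/-! ### The balanced products as coinvariants -/

/-- The functor `q` is the quotient of the category `C` by the action of a group `G`: it is universal
among the functors that are invariant under `G`. -/
def IsCoinvariants {G C N : Type} [Category.{0} C] [Category.{0} N] (act : G → C ⥤ C)
    (q : C ⥤ N) : Prop :=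
  (∀ g, act g ⋙ q = q) ∧
    ∀ (D : Type) [Category.{0} D] (F : C ⥤ D), (∀ g, act g ⋙ F = F) → ∃! F' : N ⥤ D, q ⋙ F' = F

namespace Word

variable {n m : ℕ}

theorem list_eq_ofFn (w : Word (Fin n)) : w.list = List.ofFn w.perm := by
  have hl : w.list.length = n := by
    have h := Fintype.card_congr (List.Nodup.getEquivOfForallMemList w.list w.nodup w.complete)
    simpa using h
  refine List.ext_getElem (by simpa using hl) fun i h1 h2 => ?_
  simp [perm]

/-- The relabelling of a word whose effect is to permute its places by `s`. -/
def placeAct (s : Equiv.Perm (Fin n)) (w : Word (Fin n)) : Equiv.Perm (Fin n) :=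
  w.perm * s⁻¹ * w.perm⁻¹

/-- The relabelling of the word `w` whose effect is to permute its places by the permutation given
by the word `u`. -/
def compAct (u w : Word (Fin n)) : Equiv.Perm (Fin n) := w.perm * u.perm * w.perm⁻¹

theorem map_compAct (u w : Word (Fin n)) : w.map (compAct u w) = u.map w.perm := by
  ext1
  change w.list.map (compAct u w) = u.list.map w.perm
  rw [list_eq_ofFn, list_eq_ofFn u, List.map_ofFn, List.map_ofFn]
  congr 1
  funext i
  simp [compAct]

end Word

section coinvariants

variable (n m : ℕ)

/-- The diagonal action on `Sh`, by permutation of the places of the letters of each colour. -/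
def Sh.act (g : Equiv.Perm (Fin n) × Equiv.Perm (Fin m)) : Sh (Fin n) (Fin m) ⥤ Sh (Fin n) (Fin m) :=
  liftTo (inducedFunctor _ ⋙ Discrete.functor fun p : Word (Fin n) × Word (Fin m) =>
      ⟨(p.1.map (p.1.placeAct g.1), p.2.map (p.2.placeAct g.2))⟩) _
    (fun w => Word.map (Equiv.sumCongr ((Word.resL w).placeAct g.1) ((Word.resR w).placeAct g.2)) w)
    fun _ => eqToIso (congrArg Discrete.mk (Prod.ext (Word.resL_map _ _ _).symm
      (Word.resR_map _ _ _).symm))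

/-- The diagonal action on `PaSh`. -/
def PaSh.act (g : Equiv.Perm (Fin n) × Equiv.Perm (Fin m)) :
    PaSh (Fin n) (Fin m) ⥤ PaSh (Fin n) (Fin m) :=
  liftTo (inducedFunctor _ ⋙ Sh.act n m g) _
    (fun t => SWord.map (t.word.resL.placeAct g.1) (t.word.resR.placeAct g.2) t)
    fun t => eqToIso (SWord.word_map _ _ t).symm

/-- The diagonal action of the symmetric groups on `(CoP × CoB) × Sh`. -/
def coAct (g : Equiv.Perm (Fin n) × Equiv.Perm (Fin m)) :
    (CoP (Fin n) × CoB (Fin m)) × Sh (Fin n) (Fin m) ⥤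
      (CoP (Fin n) × CoB (Fin m)) × Sh (Fin n) (Fin m) :=
  ((CoP.map g.1).prod (CoB.map g.2)).prod (Sh.act n m g)

/-- The diagonal action of the symmetric groups on `(PaP × PaB) × PaSh`. -/
def paAct (g : Equiv.Perm (Fin n) × Equiv.Perm (Fin m)) :
    (PaP (Fin n) × PaB (Fin m)) × PaSh (Fin n) (Fin m) ⥤
      (PaP (Fin n) × PaB (Fin m)) × PaSh (Fin n) (Fin m) :=
  ((PaP.map g.1).prod (PaB.map g.2)).prod (PaSh.act n m g)

/-- The functor that sends a triple `(u, x, μ)` to its class `[u, x, μ]`. -/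
def coQuot : (CoP (Fin n) × CoB (Fin m)) × Sh (Fin n) (Fin m) ⥤ CoBal (Fin n) (Fin m) :=
  liftTo (CategoryTheory.Prod.swap _ _ ⋙ (inducedFunctor _).prod (𝟭 _) ⋙
      Functor.uncurry.obj (Discrete.functor fun p : Word (Fin n) × Word (Fin m) =>
        (CoP.map p.1.perm).prod (CoB.map p.2.perm))) _
    (fun c => Word.map (Equiv.sumCongr (Word.compAct c.1.1.as (Word.resL c.2))
      (Word.compAct c.1.2 (Word.resR c.2))) c.2)
    fun _ => eqToIso (Prod.ext
      (congrArg Discrete.mk ((Word.resL_map _ _ _).trans (Word.map_compAct _ _)).symm)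
      ((Word.resR_map _ _ _).trans (Word.map_compAct _ _)).symm)

/-- The canonical representative of the class `[u, x, μ]`. -/
def PaTriple.mk' {n m : ℕ} (u : PWord (Fin n)) (x : PWord (Fin m)) (μ : SWord (Fin n) (Fin m)) :
    PaTriple (Fin n) (Fin m) where
  u := u.map μ.word.resL.perm
  x := x.map μ.word.resR.perm
  μ := μ.map (Word.compAct u.word μ.word.resL) (Word.compAct x.word μ.word.resR)
  hu := by rw [SWord.word_map, Word.resL_map, Word.map_compAct, PWord.word_map]
  hx := by rw [SWord.word_map, Word.resR_map, Word.map_compAct, PWord.word_map]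

/-- The functor that sends a triple `(u, x, μ)` to its class `[u, x, μ]`. -/
def paQuot : (PaP (Fin n) × PaB (Fin m)) × PaSh (Fin n) (Fin m) ⥤ PaBal (Fin n) (Fin m) :=
  liftTo (CategoryTheory.Prod.swap _ _ ⋙ (inducedFunctor _ ⋙ inducedFunctor _).prod (𝟭 _) ⋙
      Functor.uncurry.obj (Discrete.functor fun p : Word (Fin n) × Word (Fin m) =>
        (PaP.map p.1.perm).prod (PaB.map p.2.perm))) _
    (fun c => PaTriple.mk' c.1.1 c.1.2 c.2)
    fun _ => Iso.refl _

/-- The product of the functors `PaP → CoP`, `PaB → CoB` and `PaSh → Sh`. -/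
def tripleMap : (PaP (Fin n) × PaB (Fin m)) × PaSh (Fin n) (Fin m) ⥤
    (CoP (Fin n) × CoB (Fin m)) × Sh (Fin n) (Fin m) :=
  ((inducedFunctor _).prod (inducedFunctor _)).prod (inducedFunctor _)

end coinvariants

end SwissCheese

end

/-!
Every structure map in the theorem is a functor between restrictions of fundamental groupoids of
configuration spaces, corrected by linear paths to the base configurations.  The proof therefore
represents a morphism by an honest path of configurations and reduces each identity of morphisms to
a pointwise statement: two paths of configurations whose values at each time are joined by a linear
path without collisions (`Compat`) represent the same morphism, because the linear homotopy stays in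
the configuration space (`cls_comp_seg`, `mkA_congr`).  The ends of a representing path need not be
base configurations; it is enough that they are sorted from left to right by the given words
(`coA`, `hcoA`), since configurations sorted by the same word are always joined linearly.

**`CoPB₊` is a relative operad.**  The structure maps send the arrow represented by a path to the
arrow represented by the image path (`coM_coA`, `coC_coA`, `hcoMod_hcoA`, `hcoC_hcoA`).  For
insertions, the linear path to the base configuration has to stay sorted after points are
inserted; the condition `Spread`, which bounds slopes, is preserved by the insertions that occur and
guarantees this.  Each axiom is then an identity of words, together with the claim that two ways of
inserting configurations into neighbourhoods of points are joined by a linear path.  For the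
associativity axioms both iterated insertions consist of points in three nested scales with the same
data in each scale (`Nest`); the difference of any two points is up to a small error a positive
multiple of the same vector on both sides, so it never vanishes in between (`Nest.compat`).

**`ζ` is an isomorphism.**  Terrestrial points move on a line, so a path in the configuration space
of the half disk keeps their order (`terrestrial_order`), and they never meet the aerial points,
whose imaginary part is positive.  Hence compatibility can be checked on each colour
(`compat_of_colours`), and a morphism of `CoPB` is determined by its ends and by the coloured braid
of its aerial strands.  Forgetting the terrestrial strands (`aer`) gives the inverse of `ζ`
(`zetaInv`), and equality of morphisms of `CoPB` may be tested on aerial strands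
(`arrow_ext_aer`).

**The projection is a morphism of relative operads.**  By this test, its compatibility with the
structure maps is a comparison of coloured braids.  For composition at the terrestrial inputs, the
aerial strands of a composite `q (r₁, …, rₙ)` in `CoPB₊` are obtained by inserting the aerial
strands of the `rᵢ` into the braid of *all* strands of `q` (`aer_hcoC`); this is the formula for the
composition in `PaPB'₊`, because `ρ` is `ζ` followed by the functor that forgets the colours
(`arr_forget_zeta`).

**`PaPB'₊` is a relative operad.**  A morphism of `PaPB'` is determined by its ends and by its
projection to `CoPB` (`arrow_ext_toCoPB`), so each axiom follows from the same axiom for `CoPB₊` and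
from the corresponding identity of trees on objects.  The projection is fully faithful since the
three functors that compose it are, and every word is the word of some tree, so the projection is an
equivalence in each arity.

**The balanced products are coinvariants.**  Relabelling the shuffle in standard order gives a
section of the quotient functor, and each arrow is moved by the group to a value of this section
(`isCoinvariants_of_section`).
-/

open CategoryTheory

noncomputable section

namespace SwissCheese

/-! ### Linear deformations of configurations -/

section linear

variable {I J : Type}

/-- The convex combination `(1 - t) z + t z'` of two families of complex numbers. -/
def lin (t : ℝ) (z z' : I → ℂ) : I → ℂ := fun i => (1 - t : ℂ) * z i + t * z' i

/-- The linear path between two families consists of families of pairwise distinct points. -/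
def Compat (z z' : I → ℂ) : Prop :=
  ∀ t : ℝ, 0 ≤ t → t ≤ 1 → Function.Injective (lin t z z')

/-- The property `P` persists along a linear path as long as the points remain distinct. -/
def SegClosed (P : (I → ℂ) → Prop) : Prop :=
  ∀ z z', P z → P z' → Compat z z' → ∀ t : ℝ, 0 ≤ t → t ≤ 1 → P (lin t z z')

theorem lin_self (t : ℝ) (z : I → ℂ) : lin t z z = z := by
  funext i
  simp only [lin]
  ring

theorem lin_zero (z z' : I → ℂ) : lin 0 z z' = z := by
  funext i
  simp [lin]

theorem lin_one (z z' : I → ℂ) : lin 1 z z' = z' := by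
  funext i
  simp [lin]

theorem lin_sub (t : ℝ) (z z' : I → ℂ) (i j : I) :
    lin t z z' i - lin t z z' j = (1 - t : ℂ) * (z i - z j) + t * (z' i - z' j) := by
  simp only [lin]
  ring

theorem lin_re (t : ℝ) (z z' : I → ℂ) (i : I) :
    (lin t z z' i).re = (1 - t) * (z i).re + t * (z' i).re := re_convex _ _ _

theorem lin_im (t : ℝ) (z z' : I → ℂ) (i : I) :
    (lin t z z' i).im = (1 - t) * (z i).im + t * (z' i).im := im_convex _ _ _

theorem Compat.refl {z : I → ℂ} (hz : Function.Injective z) : Compat z z := fun t _ _ => by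
  rwa [lin_self]

theorem Compat.congr {z z' y y' : I → ℂ} (h : Compat z z') (hz : z = y) (hz' : z' = y') :
    Compat y y' := hz ▸ hz' ▸ h

/-- Differences that are, up to a small error, positive multiples of a common vector keep away
from zero along a linear path. -/
theorem Compat.of_vector {z z' : I → ℂ} (h : ∀ i j, i ≠ j → ∃ (v : ℂ) (α α' : ℝ),
    ‖z i - z j - α * v‖ < α * ‖v‖ ∧ ‖z' i - z' j - α' * v‖ < α' * ‖v‖) : Compat z z' := by
  intro t h0 h1 i j hij
  by_contra hne
  obtain ⟨v, α, α', ha, ha'⟩ := h i j hne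
  -- At a collision, a positive multiple of `v` would be the sum of two errors that are shorter.
  have h2 : (1 - t : ℂ) * (z i - z j) + t * (z' i - z' j) = 0 := by
    rw [← lin_sub, hij, sub_self]
  have h3 : (((1 - t) * α + t * α' : ℝ) : ℂ) * v
      = -((1 - t : ℂ) * (z i - z j - α * v) + t * (z' i - z' j - α' * v)) := by
    push_cast
    linear_combination h2
  have h4 : ‖(1 - t : ℂ)‖ = 1 - t := by
    rw [show (1 - t : ℂ) = ((1 - t : ℝ) : ℂ) by push_cast; ring, Complex.norm_real,
      Real.norm_of_nonneg (by linarith)]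
  have h5 : ‖(t : ℂ)‖ = t := by rw [Complex.norm_real, Real.norm_of_nonneg h0]
  have h6 : ((1 - t) * α + t * α') * ‖v‖ ≤
      (1 - t) * ‖z i - z j - α * v‖ + t * ‖z' i - z' j - α' * v‖ := by
    calc ((1 - t) * α + t * α') * ‖v‖ ≤ ‖(((1 - t) * α + t * α' : ℝ) : ℂ) * v‖ := by
          rw [norm_mul, Complex.norm_real]
          exact mul_le_mul_of_nonneg_right (le_abs_self _) (norm_nonneg _)
      _ ≤ _ := by
          rw [h3, norm_neg]
          refine (norm_add_le _ _).trans ?_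
          rw [norm_mul, norm_mul, h4, h5]
  have h7 := lt_convex ha ha' h0 h1
  nlinarith

theorem Compat.of_sorted {w : Word I} {z z' : I → ℂ} (h : w.Sorted fun i => (z i).re)
    (h' : w.Sorted fun i => (z' i).re) : Compat z z' := fun _ h0 h1 _ _ hij =>
  by_contra fun hne => ne_convex h h' hne h0 h1 hij

theorem Word.Sorted.lin {w : Word I} {z z' : I → ℂ} (h : w.Sorted fun i => (z i).re)
    (h' : w.Sorted fun i => (z' i).re) {t : ℝ} (h0 : 0 ≤ t) (h1 : t ≤ 1) :
    w.Sorted fun i => (lin t z z' i).re := by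
  refine (List.Pairwise.and h h').imp fun {i j} hij => ?_
  simp only [lin_re]
  exact lt_convex hij.1 hij.2 h0 h1

theorem lin_norm {z z' : I → ℂ} (h : ∀ i, ‖z i‖ ≤ 1) (h' : ∀ i, ‖z' i‖ ≤ 1) {t : ℝ} (h0 : 0 ≤ t)
    (h1 : t ≤ 1) (i : I) : ‖lin t z z' i‖ ≤ 1 := norm_convex (h i) (h' i) h0 h1

end linear

/-- The condition that defines `Conf I`. -/
abbrev confP (I : Type) (z : I → ℂ) : Prop := Function.Injective z ∧ ∀ i, ‖z i‖ ≤ 1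

/-- The condition that defines `HConf A B`. -/
abbrev hconfP (A B : Type) (z : A ⊕ B → ℂ) : Prop :=
  Function.Injective z ∧ (∀ x, ‖z x‖ ≤ 1) ∧
    (∀ a, (z (Sum.inl a)).im = 0) ∧ ∀ b, 0 < (z (Sum.inr b)).im

theorem segClosed_confP (I : Type) : SegClosed (confP I) := fun _ _ hz hz' h _ h0 h1 =>
  ⟨h _ h0 h1, lin_norm hz.2 hz'.2 h0 h1⟩

theorem segClosed_hconfP (A B : Type) : SegClosed (hconfP A B) := fun z z' hz hz' h t h0 h1 => by
  refine ⟨h _ h0 h1, lin_norm hz.2.1 hz'.2.1 h0 h1, fun a => ?_, fun b => ?_⟩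
  · rw [lin_im, hz.2.2.1 a, hz'.2.2.1 a]
    ring
  · have := lt_convex (hz.2.2.2 b) (hz'.2.2.2 b) h0 h1
    rw [lin_im]
    simpa using this

section paths

variable {I : Type} {P : (I → ℂ) → Prop}

/-- The linear path between two compatible configurations. -/
def segPath (hP : SegClosed P) (z z' : Subtype P) (h : Compat z.1 z'.1) : Path z z' where
  toFun t := ⟨lin t z.1 z'.1, hP _ _ z.2 z'.2 h t t.2.1 t.2.2⟩
  continuous_toFun := by
    refine Continuous.subtype_mk (continuous_pi fun i => ?_) _
    unfold lin
    fun_prop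
  source' := Subtype.ext (lin_zero _ _)
  target' := Subtype.ext (lin_one _ _)

/-- The class of a path, as a morphism of the fundamental groupoid. -/
abbrev cls {X : Type} [TopologicalSpace X] {x y : X} (p : Path x y) :
    (⟨x⟩ : FundamentalGroupoid X) ⟶ ⟨y⟩ := Path.Homotopic.Quotient.mk p

/-- The class of the linear path between two compatible configurations. -/
def seg (hP : SegClosed P) (z z' : Subtype P) (h : Compat z.1 z'.1) :
    (⟨z⟩ : FundamentalGroupoid (Subtype P)) ⟶ ⟨z'⟩ := cls (segPath hP z z' h)

/-- The linear homotopy between two paths of pointwise compatible configurations. -/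
def linHomotopy (hP : SegClosed P) {z₀ z₁ z₀' z₁' : Subtype P} (p : Path z₀ z₁) (p' : Path z₀' z₁')
    (h : ∀ t, Compat (p t).1 (p' t).1) :
    ContinuousMap.Homotopy (p : C(unitInterval, Subtype P)) (p' : C(unitInterval, Subtype P)) where
  toFun st := ⟨lin st.1 (p st.2).1 (p' st.2).1,
    hP _ _ (p st.2).2 (p' st.2).2 (h st.2) st.1 st.1.2.1 st.1.2.2⟩
  continuous_toFun := by
    refine Continuous.subtype_mk (continuous_pi fun i => ?_) _
    have h1 : Continuous fun st : unitInterval × unitInterval => (p st.2).1 i :=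
      continuous_point (φ := fun st : unitInterval × unitInterval => p st.2) (by fun_prop) i
    have h2 : Continuous fun st : unitInterval × unitInterval => (p' st.2).1 i :=
      continuous_point (φ := fun st : unitInterval × unitInterval => p' st.2) (by fun_prop) i
    have h3 : Continuous fun st : unitInterval × unitInterval => ((st.1 : ℝ) : ℂ) := by fun_prop
    exact ((continuous_const.sub h3).mul h1).add (h3.mul h2)
  map_zero_left t := Subtype.ext (lin_zero _ _)
  map_one_left t := Subtype.ext (lin_one _ _)

theorem Compat.source {z₀ z₁ z₀' z₁' : Subtype P} {p : Path z₀ z₁} {p' : Path z₀' z₁'}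
    (h : ∀ t, Compat (p t).1 (p' t).1) : Compat z₀.1 z₀'.1 := by
  have := h 0
  rwa [p.source, p'.source] at this

theorem Compat.target {z₀ z₁ z₀' z₁' : Subtype P} {p : Path z₀ z₁} {p' : Path z₀' z₁'}
    (h : ∀ t, Compat (p t).1 (p' t).1) : Compat z₁.1 z₁'.1 := by
  have := h 1
  rwa [p.target, p'.target] at this

/-- The identity of the unit interval, as a path. -/
def unitPath : Path (0 : unitInterval) 1 where
  toFun t := t
  source' := rfl
  target' := rfl

/-- Two pointwise compatible paths are conjugate by linear paths. -/
theorem cls_comp_seg (hP : SegClosed P) {z₀ z₁ z₀' z₁' : Subtype P} (p : Path z₀ z₁)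
    (p' : Path z₀' z₁')
    (h : ∀ t, Compat (p t).1 (p' t).1) :
    cls p ≫ seg hP z₁ z₁' (Compat.target h) = seg hP z₀ z₀' (Compat.source h) ≫ cls p' := by
  obtain ⟨p, rfl, rfl⟩ := p
  obtain ⟨p', rfl, rfl⟩ := p'
  have key := Path.Homotopic.map_trans_evalAt (linHomotopy hP _ _ h) unitPath
  exact Path.Homotopic.Quotient.eq.2 key

theorem seg_self (hP : SegClosed P) (z : Subtype P) (h : Compat z.1 z.1) : seg hP z z h = 𝟙 _ := by
  have : segPath hP z z h = Path.refl z := by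
    ext t
    exact congrFun (lin_self _ _) _
  unfold seg
  rw [this]
  rfl

/-- Pointwise compatible paths with the same ends are homotopic. -/
theorem cls_eq_of_compat (hP : SegClosed P) {z z' : Subtype P} (p p' : Path z z')
    (h : ∀ t, Compat (p t).1 (p' t).1) : cls p = cls p' := by
  have := cls_comp_seg hP p p' h
  rwa [seg_self, seg_self, Category.comp_id, Category.id_comp] at this

/-- Two linear paths compose to a linear path if every point of the first one can be joined linearly
to the end of the second one: the triangle is then filled by segments. -/
theorem seg_comp_seg (hP : SegClosed P) {z₁ z₂ z₃ : Subtype P} (h₁₂ : Compat z₁.1 z₂.1)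
    (h₂₃ : Compat z₂.1 z₃.1) (h₁₃ : Compat z₁.1 z₃.1)
    (h : ∀ t : ℝ, 0 ≤ t → t ≤ 1 → Compat (lin t z₁.1 z₂.1) z₃.1) :
    seg hP z₁ z₂ h₁₂ ≫ seg hP z₂ z₃ h₂₃ = seg hP z₁ z₃ h₁₃ := by
  have := cls_comp_seg hP (segPath hP z₁ z₂ h₁₂) (Path.refl z₃) fun t => h t t.2.1 t.2.2
  exact this.trans (Category.comp_id _)

/-- The image of a linear path under a continuous map is homotopic to a linear path. -/
theorem map_seg (hP : SegClosed P) {J : Type} {Q : (J → ℂ) → Prop} (hQ : SegClosed Q)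
    (Φ : C(Subtype P, Subtype Q))
    {z z' : Subtype P} (h : Compat z.1 z'.1) (h' : Compat (Φ z).1 (Φ z').1)
    (hc : ∀ (t : ℝ) (h0 : 0 ≤ t) (h1 : t ≤ 1),
      Compat (Φ ⟨lin t z.1 z'.1, hP _ _ z.2 z'.2 h t h0 h1⟩).1 (lin t (Φ z).1 (Φ z').1)) :
    (FundamentalGroupoid.map Φ).map (seg hP z z' h) = seg hQ (Φ z) (Φ z') h' :=
  cls_eq_of_compat hQ ((segPath hP z z' h).map Φ.continuous) (segPath hQ (Φ z) (Φ z') h')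
    fun t => hc t t.2.1 t.2.2

end paths

/-! ### Morphisms represented by paths between sorted configurations -/

section sorted

variable {I J : Type} {P : (I → ℂ) → Prop} {Q : (J → ℂ) → Prop}

/-- The points of the family `z` occur from left to right in the order of the word `w`. -/
def Srt (w : Word I) (z : I → ℂ) : Prop := w.Sorted fun i => (z i).re

theorem Srt.compat {w : Word I} {z z' : I → ℂ} (h : Srt w z) (h' : Srt w z') : Compat z z' :=
  Compat.of_sorted h h'

theorem Srt.lin {w : Word I} {z z' : I → ℂ} (h : Srt w z) (h' : Srt w z') {t : ℝ} (h0 : 0 ≤ t)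
    (h1 : t ≤ 1) : Srt w (lin t z z') := Word.Sorted.lin h h' h0 h1

/-- The linear path between two configurations sorted by the same word, as an isomorphism. -/
def srtIso (hP : SegClosed P) {w : Word I} {z z' : Subtype P} (h : Srt w z.1) (h' : Srt w z'.1) :
    (⟨z⟩ : FundamentalGroupoid (Subtype P)) ≅ ⟨z'⟩ :=
  (Groupoid.isoEquivHom _ _).symm (seg hP z z' (h.compat h'))

theorem srtIso_comp (hP : SegClosed P) {w : Word I} {z₁ z₂ z₃ : Subtype P} (h₁ : Srt w z₁.1)
    (h₂ : Srt w z₂.1) (h₃ : Srt w z₃.1) :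
    (srtIso hP h₁ h₂).hom ≫ (srtIso hP h₂ h₃).hom = (srtIso hP h₁ h₃).hom :=
  seg_comp_seg hP _ _ _ fun _ h0 h1 => (h₁.lin h₂ h0 h1).compat h₃

theorem srtIso_self (hP : SegClosed P) {w : Word I} {z : Subtype P} (h : Srt w z.1) :
    (srtIso hP h h).hom = 𝟙 _ := seg_self hP _ _

variable (hP : SegClosed P) (hQ : SegClosed Q)
  (b : Word I → Subtype P) (hb : ∀ w, Srt w (b w).1)
  (c : Word J → Subtype Q) (hc : ∀ w, Srt w (c w).1)

/-- The restriction of a fundamental groupoid to the base configurations of the words. -/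
abbrev Ind : Type := InducedCategory (FundamentalGroupoid (Subtype P)) fun w : Word I => ⟨b w⟩

/-- The arrow from `w` to `w'` represented by a path between configurations sorted by `w` and by
`w'`: the ends of the path are joined linearly to the base configurations. -/
def mkA {w w' : Word I} {z z' : Subtype P} (p : Path z z') (h : Srt w z.1) (h' : Srt w' z'.1) :
    Arrow (Ind b) :=
  Arrow.mk (X := (w : Ind b)) (Y := (w' : Ind b))
    (InducedCategory.homMk ((srtIso hP (hb w) h).hom ≫ cls p ≫ (srtIso hP (hb w') h').inv))

theorem mkA_refl (w : Ind b) :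
    mkA hP b hb (Path.refl (b w)) (hb w) (hb w) = Arrow.mk (𝟙 w) := by
  refine congrArg (fun m => Arrow.mk (X := w) (Y := w) m)
    (InducedCategory.hom_ext ?_)
  have h1 : srtIso hP (hb w) (hb w) = Iso.refl _ := Iso.ext (srtIso_self hP (hb w))
  refine Eq.trans (congrArg (fun e : (⟨b w⟩ : FundamentalGroupoid (Subtype P)) ≅ ⟨b w⟩ =>
    e.hom ≫ cls (Path.refl (b w)) ≫ e.inv) h1) ?_
  exact (Category.id_comp _).trans (Category.comp_id _)

theorem exists_mkA (f : Arrow (Ind b)) : ∃ p : Path (b f.left) (b f.right),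
    f = mkA hP b hb p (hb f.left) (hb f.right) := by
  obtain ⟨p, hp⟩ := Path.Homotopic.Quotient.mk_surjective f.hom.hom
  refine ⟨p, ?_⟩
  have h1 : ∀ w, srtIso hP (hb w) (hb w) = Iso.refl _ := fun w => Iso.ext (srtIso_self hP (hb w))
  unfold mkA
  rw [h1, h1]
  simp only [Iso.refl_hom, Iso.refl_inv, Category.comp_id, Category.id_comp]
  exact congrArg (fun m => Arrow.mk (X := f.left) (Y := f.right) m)
    (InducedCategory.hom_ext hp.symm)

/-- Arrows represented by pointwise compatible paths are equal. -/
theorem mkA_congr {w₁ w₁' w₂ w₂' : Word I} {z z' y y' : Subtype P} {p : Path z z'} {q : Path y y'}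
    {h : Srt w₁ z.1} {h' : Srt w₁' z'.1} {k : Srt w₂ y.1} {k' : Srt w₂' y'.1}
    (hw : w₁ = w₂) (hw' : w₁' = w₂') (hpq : ∀ t, Compat (p t).1 (q t).1) :
    mkA hP b hb p h h' = mkA hP b hb q k k' := by
  subst hw hw'
  unfold mkA
  congr 2
  have key : cls p ≫ (srtIso hP h' k').hom = (srtIso hP h k).hom ≫ cls q := cls_comp_seg hP p q hpq
  rw [← srtIso_comp hP (hb w₁) h k, Category.assoc, ← reassoc_of% key]
  congr 2
  rw [Iso.eq_comp_inv, Iso.inv_comp_eq]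
  exact (srtIso_comp hP (hb w₁') h' k').symm

theorem conj_comp {D : Type} [Category.{0} D] {x x' y y' u u' : D} (e : x ≅ y) (e' : x' ≅ y')
    {f : x ⟶ u} {s : y ≅ u} {f' : u' ⟶ x'} {s' : y' ≅ u'} (h : f = e.hom ≫ s.hom)
    (h' : f' = s'.inv ≫ e'.inv) (m : u ⟶ u') :
    e.inv ≫ (f ≫ m ≫ f') ≫ e'.hom = s.hom ≫ m ≫ s'.inv := by
  subst h h'
  simp

/-- A functor induced by a continuous map sends the arrow represented by a path to the arrow
represented by the image path, provided that the map takes sorted configurations to sorted ones. -/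
theorem arr_liftTo_map (Φ : C(Subtype P, Subtype Q)) (g : Ind b → Ind c)
    (hΦ : ∀ (w : Word I) (z : Subtype P), Srt w z.1 → Srt (g w : Word J) (Φ z).1)
    (e : ∀ w : Ind b,
      (inducedFunctor (fun w : Word I => (⟨b w⟩ : FundamentalGroupoid (Subtype P))) ⋙
        FundamentalGroupoid.map Φ).obj w ≅ ⟨c (g w)⟩)
    (he : ∀ w : Word I, (e w).hom = (srtIso hQ (hΦ w _ (hb w)) (hc (g w))).hom)
    {w w' : Word I} {z z' : Subtype P} (p : Path z z') (h : Srt w z.1) (h' : Srt w' z'.1) :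
    arr (liftTo (inducedFunctor _ ⋙ FundamentalGroupoid.map Φ) _ g e) (mkA hP b hb p h h')
      = mkA hQ c hc (p.map Φ.continuous) (hΦ w z h) (hΦ w' z' h') := by
  have key : ∀ (w : Word I) (z : Subtype P) (h : Srt w z.1),
      (FundamentalGroupoid.map Φ).map (srtIso hP (hb w) h).hom
        = (e w).hom ≫ (srtIso hQ (hc (g w)) (hΦ w z h)).hom := fun w z h => by
    rw [he]
    refine Eq.trans ?_ (srtIso_comp hQ _ _ _).symm
    refine map_seg hP hQ Φ _ _ fun t h0 h1 => Srt.compat (w := g w) (hΦ w _ ?_) ?_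
    · exact (hb w).lin h h0 h1
    · exact (hΦ w _ (hb w)).lin (hΦ w z h) h0 h1
  have key' : ∀ (w : Word I) (z : Subtype P) (h : Srt w z.1),
      (FundamentalGroupoid.map Φ).map (srtIso hP (hb w) h).inv
        = (srtIso hQ (hc (g w)) (hΦ w z h)).inv ≫ (e w).inv := fun w z h => by
    have := key w z h
    rw [← Functor.mapIso_hom, ← Iso.trans_hom] at this
    have := congrArg Iso.inv (Iso.ext this)
    exact this
  refine congrArg (fun m => Arrow.mk (X := (g w : Ind c)) (Y := (g w' : Ind c))
    (InducedCategory.homMk m)) ?_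
  refine Eq.trans ?_ (conj_comp (e w) (e w') (key w z h) (key' w' z' h') _)
  refine congrArg (fun m => (e w).inv ≫ m ≫ (e w').hom) ?_
  change (FundamentalGroupoid.map Φ).map
    ((srtIso hP (hb w) h).hom ≫ cls p ≫ (srtIso hP (hb w') h').inv) = _
  refine ((FundamentalGroupoid.map Φ).map_comp _ _).trans ?_
  exact congrArg (fun m => _ ≫ m) ((FundamentalGroupoid.map Φ).map_comp _ _)

end sorted

section multi

variable {I J K : Type} {L : K → Type} {P : (I → ℂ) → Prop} {Q : (J → ℂ) → Prop}
  {R : ∀ k, (L k → ℂ) → Prop} (hP : SegClosed P) (hQ : SegClosed Q) (hR : ∀ k, SegClosed (R k))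
  (b : Word I → Subtype P) (hb : ∀ w, Srt w (b w).1)
  (c : Word J → Subtype Q) (hc : ∀ w, Srt w (c w).1)
  (d : ∀ k, Word (L k) → Subtype (R k)) (hd : ∀ k w, Srt w (d k w).1)

/-- The path of a family of paths, after application of a continuous map. -/
def mapPath (Φ : C(Subtype P × (∀ k, Subtype (R k)), Subtype Q)) {z z' : Subtype P} (p : Path z z')
    {y y' : ∀ k, Subtype (R k)} (q : ∀ k, Path (y k) (y' k)) : Path (Φ (z, y)) (Φ (z', y')) :=
  (p.prod (Path.pi q)).map Φ.continuous

/-- The functor on fundamental groupoids given by a continuous map in several variables. -/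
abbrev multiFunctor (Φ : C(Subtype P × (∀ k, Subtype (R k)), Subtype Q)) :
    FundamentalGroupoid (Subtype P) × (∀ k, FundamentalGroupoid (Subtype (R k))) ⥤
      FundamentalGroupoid (Subtype Q) :=
  (𝟭 _).prod (piPi fun k => Subtype (R k)) ⋙ piProd _ _ ⋙ FundamentalGroupoid.map Φ

theorem multiFunctor_map_cls (Φ : C(Subtype P × (∀ k, Subtype (R k)), Subtype Q))
    {z z' : Subtype P} (p : Path z z') {y y' : ∀ k, Subtype (R k)} (q : ∀ k, Path (y k) (y' k)) :
    (multiFunctor Φ).map (X := (⟨z⟩, fun k => ⟨y k⟩)) (Y := (⟨z'⟩, fun k => ⟨y' k⟩))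
      (cls p, fun k => cls (q k)) = cls (mapPath Φ p q) := by
  change (FundamentalGroupoid.map Φ).map
    (Path.Homotopic.prod (cls p) (Path.Homotopic.pi fun k => cls (q k))) = _
  erw [Path.Homotopic.pi_lift]
  rfl

/-- The version of `arr_liftTo_map` for a continuous map in several variables.  Sortedness of the
images is only required along the linear paths from the base configurations to the ends of the given
paths: in general, an insertion does not preserve sortedness. -/
theorem arr_liftTo_multi (Φ : C(Subtype P × (∀ k, Subtype (R k)), Subtype Q))
    (g : Ind b × (∀ k, Ind (d k)) → Ind c)
    (e : ∀ o : Ind b × (∀ k, Ind (d k)),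
      ((inducedFunctor _).prod (Functor.pi fun _ => inducedFunctor _) ⋙
        (𝟭 _).prod (piPi fun k => Subtype (R k)) ⋙ piProd _ _ ⋙
          FundamentalGroupoid.map Φ).obj o ≅ ⟨c (g o)⟩)
    (hΦ : ∀ (w : Word I) (v : ∀ k, Word (L k)),
      Srt (g ((w : Ind b), fun k => (v k : Ind (d k))) : Word J) (Φ (b w, fun k => d k (v k))).1)
    (he : ∀ (w : Word I) (v : ∀ k, Word (L k)), (e ((w : Ind b), fun k => (v k : Ind (d k)))).hom
      = (srtIso hQ (hΦ w v) (hc (g (w, v)))).hom)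
    {w w' : Word I} {z z' : Subtype P} (p : Path z z') (h : Srt w z.1) (h' : Srt w' z'.1)
    {v v' : ∀ k, Word (L k)} {y y' : ∀ k, Subtype (R k)} (q : ∀ k, Path (y k) (y' k))
    (k : ∀ i, Srt (v i) (y i).1) (k' : ∀ i, Srt (v' i) (y' i).1)
    (hs : ∀ t, Srt (g (w, v) : Word J) (Φ (segPath hP (b w) z ((hb w).compat h) t,
      fun i => segPath (hR i) (d i (v i)) (y i) ((hd i (v i)).compat (k i)) t)).1)
    (hs' : ∀ t, Srt (g (w', v') : Word J) (Φ (segPath hP (b w') z' ((hb w').compat h') t,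
      fun i => segPath (hR i) (d i (v' i)) (y' i) ((hd i (v' i)).compat (k' i)) t)).1)
    (r : Srt (g (w, v) : Word J) (Φ (z, y)).1) (r' : Srt (g (w', v') : Word J) (Φ (z', y')).1) :
    arr (liftTo ((inducedFunctor _).prod (Functor.pi fun _ => inducedFunctor _) ⋙
        (𝟭 _).prod (piPi fun k => Subtype (R k)) ⋙ piProd _ _ ⋙ FundamentalGroupoid.map Φ)
          _ g e) (arrTuple (mkA hP b hb p h h') fun i => mkA (hR i) (d i) (hd i) (q i) (k i) (k' i))
      = mkA hQ c hc (mapPath Φ p q) r r' := by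
  have key : ∀ (w : Word I) (v : ∀ k, Word (L k)) (z : Subtype P) (y : ∀ k, Subtype (R k))
      (h : Srt w z.1) (k : ∀ i, Srt (v i) (y i).1)
      (_ : ∀ t, Srt (g (w, v) : Word J) (Φ (segPath hP (b w) z ((hb w).compat h) t,
        fun i => segPath (hR i) (d i (v i)) (y i) ((hd i (v i)).compat (k i)) t)).1)
      (r : Srt (g (w, v) : Word J) (Φ (z, y)).1),
      (multiFunctor Φ).map (X := (⟨b w⟩, fun i => ⟨d i (v i)⟩)) (Y := (⟨z⟩, fun i => ⟨y i⟩))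
        ((srtIso hP (hb w) h).hom, fun i => (srtIso (hR i) (hd i (v i)) (k i)).hom)
        = (e ((w : Ind b), fun k => (v k : Ind (d k)))).hom ≫
          (srtIso hQ (hc (g (w, v))) r).hom := fun w v z y h k hs r => by
    rw [he]
    refine Eq.trans ?_ (srtIso_comp hQ _ _ _).symm
    refine (multiFunctor_map_cls Φ _ _).trans ?_
    refine cls_eq_of_compat hQ _ _ fun t => Srt.compat (hs t) ?_
    exact (hΦ w v).lin r t.2.1 t.2.2
  have key' := key w' v' z' y' h' k' hs' r'
  have key'' : (multiFunctor Φ).map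
      (X := (⟨z'⟩, fun i => ⟨y' i⟩)) (Y := (⟨b w'⟩, fun i => ⟨d i (v' i)⟩))
        ((srtIso hP (hb w') h').inv, fun i => (srtIso (hR i) (hd i (v' i)) (k' i)).inv)
        = (srtIso hQ (hc (g (w', v'))) r').inv ≫
          (e ((w' : Ind b), fun k => (v' k : Ind (d k)))).inv := by
    let x : ((⟨b w'⟩, fun i => ⟨d i (v' i)⟩) :
        FundamentalGroupoid (Subtype P) × (∀ k, FundamentalGroupoid (Subtype (R k)))) ≅
        (⟨z'⟩, fun i => ⟨y' i⟩) :=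
      Iso.prod (srtIso hP (hb w') h') (Pi.isoMk fun i => srtIso (hR i) (hd i (v' i)) (k' i))
    have h1 : (multiFunctor Φ).mapIso x = e (w', v') ≪≫ srtIso hQ (hc (g (w', v'))) r' :=
      Iso.ext key'
    exact congrArg Iso.inv h1
  refine congrArg (fun m => Arrow.mk (X := (g (w, v) : Ind c)) (Y := (g (w', v') : Ind c))
    (InducedCategory.homMk m)) ?_
  refine Eq.trans ?_ (conj_comp (e (w, v)) (e (w', v')) (key w v z y h k hs r) key'' _)
  refine congrArg (fun m => (e (w, v)).inv ≫ m ≫ (e (w', v')).hom) ?_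
  rw [← multiFunctor_map_cls]
  refine Eq.trans ?_ (congrArg (fun m => _ ≫ m) ((multiFunctor Φ).map_comp _ _))
  change (multiFunctor Φ).map (X := (⟨b w⟩, fun i => ⟨d i (v i)⟩))
    (Y := (⟨b w'⟩, fun i => ⟨d i (v' i)⟩))
    ((srtIso hP (hb w) h).hom ≫ cls p ≫ (srtIso hP (hb w') h').inv, fun i =>
      (srtIso (hR i) (hd i (v i)) (k i)).hom ≫ cls (q i) ≫
        (srtIso (hR i) (hd i (v' i)) (k' i)).inv) = _
  exact (multiFunctor Φ).map_comp (X := (⟨b w⟩, fun i => ⟨d i (v i)⟩)) (Y := (⟨z⟩, fun i => ⟨y i⟩))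
    (Z := (⟨b w'⟩, fun i => ⟨d i (v' i)⟩)) ((srtIso hP (hb w) h).hom, fun i =>
      (srtIso (hR i) (hd i (v i)) (k i)).hom) (cls p ≫ (srtIso hP (hb w') h').inv, fun i =>
        cls (q i) ≫ (srtIso (hR i) (hd i (v' i)) (k' i)).inv)

end multi

/-! ### Insertion of spread configurations -/

section spread

variable {I J X T : Type}

/-- Distinct points of `z` are ordered from left to right as in `w`, and the slope of the line
through any two of them is bounded: their distance is at most `κ` times the difference of their
real parts. -/
def Spread (κ : ℝ) (w : Word I) (z : I → ℂ) : Prop :=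
  w.list.Pairwise fun i j => ‖z i - z j‖ ≤ κ * ((z j).re - (z i).re)

/-- The real number `r` is a possible width of tubular neighbourhoods of the points of `z`. -/
def Tight (z : X → ℂ) (r : ℝ) : Prop := 0 < r ∧ ∀ x y, x ≠ y → r ≤ ‖z x - z y‖ / 8

theorem tight_radius [Finite X] {z : X → ℂ} (hz : Function.Injective z) (hb : ∀ x, ‖z x‖ ≤ 1) :
    Tight z (radius z) := ⟨radius_pos hz, fun _ _ h => radius_le hb h⟩

theorem tight_hradius {A B : Type} [Finite A] [Finite B] (z : HConf A B) :
    Tight z.1 (hradius z.1) :=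
  ⟨hradius_pos z, fun _ _ h => (hradius_le z).trans (radius_le z.2.2.1 h)⟩

theorem Spread.mono {κ κ' : ℝ} (h : κ ≤ κ') (hκ : 0 < κ) {w : Word I} {z : I → ℂ}
    (hz : Spread κ w z) : Spread κ' w z := by
  refine List.Pairwise.imp (fun {i j} hij => ?_) hz
  have h1 : 0 ≤ (z j).re - (z i).re := by
    by_contra hneg
    have := norm_nonneg (z i - z j)
    nlinarith
  nlinarith

theorem Spread.srt {κ : ℝ} (hκ : 0 < κ) {w : Word I} {z : I → ℂ} (hz : Function.Injective z)
    (h : Spread κ w z) : Srt w z := by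
  refine List.Pairwise.imp₂ ?_ h w.nodup
  intro i j hij hne
  have h1 : 0 < ‖z i - z j‖ := norm_pos_iff.2 (sub_ne_zero.2 fun h => hne (hz h))
  by_contra hneg
  nlinarith

theorem Spread.lin {κ : ℝ} {w : Word I} {z z' : I → ℂ} (h : Spread κ w z) (h' : Spread κ w z')
    {t : ℝ} (h0 : 0 ≤ t) (h1 : t ≤ 1) : Spread κ w (lin t z z') := by
  refine (List.Pairwise.and h h').imp fun {i j} hij => ?_
  have h4 : ‖(1 - t : ℂ)‖ = 1 - t := by
    rw [show (1 - t : ℂ) = ((1 - t : ℝ) : ℂ) by push_cast; ring, Complex.norm_real,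
      Real.norm_of_nonneg (by linarith)]
  have h5 : ‖(t : ℂ)‖ = t := by rw [Complex.norm_real, Real.norm_of_nonneg h0]
  rw [lin_sub, lin_re, lin_re]
  refine (norm_add_le _ _).trans ?_
  rw [norm_mul, norm_mul, h4, h5]
  have h6 := mul_le_mul_of_nonneg_left hij.1 (by linarith : 0 ≤ 1 - t)
  have h7 := mul_le_mul_of_nonneg_left hij.2 h0
  linarith

theorem Spread.map {κ : ℝ} {w : Word I} {z : I → ℂ} (h : Spread κ w z) (e : I ≃ J) :
    Spread κ (w.map e) fun j => z (e.symm j) := by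
  simpa [Spread, Word.map, List.pairwise_map] using h

theorem Word.bind_pairwise {w : Word X} {p : T → X} {g : X → List T} {hn : ∀ x, (g x).Nodup}
    {hm : ∀ x t, t ∈ g x ↔ p t = x} {R : T → T → Prop} (h : ∀ x, (g x).Pairwise R)
    (h' : w.list.Pairwise fun x y => ∀ s t, p s = x → p t = y → R s t) :
    (w.bind p g hn hm).list.Pairwise R := by
  unfold Word.bind
  rw [List.pairwise_flatMap]
  exact ⟨fun x _ => h x, h'.imp fun {x y} hxy s hs t ht =>
    hxy s t ((hm x s).1 hs) ((hm y t).1 ht)⟩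

/-- Inserted points, in distinct blocks, keep a bounded slope.  A neighbourhood has width at most an
eighth of the distance of the centres, so the two inserted points move relative to each other by at
most a quarter of this distance; this is the origin of the constants `5 / 4` and `1 / 4`. -/
theorem insert_slope {z : X → ℂ} {r κ κ' : ℝ} (hr : Tight z r) {p : T → X} {d : T → ℂ}
    (hd : ∀ t, ‖d t‖ ≤ 1) {s t : T} (hne : p s ≠ p t) (hκ : 0 < κ) (hκ' : 0 < κ')
    (hκκ' : 5 / 4 ≤ κ' * (1 / κ - 1 / 4))
    (h : ‖z (p s) - z (p t)‖ ≤ κ * ((z (p t)).re - (z (p s)).re)) :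
    ‖insert z r p d s - insert z r p d t‖
      ≤ κ' * ((insert z r p d t).re - (insert z r p d s).re) := by
  have h1 := hr.2 _ _ hne
  have h2 : insert z r p d s - insert z r p d t
      = ((z (p s) - z (p t)) + r * (d s - d t)) / 2 := by
    unfold insert
    ring
  have h3 : ‖(r : ℂ) * (d s - d t)‖ ≤ r * 2 := by
    rw [norm_mul, Complex.norm_real, Real.norm_of_nonneg hr.1.le]
    have := norm_sub_le (d s) (d t)
    have := hd s
    have := hd t
    have := hr.1
    gcongr
    linarith
  have h4 : ‖insert z r p d s - insert z r p d t‖ ≤ 5 / 8 * ‖z (p s) - z (p t)‖ := by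
    rw [h2, norm_div]
    have := norm_add_le (z (p s) - z (p t)) (r * (d s - d t))
    rw [show ‖(2 : ℂ)‖ = 2 by simp]
    linarith
  have h5 : r * (d s).re ≤ r * 1 := by
    have := hr.1.le
    gcongr
    exact (Complex.re_le_norm _).trans (hd s)
  have h6 : r * (-1) ≤ r * (d t).re := by
    have := hr.1.le
    gcongr
    have := (Complex.abs_re_le_norm (d t)).trans (hd t)
    linarith [neg_abs_le (d t).re]
  have h7 : (1 / κ) * ‖z (p s) - z (p t)‖ ≤ (z (p t)).re - (z (p s)).re := by
    rw [one_div, inv_mul_le_iff₀ hκ]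
    exact h
  have h8 : (1 / κ - 1 / 4) * ‖z (p s) - z (p t)‖ ≤
      2 * ((insert z r p d t).re - (insert z r p d s).re) := by
    rw [insert_re, insert_re]
    linarith
  have h9 := mul_le_mul_of_nonneg_left h8 hκ'.le
  have h10 := mul_le_mul_of_nonneg_right hκκ' (norm_nonneg (z (p s) - z (p t)))
  linarith

/-- Insertion of sorted configurations in a configuration of slope at most `3` is sorted. -/
theorem Spread.insert_srt {w : Word X} {z : X → ℂ} {r : ℝ}
    (h : Spread 3 w z) (hr : Tight z r) {p : T → X} {g : X → List T} {hn : ∀ x, (g x).Nodup}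
    {hm : ∀ x t, t ∈ g x ↔ p t = x} {d : T → ℂ} (hd : ∀ t, ‖d t‖ ≤ 1)
    (hg : ∀ x, (g x).Pairwise fun s t => (d s).re < (d t).re) :
    Srt (w.bind p g hn hm) (insert z r p d) := by
  refine Word.bind_pairwise (fun x => ?_) ?_
  · refine List.Pairwise.imp_of_mem ?_ (hg x)
    intro s t hs ht hst
    dsimp only
    rw [insert_re, insert_re, (hm x s).1 hs, (hm x t).1 ht]
    have := mul_lt_mul_of_pos_left hst hr.1
    linarith
  · refine List.Pairwise.imp₂ ?_ h w.nodup
    rintro x y hxy hne s t rfl rfl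
    -- Any constant of at least `15` bounds the slope; only the sign of the difference matters here.
    have h1 := insert_slope (κ' := 20) hr hd hne (by norm_num) (by norm_num) (by norm_num) hxy
    have h2 : 0 < ‖insert z r p d s - insert z r p d t‖ := by
      refine norm_pos_iff.2 fun h0 => ?_
      have h3 : z (p s) - z (p t) = r * (d t - d s) := by
        unfold insert at h0
        linear_combination 2 * h0
      have h4 : ‖z (p s) - z (p t)‖ ≤ r * 2 := by
        rw [h3, norm_mul, Complex.norm_real, Real.norm_of_nonneg hr.1.le]
        have := norm_sub_le (d t) (d s)
        have := hd s
        have := hd t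
        have := hr.1
        gcongr
        linarith
      have h5 := hr.2 _ _ hne
      have := hr.1
      linarith
    linarith

/-- Insertion of base configurations, whose slopes are at most `3 / 2`, in a base configuration may
be used as the outer configuration of a further insertion. -/
theorem Spread.insert {w : Word X} {z : X → ℂ} {r : ℝ}
    (h : Spread (3 / 2) w z) (hr : Tight z r) {p : T → X} {g : X → List T}
    {hn : ∀ x, (g x).Nodup} {hm : ∀ x t, t ∈ g x ↔ p t = x} {d : T → ℂ} (hd : ∀ t, ‖d t‖ ≤ 1)
    (hg : ∀ x, (g x).Pairwise fun s t => ‖d s - d t‖ ≤ 3 / 2 * ((d t).re - (d s).re)) :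
    Spread 3 (w.bind p g hn hm) (insert z r p d) := by
  refine Word.bind_pairwise (fun x => ?_) ?_
  · refine List.Pairwise.imp_of_mem ?_ (hg x)
    intro s t hs ht hst
    rw [insert_re, insert_re, (hm x s).1 hs, (hm x t).1 ht]
    have h2 : SwissCheese.insert z r p d s - SwissCheese.insert z r p d t
        = (r * (d s - d t)) / 2 := by
      unfold SwissCheese.insert
      rw [(hm x s).1 hs, (hm x t).1 ht]
      ring
    rw [h2, norm_div, norm_mul, Complex.norm_real, Real.norm_of_nonneg hr.1.le,
      show ‖(2 : ℂ)‖ = 2 by simp]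
    have := mul_le_mul_of_nonneg_left hst hr.1.le
    have := mul_nonneg hr.1.le (norm_nonneg (d s - d t))
    nlinarith
  · refine List.Pairwise.imp₂ ?_ h w.nodup
    rintro x y hxy hne s t rfl rfl
    exact insert_slope hr hd hne (by norm_num) (by norm_num) (by norm_num) hxy

theorem spread_conf (w : Word I) : Spread (3 / 2) w w.conf.1 := by
  refine List.Pairwise.imp ?_ w.pos_sorted
  intro i j hij
  change ‖(w.pos i : ℂ) - (w.pos j : ℂ)‖ ≤ 3 / 2 * (w.pos j - w.pos i)
  rw [← Complex.ofReal_sub, Complex.norm_real, Real.norm_eq_abs, abs_of_neg (by linarith)]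
  linarith

theorem spread_hconf {A B : Type} (w : Word (A ⊕ B)) : Spread (3 / 2) w w.hconf.1 := by
  refine List.Pairwise.imp ?_ w.pos_sorted
  intro i j hij
  have h2 := w.pos_gap hij
  set g := 1 / ((w.list.length : ℝ) + 1) with hg
  have h0 : 0 ≤ g := by positivity
  have h3 : (w.hconf.1 i - w.hconf.1 j).re = w.pos i - w.pos j := rfl
  have him : ∀ x, 0 ≤ (w.hconf.1 x).im ∧ (w.hconf.1 x).im ≤ g := by
    rintro (a | b)
    · exact ⟨le_rfl, h0⟩
    · exact ⟨h0, le_rfl⟩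
  have h4 : |(w.hconf.1 i - w.hconf.1 j).im| ≤ w.pos j - w.pos i := by
    rw [Complex.sub_im, abs_le]
    constructor <;> linarith [(him i).1, (him i).2, (him j).1, (him j).2]
  change _ ≤ 3 / 2 * (w.pos j - w.pos i)
  have h6 := neg_abs_le (w.hconf.1 i - w.hconf.1 j).im
  have h5 := sq_le_sq' (by linarith) ((le_abs_self _).trans h4)
  rw [Complex.norm_def, Real.sqrt_le_left (by linarith), Complex.normSq_apply, h3]
  nlinarith

end spread

/-! ### The structure maps of `CoPB₊` on represented arrows -/

section rules

variable {I J A A' B B' : Type}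

/-- The coloured braid from `w` to `w'` represented by a path of configurations whose ends are
sorted by `w` and by `w'`. -/
def coA {w w' : Word I} {z z' : Conf I} (p : Path z z') (h : Srt w z.1) (h' : Srt w' z'.1) :
    Arrow (CoB I) := mkA (segClosed_confP I) Word.conf Word.conf_sorted p h h'

/-- The arrow of `CoPB` from `w` to `w'` represented by a path of configurations whose ends are
sorted by `w` and by `w'`. -/
def hcoA {w w' : Word (A ⊕ B)} {z z' : HConf A B} (p : Path z z') (h : Srt w z.1)
    (h' : Srt w' z'.1) : Arrow (CoPB A B) :=
  mkA (segClosed_hconfP A B) Word.hconf Word.hconf_sorted p h h'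

/-- Relabelling of arrows of `CoB`. -/
def coM (e : B ≃ B') : Arrow (CoB B) → Arrow (CoB B') := arr (CoB.map e)

/-- Composition of arrows of `CoB`. -/
def coC [Finite B] {D : B → Type} (f : Arrow (CoB B)) (g : ∀ b, Arrow (CoB (D b))) :
    Arrow (CoB (Σ b, D b)) := arr (CoB.comp D) (arrTuple f g)

/-- Relabelling of arrows of `CoPB`. -/
def hcoM (e : A ≃ A') (e' : B ≃ B') : Arrow (CoPB A B) → Arrow (CoPB A' B') := arr (CoPB.map e e')

/-- Composition of arrows of `CoPB` with arrows of `CoB`. -/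
def hcoMod [Finite A] [Finite B] {D : B → Type} (f : Arrow (CoPB A B))
    (g : ∀ b, Arrow (CoB (D b))) : Arrow (CoPB A (Σ b, D b)) :=
  arr (CoPB.modComp A D) (arrTuple f g)

/-- Composition of arrows of `CoPB`. -/
def hcoC [Finite A] [Finite B] {C D : A → Type} (f : Arrow (CoPB A B))
    (g : ∀ a, Arrow (CoPB (C a) (D a))) : Arrow (CoPB (Σ a, C a) (B ⊕ Σ a, D a)) :=
  arr (CoPB.opComp B C D) (arrTuple f g)

theorem srt_conf (w : Word I) : Srt w w.conf.1 := w.conf_sorted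

theorem srt_hconf (w : Word (A ⊕ B)) : Srt w w.hconf.1 := w.hconf_sorted

theorem coA_congr {w₁ w₁' w₂ w₂' : Word I} {z z' y y' : Conf I} {p : Path z z'} {q : Path y y'}
    {h : Srt w₁ z.1} {h' : Srt w₁' z'.1} {k : Srt w₂ y.1} {k' : Srt w₂' y'.1}
    (hw : w₁ = w₂) (hw' : w₁' = w₂') (hpq : ∀ t, Compat (p t).1 (q t).1) :
    coA p h h' = coA q k k' := mkA_congr _ _ _ hw hw' hpq

theorem hcoA_congr {w₁ w₁' w₂ w₂' : Word (A ⊕ B)} {z z' y y' : HConf A B} {p : Path z z'}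
    {q : Path y y'} {h : Srt w₁ z.1} {h' : Srt w₁' z'.1} {k : Srt w₂ y.1} {k' : Srt w₂' y'.1}
    (hw : w₁ = w₂) (hw' : w₁' = w₂') (hpq : ∀ t, Compat (p t).1 (q t).1) :
    hcoA p h h' = hcoA q k k' := mkA_congr _ _ _ hw hw' hpq

theorem exists_coA (f : Arrow (CoB I)) : ∃ (w w' : Word I) (p : Path w.conf w'.conf),
    f = coA p (srt_conf w) (srt_conf w') :=
  ⟨_, _, exists_mkA (segClosed_confP I) Word.conf Word.conf_sorted f⟩

theorem exists_hcoA (f : Arrow (CoPB A B)) : ∃ (w w' : Word (A ⊕ B)) (p : Path w.hconf w'.hconf),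
    f = hcoA p (srt_hconf w) (srt_hconf w') :=
  ⟨_, _, exists_mkA (segClosed_hconfP A B) Word.hconf Word.hconf_sorted f⟩

theorem Srt.map {w : Word I} {z : I → ℂ} (h : Srt w z) (e : I ≃ J) :
    Srt (w.map e) fun j => z (e.symm j) := Word.Sorted.map h e

theorem srt_relabel {w : Word I} {z : Conf I} (h : Srt w z.1) (e : I ≃ J) :
    Srt (w.map e) (CoB.relabelMap e z).1 := Srt.map h e

theorem srt_hrelabel {w : Word (A ⊕ B)} {z : HConf A B} (h : Srt w z.1) (e : A ≃ A')
    (e' : B ≃ B') : Srt (w.map (Equiv.sumCongr e e')) (CoPB.relabelMap e e' z).1 :=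
  Srt.map h (Equiv.sumCongr e e')

theorem coM_coA (e : B ≃ B') {w w' : Word B} {z z' : Conf B}
    (p : Path z z') (h : Srt w z.1) (h' : Srt w' z'.1) :
    coM e (coA p h h')
      = coA (p.map (CoB.relabelMap e).continuous) (srt_relabel h e) (srt_relabel h' e) :=
  arr_liftTo_map _ _ _ _ _ _ (CoB.relabelMap e) (fun w => Word.map e w)
    (fun _ _ h => h.map e) _ (fun _ => rfl) p h h'

theorem hcoM_hcoA (e : A ≃ A') (e' : B ≃ B')
    {w w' : Word (A ⊕ B)} {z z' : HConf A B}
    (p : Path z z') (h : Srt w z.1) (h' : Srt w' z'.1) :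
    hcoM e e' (hcoA p h h')
      = hcoA (p.map (CoPB.relabelMap e e').continuous) (srt_hrelabel h e e')
        (srt_hrelabel h' e e') :=
  arr_liftTo_map _ _ _ _ _ _ (CoPB.relabelMap e e') (fun w => Word.map (Equiv.sumCongr e e') w)
    (fun _ _ h => h.map (Equiv.sumCongr e e')) _ (fun _ => rfl) p h h'

theorem arr_forget_hcoA {w w' : Word (A ⊕ B)} {z z' : HConf A B}
    (p : Path z z') (h : Srt w z.1) (h' : Srt w' z'.1) :
    arr (CoPB.forget A B) (hcoA p h h')
      = coA (p.map (CoPB.forgetMap A B).continuous) h h' :=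
  arr_liftTo_map _ _ _ _ _ _ (CoPB.forgetMap A B) (fun w => w)
    (fun _ _ h => h) _ (fun _ => rfl) p h h'

theorem confP_norm_sigma {D : B → Type} (y : ∀ b, Conf (D b)) (t : Σ b, D b) :
    ‖(y t.1).1 t.2‖ ≤ 1 := (y t.1).2.2 t.2

theorem srt_comp [Finite B] {D : B → Type} {w : Word B} {v : ∀ b, Word (D b)} {z : Conf B}
    {y : ∀ b, Conf (D b)} (h : Spread 3 w z.1) (k : ∀ b, Srt (v b) (y b).1) :
    Srt (CoB.compWord w v) (CoB.compMap D (z, y)).1 :=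
  h.insert_srt (tight_radius z.2.1 z.2.2) (confP_norm_sigma y) fun b => List.pairwise_map.2 (k b)

theorem spread_comp [Finite B] {D : B → Type} {w : Word B} {v : ∀ b, Word (D b)} {z : Conf B}
    {y : ∀ b, Conf (D b)} (h : Spread (3 / 2) w z.1) (k : ∀ b, Spread (3 / 2) (v b) (y b).1) :
    Spread 3 (CoB.compWord w v) (CoB.compMap D (z, y)).1 :=
  h.insert (tight_radius z.2.1 z.2.2) (confP_norm_sigma y) fun b => List.pairwise_map.2 (k b)

theorem Spread.three {w : Word I} {z : I → ℂ} (h : Spread (3 / 2) w z) : Spread 3 w z :=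
  h.mono (by norm_num) (by norm_num)

theorem coC_coA [Finite B] {D : B → Type} {w w' : Word B} {z z' : Conf B}
    (p : Path z z') (h : Spread 3 w z.1) (h' : Spread 3 w' z'.1) {v v' : ∀ b, Word (D b)}
    {y y' : ∀ b, Conf (D b)} (q : ∀ b, Path (y b) (y' b)) (k : ∀ b, Srt (v b) (y b).1)
    (k' : ∀ b, Srt (v' b) (y' b).1) :
    coC (coA p (h.srt (by norm_num) z.2.1) (h'.srt (by norm_num) z'.2.1))
        (fun b => coA (q b) (k b) (k' b))
      = coA (mapPath (CoB.compMap D) p q) (srt_comp h k) (srt_comp h' k') := by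
  have hs : ∀ (w : Word B) (z : Conf B) (h : Spread 3 w z.1) (v : ∀ b, Word (D b))
      (y : ∀ b, Conf (D b)) (k : ∀ b, Srt (v b) (y b).1) (t : unitInterval),
      Srt (CoB.compWord w v) (CoB.compMap D (segPath (segClosed_confP B) w.conf z
        ((srt_conf w).compat (h.srt (by norm_num) z.2.1)) t, fun b =>
          segPath (segClosed_confP _) (v b).conf (y b) ((srt_conf (v b)).compat (k b)) t)).1 :=
    fun w z h v y k t => srt_comp ((spread_conf w).three.lin h t.2.1 t.2.2)
      fun b => Srt.lin (v b).conf_sorted (k b) t.2.1 t.2.2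
  exact arr_liftTo_multi (segClosed_confP _) (segClosed_confP _) (fun _ => segClosed_confP _)
    Word.conf Word.conf_sorted Word.conf Word.conf_sorted (fun _ => Word.conf)
    (fun _ => Word.conf_sorted) (CoB.compMap D) (fun q => CoB.compWord q.1 q.2) _
    (fun w v => srt_comp (spread_conf w).three fun b => (v b).conf_sorted) (fun _ _ => rfl)
    p _ _ q k k' (hs w z h v y k) (hs w' z' h' v' y' k') _ _

/-- The relative positions of the points inserted by `CoPB.modCompMap`. -/
abbrev modPos (A : Type) {D : B → Type} (y : ∀ b, Conf (D b)) : A ⊕ (Σ b, D b) → ℂ :=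
  Sum.elim (fun _ => 0) fun t => (y t.1).1 t.2

theorem modPos_norm (A : Type) {D : B → Type} (y : ∀ b, Conf (D b)) (t) :
    ‖modPos A y t‖ ≤ 1 := by
  rcases t with a | t
  · simp [modPos]
  · exact (y t.1).2.2 t.2

theorem srt_modComp [Finite A] [Finite B] {D : B → Type} {w : Word (A ⊕ B)}
    {v : ∀ b, Word (D b)} {z : HConf A B} {y : ∀ b, Conf (D b)} (h : Spread 3 w z.1)
    (k : ∀ b, Srt (v b) (y b).1) :
    Srt (CoPB.modCompWord w v) (CoPB.modCompMap A D (z, y)).1 :=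
  h.insert_srt (tight_hradius z) (modPos_norm A y) (by
    rintro (a | b)
    · exact List.pairwise_singleton _ _
    · exact List.pairwise_map.2 (k b))

theorem spread_modComp [Finite A] [Finite B] {D : B → Type} {w : Word (A ⊕ B)}
    {v : ∀ b, Word (D b)} {z : HConf A B} {y : ∀ b, Conf (D b)} (h : Spread (3 / 2) w z.1)
    (k : ∀ b, Spread (3 / 2) (v b) (y b).1) :
    Spread 3 (CoPB.modCompWord w v) (CoPB.modCompMap A D (z, y)).1 :=
  h.insert (tight_hradius z) (modPos_norm A y) (by
    rintro (a | b)
    · exact List.pairwise_singleton _ _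
    · exact List.pairwise_map.2 (k b))

theorem hcoMod_hcoA [Finite A] [Finite B] {D : B → Type} {w w' : Word (A ⊕ B)}
    {z z' : HConf A B} (p : Path z z') (h : Spread 3 w z.1) (h' : Spread 3 w' z'.1)
    {v v' : ∀ b, Word (D b)} {y y' : ∀ b, Conf (D b)} (q : ∀ b, Path (y b) (y' b))
    (k : ∀ b, Srt (v b) (y b).1) (k' : ∀ b, Srt (v' b) (y' b).1) :
    hcoMod (hcoA p (h.srt (by norm_num) z.2.1) (h'.srt (by norm_num) z'.2.1))
        (fun b => coA (q b) (k b) (k' b))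
      = hcoA (mapPath (CoPB.modCompMap A D) p q) (srt_modComp h k) (srt_modComp h' k') := by
  have hs : ∀ (w : Word (A ⊕ B)) (z : HConf A B) (h : Spread 3 w z.1) (v : ∀ b, Word (D b))
      (y : ∀ b, Conf (D b)) (k : ∀ b, Srt (v b) (y b).1) (t : unitInterval),
      Srt (CoPB.modCompWord w v) (CoPB.modCompMap A D (segPath (segClosed_hconfP A B) w.hconf z
        ((srt_hconf w).compat (h.srt (by norm_num) z.2.1)) t, fun b =>
          segPath (segClosed_confP _) (v b).conf (y b) ((srt_conf (v b)).compat (k b)) t)).1 :=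
    fun w z h v y k t => srt_modComp ((spread_hconf w).three.lin h t.2.1 t.2.2)
      fun b => Srt.lin (v b).conf_sorted (k b) t.2.1 t.2.2
  exact arr_liftTo_multi (segClosed_hconfP _ _) (segClosed_hconfP _ _) (fun _ => segClosed_confP _)
    Word.hconf Word.hconf_sorted Word.hconf Word.hconf_sorted (fun _ => Word.conf)
    (fun _ => Word.conf_sorted) (CoPB.modCompMap A D) (fun q => CoPB.modCompWord q.1 q.2) _
    (fun w v => srt_modComp (spread_hconf w).three fun b => (v b).conf_sorted) (fun _ _ => rfl)
    p _ _ q k k' (hs w z h v y k) (hs w' z' h' v' y' k') _ _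

/-- The relative positions of the points inserted by `CoPB.opCompMap`. -/
abbrev opPos (B : Type) {C D : A → Type} (y : ∀ a, HConf (C a) (D a)) :
    (Σ a, C a) ⊕ (B ⊕ Σ a, D a) → ℂ :=
  Sum.elim (fun t => (y t.1).1 (Sum.inl t.2))
    (Sum.elim (fun _ => 0) fun t => (y t.1).1 (Sum.inr t.2))

theorem opPos_norm (B : Type) {C D : A → Type} (y : ∀ a, HConf (C a) (D a)) (t) :
    ‖opPos B y t‖ ≤ 1 := by
  rcases t with t | b | t
  · exact (y t.1).2.2.1 _
  · simp [opPos]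
  · exact (y t.1).2.2.1 _

theorem srt_opComp [Finite A] [Finite B] {C D : A → Type} {w : Word (A ⊕ B)}
    {v : ∀ a, Word (C a ⊕ D a)} {z : HConf A B} {y : ∀ a, HConf (C a) (D a)} (h : Spread 3 w z.1)
    (k : ∀ a, Srt (v a) (y a).1) :
    Srt (CoPB.opCompWord w v) (CoPB.opCompMap B C D (z, y)).1 :=
  h.insert_srt (tight_radius z.2.1 z.2.2.1) (opPos_norm B y) (by
    rintro (a | b)
    · refine List.pairwise_map.2 ((k a).imp ?_)
      rintro (c | d) (c' | d') h <;> exact h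
    · exact List.pairwise_singleton _ _)

theorem spread_opComp [Finite A] [Finite B] {C D : A → Type} {w : Word (A ⊕ B)}
    {v : ∀ a, Word (C a ⊕ D a)} {z : HConf A B} {y : ∀ a, HConf (C a) (D a)}
    (h : Spread (3 / 2) w z.1) (k : ∀ a, Spread (3 / 2) (v a) (y a).1) :
    Spread 3 (CoPB.opCompWord w v) (CoPB.opCompMap B C D (z, y)).1 :=
  h.insert (tight_radius z.2.1 z.2.2.1) (opPos_norm B y) (by
    rintro (a | b)
    · refine List.pairwise_map.2 ((k a).imp ?_)
      rintro (c | d) (c' | d') h <;> exact h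
    · exact List.pairwise_singleton _ _)

theorem hcoC_hcoA [Finite A] [Finite B] {C D : A → Type}
    {w w' : Word (A ⊕ B)} {z z' : HConf A B} (p : Path z z') (h : Spread 3 w z.1)
    (h' : Spread 3 w' z'.1) {v v' : ∀ a, Word (C a ⊕ D a)} {y y' : ∀ a, HConf (C a) (D a)}
    (q : ∀ a, Path (y a) (y' a)) (k : ∀ a, Srt (v a) (y a).1) (k' : ∀ a, Srt (v' a) (y' a).1) :
    hcoC (hcoA p (h.srt (by norm_num) z.2.1) (h'.srt (by norm_num) z'.2.1))
        (fun a => hcoA (q a) (k a) (k' a))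
      = hcoA (mapPath (CoPB.opCompMap B C D) p q) (srt_opComp h k) (srt_opComp h' k') := by
  have hs : ∀ (w : Word (A ⊕ B)) (z : HConf A B) (h : Spread 3 w z.1)
      (v : ∀ a, Word (C a ⊕ D a)) (y : ∀ a, HConf (C a) (D a)) (k : ∀ a, Srt (v a) (y a).1)
      (t : unitInterval),
      Srt (CoPB.opCompWord w v) (CoPB.opCompMap B C D (segPath (segClosed_hconfP A B) w.hconf z
        ((srt_hconf w).compat (h.srt (by norm_num) z.2.1)) t, fun a =>
          segPath (segClosed_hconfP _ _) (v a).hconf (y a)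
            ((srt_hconf (v a)).compat (k a)) t)).1 :=
    fun w z h v y k t => srt_opComp ((spread_hconf w).three.lin h t.2.1 t.2.2)
      fun a => Srt.lin (v a).hconf_sorted (k a) t.2.1 t.2.2
  exact arr_liftTo_multi (segClosed_hconfP _ _) (segClosed_hconfP _ _)
    (fun _ => segClosed_hconfP _ _) Word.hconf Word.hconf_sorted Word.hconf Word.hconf_sorted
    (fun _ => Word.hconf) (fun _ => Word.hconf_sorted) (CoPB.opCompMap B C D)
    (fun q => CoPB.opCompWord q.1 q.2) _
    (fun w v => srt_opComp (spread_hconf w).three fun a => (v a).hconf_sorted) (fun _ _ => rfl)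
    p _ _ q k k' (hs w z h v y k) (hs w' z' h' v' y' k') _ _

theorem coA_refl (w : Word I) :
    coA (Path.refl w.conf) (srt_conf w) (srt_conf w) = Arrow.mk (𝟙 (show CoB I from w)) :=
  mkA_refl _ _ _ w

theorem hcoA_refl (w : Word (A ⊕ B)) :
    hcoA (Path.refl w.hconf) (srt_hconf w) (srt_hconf w) = Arrow.mk (𝟙 (show CoPB A B from w)) :=
  mkA_refl _ _ _ w

/-- The one-letter word that is the closed unit. -/
abbrev clOneWord : Word Unit :=
  ⟨[()], List.nodup_singleton _, fun _ => List.mem_singleton.2 rfl⟩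

/-- The one-letter word that is the open unit. -/
abbrev opOneWord : Word (Unit ⊕ Empty) :=
  ⟨[Sum.inl ()], List.nodup_singleton _, by rintro (⟨⟩ | ⟨⟨⟩⟩); simp⟩

/-- The identity of the closed unit, as an arrow. -/
def co1 : Arrow (CoB Unit) := Arrow.mk (𝟙 (show CoB Unit from clOneWord))

/-- The identity of the open unit, as an arrow. -/
def hco1 : Arrow (CoPB Unit Empty) := Arrow.mk (𝟙 (show CoPB Unit Empty from opOneWord))

theorem co1_eq : co1
    = coA (Path.refl clOneWord.conf) (srt_conf clOneWord) (srt_conf clOneWord) :=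
  (coA_refl clOneWord).symm

theorem hco1_eq : hco1
    = hcoA (Path.refl opOneWord.hconf) (srt_hconf opOneWord) (srt_hconf opOneWord) :=
  (hcoA_refl opOneWord).symm

end rules

/-! ### Operad laws for words -/

section words

variable {A A' B B' : Type}

theorem compWord_outer {D : B' → Type} (e : B ≃ B') (w : Word B) (v : ∀ b, Word (D b)) :
    CoB.compWord (w.map e) v
      = (CoB.compWord w fun b => v (e b)).map (Equiv.sigmaCongrLeft e) := by
  ext1
  simp [CoB.compWord, Word.bind, Word.map, List.map_flatMap, List.flatMap_map, Function.comp_def]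

theorem compWord_inner {D D' : B → Type} (e : ∀ b, D b ≃ D' b) (w : Word B)
    (v : ∀ b, Word (D b)) :
    CoB.compWord w (fun b => (v b).map (e b))
      = (CoB.compWord w v).map (Equiv.sigmaCongrRight e) := by
  ext1
  simp [CoB.compWord, Word.bind, Word.map, List.map_flatMap, Function.comp_def]

theorem compWord_one_left (w : Word B) :
    CoB.compWord clOneWord (fun _ => w) = w.map (unitEquiv B) := by
  ext1
  simp [CoB.compWord, Word.bind, Word.map, unitEquiv]

theorem compWord_one_right (w : Word B) :
    CoB.compWord w (fun _ => clOneWord) = w.map (unitEquiv' B) := by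
  ext1
  simp [CoB.compWord, Word.bind, Word.map, unitEquiv', ← List.map_eq_flatMap]

theorem compWord_assoc {D : B → Type} (E : ∀ b, D b → Type) (w : Word B) (v : ∀ b, Word (D b))
    (u : ∀ b d, Word (E b d)) :
    (CoB.compWord (CoB.compWord w v) fun bd : Σ b, D b => u bd.1 bd.2).map (Equiv.sigmaAssoc E)
      = CoB.compWord w fun b => CoB.compWord (v b) (u b) := by
  ext1
  simp [CoB.compWord, Word.bind, Word.map, List.map_flatMap, List.flatMap_map, List.flatMap_assoc,
    Function.comp_def, Equiv.sigmaAssoc]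

theorem modCompWord_outer {D : B' → Type} (eA : A ≃ A') (eB : B ≃ B') (w : Word (A ⊕ B))
    (v : ∀ b, Word (D b)) :
    CoPB.modCompWord (w.map (Equiv.sumCongr eA eB)) v
      = (CoPB.modCompWord w fun b => v (eB b)).map
          (Equiv.sumCongr eA (Equiv.sigmaCongrLeft eB)) := by
  ext1
  simp only [CoPB.modCompWord, Word.bind, Word.map, List.map_flatMap, List.flatMap_map]
  refine List.flatMap_congr ?_
  rintro (a | b) - <;> simp

theorem modCompWord_inner {D D' : B → Type} (e : ∀ b, D b ≃ D' b) (w : Word (A ⊕ B))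
    (v : ∀ b, Word (D b)) :
    CoPB.modCompWord w (fun b => (v b).map (e b))
      = (CoPB.modCompWord w v).map
          (Equiv.sumCongr (Equiv.refl A) (Equiv.sigmaCongrRight e)) := by
  ext1
  simp only [CoPB.modCompWord, Word.bind, Word.map, List.map_flatMap]
  refine List.flatMap_congr ?_
  rintro (a | b) - <;> simp

theorem modCompWord_one (w : Word (A ⊕ B)) :
    CoPB.modCompWord w (fun _ => clOneWord)
      = w.map (Equiv.sumCongr (Equiv.refl A) (unitEquiv' B)) := by
  ext1
  simp only [CoPB.modCompWord, Word.bind, Word.map]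
  rw [← List.flatMap_pure_eq_map]
  refine List.flatMap_congr ?_
  rintro (a | b) - <;> rfl

theorem modCompWord_assoc {D : B → Type} (E : ∀ b, D b → Type) (w : Word (A ⊕ B))
    (v : ∀ b, Word (D b)) (u : ∀ b d, Word (E b d)) :
    (CoPB.modCompWord (CoPB.modCompWord w v) fun bd : Σ b, D b => u bd.1 bd.2).map
        (Equiv.sumCongr (Equiv.refl A) (Equiv.sigmaAssoc E))
      = CoPB.modCompWord w fun b => CoB.compWord (v b) (u b) := by
  ext1
  simp only [CoPB.modCompWord, CoB.compWord, Word.bind, Word.map, List.map_flatMap,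
    List.flatMap_assoc]
  refine List.flatMap_congr ?_
  rintro (a | b) -
  · simp
  · simp [List.flatMap_map, Equiv.sigmaAssoc]
    rfl

theorem opCompWord_outer {C D : A' → Type} (eA : A ≃ A') (eB : B ≃ B') (w : Word (A ⊕ B))
    (v : ∀ a, Word (C a ⊕ D a)) :
    CoPB.opCompWord (w.map (Equiv.sumCongr eA eB)) v
      = (CoPB.opCompWord w fun a => v (eA a)).map (Equiv.sumCongr (Equiv.sigmaCongrLeft eA)
          (Equiv.sumCongr eB (Equiv.sigmaCongrLeft eA))) := by
  ext1
  simp only [CoPB.opCompWord, Word.bind, Word.map, List.map_flatMap, List.flatMap_map]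
  refine List.flatMap_congr ?_
  rintro (a | b) -
  · simp only [Equiv.sumCongr_apply, Sum.map_inl, Sum.elim_inl, List.map_map]
    refine List.map_congr_left ?_
    rintro (c | d) - <;> rfl
  · simp

theorem opCompWord_inner {C C' D D' : A → Type} (eC : ∀ a, C a ≃ C' a) (eD : ∀ a, D a ≃ D' a)
    (w : Word (A ⊕ B)) (v : ∀ a, Word (C a ⊕ D a)) :
    CoPB.opCompWord w (fun a => (v a).map (Equiv.sumCongr (eC a) (eD a)))
      = (CoPB.opCompWord w v).map (Equiv.sumCongr (Equiv.sigmaCongrRight eC)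
          (Equiv.sumCongr (Equiv.refl B) (Equiv.sigmaCongrRight eD))) := by
  ext1
  simp only [CoPB.opCompWord, Word.bind, Word.map, List.map_flatMap]
  refine List.flatMap_congr ?_
  rintro (a | b) -
  · simp only [Sum.elim_inl, List.map_map]
    refine List.map_congr_left ?_
    rintro (c | d) - <;> rfl
  · simp

theorem opCompWord_one_left (w : Word (A ⊕ B)) :
    CoPB.opCompWord opOneWord (fun _ => w) = w.map (Equiv.sumCongr (unitEquiv A)
      ((unitEquiv B).trans (Equiv.emptySum Empty _).symm)) := by
  ext1
  simp only [CoPB.opCompWord, Word.bind, Word.map, List.flatMap_cons, Sum.elim_inl,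
    List.flatMap_nil, List.append_nil]
  refine List.map_congr_left ?_
  rintro (c | d) - <;> rfl

theorem opCompWord_one_right (w : Word (A ⊕ B)) :
    CoPB.opCompWord w (fun _ => opOneWord)
      = w.map (Equiv.sumCongr (unitEquiv' A) (unitEquiv'' A B)) := by
  ext1
  simp only [CoPB.opCompWord, Word.bind, Word.map]
  rw [← List.flatMap_pure_eq_map]
  refine List.flatMap_congr ?_
  rintro (a | b) - <;> rfl

theorem opCompWord_assoc {C D : A → Type} (C' D' : ∀ a, C a → Type) (w : Word (A ⊕ B))
    (v : ∀ a, Word (C a ⊕ D a)) (u : ∀ a c, Word (C' a c ⊕ D' a c)) :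
    (CoPB.opCompWord (CoPB.opCompWord w v) fun ac : Σ a, C a => u ac.1 ac.2).map
        (Equiv.sumCongr (Equiv.sigmaAssoc C') (assocEquiv D'))
      = CoPB.opCompWord w fun a => CoPB.opCompWord (v a) (u a) := by
  ext1
  simp only [CoPB.opCompWord, Word.bind, Word.map, List.map_flatMap, List.flatMap_assoc]
  refine List.flatMap_congr ?_
  rintro (a | b) -
  · simp only [Sum.elim_inl, List.flatMap_map]
    refine List.flatMap_congr ?_
    rintro (c | d) -
    · simp only [Sum.map_inl, Sum.elim_inl, List.map_map]
      refine List.map_congr_left ?_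
      rintro (c | d) - <;> rfl
    · rfl
  · rfl

theorem modCompWord_opCompWord {C D : A → Type} (E : (B ⊕ Σ a, D a) → Type) (w : Word (A ⊕ B))
    (v : ∀ a, Word (C a ⊕ D a)) (u : ∀ x, Word (E x)) :
    (CoPB.modCompWord (CoPB.opCompWord w v) u).map
        (Equiv.sumCongr (Equiv.refl _) (modEquiv E))
      = CoPB.opCompWord (CoPB.modCompWord w fun b => u (Sum.inl b))
          fun a => CoPB.modCompWord (v a) fun d => u (Sum.inr ⟨a, d⟩) := by
  ext1
  simp only [CoPB.opCompWord, CoPB.modCompWord, Word.bind, Word.map, List.map_flatMap,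
    List.flatMap_assoc]
  refine List.flatMap_congr ?_
  rintro (a | b) -
  · simp only [Sum.elim_inl, List.flatMap_map, List.flatMap_cons, List.flatMap_nil, List.append_nil]
    refine List.flatMap_congr ?_
    rintro (c | d) -
    · rfl
    · simp only [Sum.map_inr, Sum.elim_inr, List.map_map]
      rfl
  · simp only [Sum.elim_inr, List.flatMap_cons, List.flatMap_nil, List.append_nil,
      List.map_map, List.flatMap_map]
    rw [← List.map_eq_flatMap]
    rfl

end words

/-! ### Estimates for iterated insertions -/

section nest

variable {X Y T : Type}

/-- The configuration `φ` consists of points in three nested scales: the positions `z` of the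
blocks, the much smaller displacements `d` inside of the blocks, and the displacements `e`, much
smaller again.  The scale factors of the inner displacements may depend on the block. -/
def Nest (x : Y → X) (y : T → Y) (z : X → ℂ) (d : Y → ℂ) (e : T → ℂ) (φ : T → ℂ) : Prop :=
  ∃ (α : ℝ) (β γ : Y → ℝ), (∀ t, φ t = α * z (x (y t)) + (β (y t) * d (y t) + γ (y t) * e t)) ∧
    (∀ t, 0 ≤ β (y t)) ∧ (∀ t, 0 < γ (y t)) ∧
    (∀ s t, x (y s) ≠ x (y t) →
      (β (y s) + γ (y s)) + (β (y t) + γ (y t)) < α * ‖z (x (y s)) - z (x (y t))‖) ∧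
    ∀ s t, y s ≠ y t → x (y s) = x (y t) →
      β (y s) = β (y t) ∧ γ (y s) + γ (y t) < β (y s) * ‖d (y s) - d (y t)‖

theorem norm_real_mul {r : ℝ} (hr : 0 ≤ r) (v : ℂ) : ‖(r : ℂ) * v‖ = r * ‖v‖ := by
  rw [norm_mul, Complex.norm_real, Real.norm_of_nonneg hr]

theorem norm_real_mul_le {r : ℝ} (hr : 0 ≤ r) {v : ℂ} (hv : ‖v‖ ≤ 1) : ‖(r : ℂ) * v‖ ≤ r := by
  rw [norm_real_mul hr]
  exact mul_le_of_le_one_right hr hv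

/-- The difference of two points of a nested configuration is dominated by the first scale in which
the two points differ. -/
theorem Nest.vector {x : Y → X} {y : T → Y} {z : X → ℂ} {d : Y → ℂ} {e φ : T → ℂ}
    (hd : ∀ y, ‖d y‖ ≤ 1) (he : ∀ t, ‖e t‖ ≤ 1)
    (hinj : ∀ s t, y s = y t → e s = e t → s = t) (h : Nest x y z d e φ) {s t : T} (hst : s ≠ t) :
    (x (y s) ≠ x (y t) → ∃ α : ℝ,
      ‖φ s - φ t - α * (z (x (y s)) - z (x (y t)))‖ < α * ‖z (x (y s)) - z (x (y t))‖) ∧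
    (x (y s) = x (y t) → y s ≠ y t → ∃ α : ℝ,
      ‖φ s - φ t - α * (d (y s) - d (y t))‖ < α * ‖d (y s) - d (y t)‖) ∧
    (y s = y t → ∃ α : ℝ, ‖φ s - φ t - α * (e s - e t)‖ < α * ‖e s - e t‖) := by
  obtain ⟨α, β, γ, hφ, hβ, hγ, h1, h2⟩ := h
  refine ⟨fun hx => ⟨α, ?_⟩, fun hx hy => ⟨β (y s), ?_⟩, fun hy => ⟨γ (y s), ?_⟩⟩
  · refine lt_of_le_of_lt ?_ (h1 s t hx)
    rw [hφ, hφ, show (α * z (x (y s)) + (β (y s) * d (y s) + γ (y s) * e s) -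
      (α * z (x (y t)) + (β (y t) * d (y t) + γ (y t) * e t)) - α * (z (x (y s)) - z (x (y t))) : ℂ)
      = (β (y s) * d (y s) + γ (y s) * e s) - (β (y t) * d (y t) + γ (y t) * e t) by ring]
    refine (norm_sub_le _ _).trans ?_
    have k : ∀ t, ‖(β (y t) * d (y t) + γ (y t) * e t : ℂ)‖ ≤ β (y t) + γ (y t) := fun t =>
      (norm_add_le _ _).trans (add_le_add (norm_real_mul_le (hβ t) (hd _))
        (norm_real_mul_le (hγ t).le (he _)))
    exact add_le_add (k s) (k t)
  · obtain ⟨h3, h4⟩ := h2 s t hy hx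
    refine lt_of_le_of_lt ?_ h4
    rw [hφ, hφ, ← h3, hx, show (α * z (x (y t)) + (β (y s) * d (y s) + γ (y s) * e s) -
      (α * z (x (y t)) + (β (y s) * d (y t) + γ (y t) * e t)) - β (y s) * (d (y s) - d (y t)) : ℂ)
      = γ (y s) * e s - γ (y t) * e t by ring]
    exact (norm_sub_le _ _).trans (add_le_add (norm_real_mul_le (hγ s).le (he _))
        (norm_real_mul_le (hγ t).le (he _)))
  · rw [hφ, hφ, hy, show (α * z (x (y t)) + (β (y t) * d (y t) + γ (y t) * e s) -
      (α * z (x (y t)) + (β (y t) * d (y t) + γ (y t) * e t)) - γ (y t) * (e s - e t) : ℂ)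
      = 0 by ring, norm_zero]
    exact mul_pos (hγ t) (norm_pos_iff.2 (sub_ne_zero.2 fun h => hst (hinj s t hy h)))

/-- Nested configurations with the same data on each scale are joined by a linear path. -/
theorem Nest.compat {x : Y → X} {y : T → Y} {z : X → ℂ} {d : Y → ℂ} {e φ ψ : T → ℂ}
    (hd : ∀ y, ‖d y‖ ≤ 1) (he : ∀ t, ‖e t‖ ≤ 1)
    (hinj : ∀ s t, y s = y t → e s = e t → s = t) (h : Nest x y z d e φ) (h' : Nest x y z d e ψ) :
    Compat φ ψ := by
  refine Compat.of_vector fun s t hst => ?_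
  obtain ⟨h1, h2, h3⟩ := h.vector hd he hinj hst
  obtain ⟨h1', h2', h3'⟩ := h'.vector hd he hinj hst
  by_cases hx : x (y s) = x (y t)
  · by_cases hy : y s = y t
    · obtain ⟨α, h⟩ := h3 hy
      obtain ⟨α', h'⟩ := h3' hy
      exact ⟨_, α, α', h, h'⟩
    · obtain ⟨α, h⟩ := h2 hx hy
      obtain ⟨α', h'⟩ := h2' hx hy
      exact ⟨_, α, α', h, h'⟩
  · obtain ⟨α, h⟩ := h1 hx
    obtain ⟨α', h'⟩ := h1' hx
    exact ⟨_, α, α', h, h'⟩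

theorem Tight.norm_pos {z : X → ℂ} {r : ℝ} (h : Tight z r) {x x' : X} (hx : x ≠ x') :
    0 < ‖z x - z x'‖ := by
  have := h.1
  have := h.2 x x' hx
  linarith

theorem norm_insert_sub_le {z : X → ℂ} {r : ℝ} (hr : 0 ≤ r) {p : T → X} {d : T → ℂ}
    (hd : ∀ t, ‖d t‖ ≤ 1) (s t : T) :
    ‖insert z r p d s - insert z r p d t‖ ≤ (‖z (p s) - z (p t)‖ + r * 2) / 2 := by
  have h3 : insert z r p d s - insert z r p d t = ((z (p s) - z (p t)) + r * (d s - d t)) / 2 := by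
    unfold insert
    ring
  rw [h3, norm_div, show ‖(2 : ℂ)‖ = 2 by simp]
  have h4 : ‖(r : ℂ) * (d s - d t)‖ ≤ r * 2 := by
    rw [norm_real_mul hr]
    have := norm_sub_le (d s) (d t)
    have := hd s
    have := hd t
    gcongr
    linarith
  have h5 := norm_add_le (z (p s) - z (p t)) (r * (d s - d t))
  linarith

/-- Insertion in a configuration that is itself obtained by insertion. -/
theorem nest_insert_insert {x : Y → X} {y : T → Y} {z : X → ℂ} {d : Y → ℂ} {e : T → ℂ} {r r' : ℝ}
    (hd : ∀ y, ‖d y‖ ≤ 1) (hr : Tight z r) (hr' : Tight (insert z r x d) r') :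
    Nest x y z d e (insert (insert z r x d) r' y e) := by
  have h0 := hr.1
  have h0' := hr'.1
  refine ⟨1 / 4, fun _ => r / 4, fun _ => r' / 2, fun t => ?_, fun _ => by positivity,
    fun _ => by positivity, fun s t hst => ?_, fun s t hst hx => ⟨rfl, ?_⟩⟩
  · unfold insert
    push_cast
    ring
  · have h1 := hr.2 _ _ hst
    have h2 := hr'.2 (y s) (y t) fun h => hst (congrArg x h)
    have h3 := norm_insert_sub_le (z := z) (p := x) h0.le hd (y s) (y t)
    linarith
  · have h2 := hr'.2 (y s) (y t) hst
    have h3 : insert z r x d (y s) - insert z r x d (y t)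
        = (r * (d (y s) - d (y t))) / 2 := by
      unfold insert
      rw [hx]
      ring
    rw [h3, norm_div, norm_real_mul h0.le, show ‖(2 : ℂ)‖ = 2 by simp] at h2
    linarith

/-- Insertion of configurations that are themselves obtained by insertion. -/
theorem nest_insert {x : Y → X} {y : T → Y} {z : X → ℂ} {d : Y → ℂ} {e : T → ℂ} {r : ℝ}
    {ρ : Y → ℝ} (hr : Tight z r) (hρ : ∀ y, 0 < ρ y) (hρ' : ∀ y, ρ y ≤ 1 / 4)
    (hρ'' : ∀ y y', y ≠ y' → x y = x y' → ρ y ≤ ‖d y - d y'‖ / 8) {p : T → X}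
    (hp : ∀ t, p t = x (y t)) {δ : T → ℂ}
    (hδ : ∀ t, δ t = (d (y t) + ρ (y t) * e t) / 2) :
    Nest x y z d e (insert z r p δ) := by
  have h0 := hr.1
  refine ⟨1 / 2, fun _ => r / 4, fun y => r * ρ y / 4, fun t => ?_, fun _ => by positivity,
    fun t => ?_, fun s t hst => ?_, fun s t hst hx => ⟨rfl, ?_⟩⟩
  · unfold insert
    rw [hδ, hp]
    push_cast
    ring
  · have := hρ (y t)
    positivity
  · have h1 := hr.2 _ _ hst
    have h2 := mul_le_mul_of_nonneg_left (hρ' (y s)) h0.le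
    have h3 := mul_le_mul_of_nonneg_left (hρ' (y t)) h0.le
    linarith
  · have h2 := mul_le_mul_of_nonneg_left (hρ'' _ _ hst hx) h0.le
    have h3 := mul_le_mul_of_nonneg_left (hρ'' _ _ (Ne.symm hst) hx.symm) h0.le
    rw [norm_sub_rev] at h3
    have h4 : 0 < r * ‖d (y s) - d (y t)‖ := by
      have := hρ (y s)
      have := hρ'' _ _ hst hx
      have : 0 < ‖d (y s) - d (y t)‖ := by linarith
      positivity
    linarith

/-- Two insertions in neighbourhoods of different width: only the differences of the positions
inside of each neighbourhood matter. -/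
theorem compat_insert_of_block {x : T → X} {z : X → ℂ} {d d' : T → ℂ} {r r' : ℝ} (hr : Tight z r)
    (hr' : Tight z r') (hd : ∀ t, ‖d t‖ ≤ 1) (hd' : ∀ t, ‖d' t‖ ≤ 1)
    (hdd : ∀ s t, x s = x t → d s - d t = d' s - d' t)
    (hinj : ∀ s t, x s = x t → d s = d t → s = t) :
    Compat (insert z r x d) (insert z r' x d') := by
  refine Compat.of_vector fun s t hst => ?_
  by_cases hx : x s = x t
  · have key : ∀ (r : ℝ) (d : T → ℂ), insert z r x d s - insert z r x d t
        - ((r / 2 : ℝ) : ℂ) * (d s - d t) = 0 := fun r d => by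
      unfold insert
      rw [hx]
      push_cast
      ring
    have hpos := norm_pos_iff.2 (sub_ne_zero.2 fun h => hst (hinj s t hx h))
    have h0 := hr.1
    have h0' := hr'.1
    refine ⟨d s - d t, r / 2, r' / 2, ?_, ?_⟩
    · rw [key, norm_zero]
      positivity
    · rw [hdd s t hx, key, norm_zero, ← hdd s t hx]
      positivity
  · have key : ∀ (r : ℝ) (d : T → ℂ), Tight z r → (∀ t, ‖d t‖ ≤ 1) → ‖insert z r x d s
        - insert z r x d t - ((1 / 2 : ℝ) : ℂ) * (z (x s) - z (x t))‖
        < 1 / 2 * ‖z (x s) - z (x t)‖ := fun r d hr hd => by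
      have h0 := hr.1
      have h1 := hr.2 _ _ hx
      have h2 : insert z r x d s - insert z r x d t - ((1 / 2 : ℝ) : ℂ) * (z (x s) - z (x t))
          = (r : ℂ) * (d s - d t) / 2 := by
        unfold insert
        push_cast
        ring
      have h3 : ‖d s - d t‖ ≤ 2 := by
        have := norm_sub_le (d s) (d t)
        linarith [hd s, hd t]
      rw [h2, norm_div, norm_real_mul h0.le, show ‖(2 : ℂ)‖ = 2 by simp]
      nlinarith
    exact ⟨_, _, _, key r d hr hd, key r' d' hr' hd'⟩

/-- Two insertions of the same configurations in neighbourhoods of different width. -/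
theorem compat_insert {x : T → X} {z : X → ℂ} {d : T → ℂ} {r r' : ℝ} (hr : Tight z r)
    (hr' : Tight z r') (hd : ∀ t, ‖d t‖ ≤ 1) (hinj : ∀ s t, x s = x t → d s = d t → s = t) :
    Compat (insert z r x d) (insert z r' x d) :=
  compat_insert_of_block hr hr' hd hd (fun _ _ _ => rfl) hinj

/-- Insertion of at most one point in each neighbourhood. -/
theorem compat_insert_of_injective {x : T → X} (hx : Function.Injective x) {z : X → ℂ} {d : T → ℂ}
    {r : ℝ} (hr : Tight z r) (hd : ∀ t, ‖d t‖ ≤ 1) :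
    Compat (insert z r x d) fun t => z (x t) := by
  refine Compat.of_vector fun s t hst => ⟨z (x s) - z (x t), 1 / 2, 1, ?_, ?_⟩
  · have h0 := hr.1
    have h1 := hr.2 _ _ fun h => hst (hx h)
    have h2 : insert z r x d s - insert z r x d t - ((1 / 2 : ℝ) : ℂ) * (z (x s) - z (x t))
        = (r : ℂ) * (d s - d t) / 2 := by
      unfold insert
      push_cast
      ring
    have h3 : ‖d s - d t‖ ≤ 2 := by
      have := norm_sub_le (d s) (d t)
      have := hd s
      have := hd t
      linarith
    rw [h2, norm_div, norm_real_mul h0.le, show ‖(2 : ℂ)‖ = 2 by simp]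
    nlinarith
  · simp only [Complex.ofReal_one, one_mul, sub_self, norm_zero]
    exact hr.norm_pos fun h => hst (hx h)

/-- Insertion in the neighbourhood of a single point. -/
theorem compat_insert_const {x : T → X} (hx : ∀ s t, x s = x t) {z : X → ℂ} {d : T → ℂ}
    (hd : Function.Injective d) {r : ℝ} (hr : 0 < r) : Compat (insert z r x d) d := by
  refine Compat.of_vector fun s t hst => ⟨d s - d t, r / 2, 1, ?_, ?_⟩
  · have h2 : insert z r x d s - insert z r x d t - ((r / 2 : ℝ) : ℂ) * (d s - d t) = 0 := by
      unfold insert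
      rw [hx s t]
      push_cast
      ring
    rw [h2, norm_zero]
    have := norm_pos_iff.2 (sub_ne_zero.2 fun h => hst (hd h))
    positivity
  · simp only [Complex.ofReal_one, one_mul, sub_self, norm_zero]
    exact norm_pos_iff.2 (sub_ne_zero.2 fun h => hst (hd h))

end nest

/-! ### The closed part of `CoPB₊` -/

section closed

variable {B B' : Type}

/-- Represented arrows for a family of coloured braids. -/
theorem exists_coA_family {K : Type} {D : K → Type} (g : ∀ k, Arrow (CoB (D k))) :
    ∃ (v v' : ∀ k, Word (D k)) (q : ∀ k, Path (v k).conf (v' k).conf),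
      g = fun k => coA (q k) (srt_conf (v k)) (srt_conf (v' k)) := by
  choose v v' q hq using fun k => exists_coA (g k)
  exact ⟨v, v', q, funext hq⟩

theorem exists_hcoA_family {K : Type} {C D : K → Type} (g : ∀ k, Arrow (CoPB (C k) (D k))) :
    ∃ (v v' : ∀ k, Word (C k ⊕ D k)) (q : ∀ k, Path (v k).hconf (v' k).hconf),
      g = fun k => hcoA (q k) (srt_hconf (v k)) (srt_hconf (v' k)) := by
  choose v v' q hq using fun k => exists_hcoA (g k)
  exact ⟨v, v', q, funext hq⟩

theorem confS {w : Word B} : Spread 3 w w.conf.1 := (spread_conf w).three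

theorem hconfS {A : Type} {w : Word (A ⊕ B)} : Spread 3 w w.hconf.1 := (spread_hconf w).three

theorem spread_relabel {w : Word B} {z : Conf B} (h : Spread 3 w z.1) (e : B ≃ B') :
    Spread 3 (w.map e) (CoB.relabelMap e z).1 := h.map e

theorem spread_hrelabel {A A' : Type} {w : Word (A ⊕ B)} {z : HConf A B} (h : Spread 3 w z.1)
    (e : A ≃ A') (e' : B ≃ B') :
    Spread 3 (w.map (Equiv.sumCongr e e')) (CoPB.relabelMap e e' z).1 :=
  h.map (Equiv.sumCongr e e')

theorem conf_tight [Finite B] (z : Conf B) : Tight z.1 (radius z.1) := tight_radius z.2.1 z.2.2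

theorem hconf_tight {A : Type} [Finite A] [Finite B] (z : HConf A B) : Tight z.1 (radius z.1) :=
  tight_radius z.2.1 z.2.2.1

theorem sigma_inj {D : B → Type} (y : ∀ b, Conf (D b)) (s t : Σ b, D b) (h : s.1 = t.1)
    (h' : (y s.1).1 s.2 = (y t.1).1 t.2) : s = t := by
  obtain ⟨b, d⟩ := s
  obtain ⟨b', d'⟩ := t
  obtain rfl : b = b' := h
  exact congrArg _ ((y b).2.1 h')

theorem coM_refl (f : Arrow (CoB B)) : coM (Equiv.refl B) f = f := by
  obtain ⟨w, w', p, rfl⟩ := exists_coA f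
  rw [coM_coA]
  refine coA_congr ?_ ?_ fun t => Compat.refl (p t).2.1
  all_goals
    ext1
    exact List.map_id _

theorem coM_trans {B'' : Type} (e : B ≃ B') (e' : B' ≃ B'')
    (f : Arrow (CoB B)) :
    coM (e.trans e') f = coM e' (coM e f) := by
  obtain ⟨w, w', p, rfl⟩ := exists_coA f
  rw [coM_coA, coM_coA, coM_coA]
  refine coA_congr ?_ ?_ fun t => Compat.refl (CoB.relabelMap (e.trans e') (p t)).2.1
  all_goals
    ext1
    simp [Word.map]

theorem coC_outer [Finite B] [Finite B'] {D : B' → Type} (e : B ≃ B')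
    (f : Arrow (CoB B)) (g : ∀ b, Arrow (CoB (D b))) :
    coC (coM e f) g
      = coM (Equiv.sigmaCongrLeft e) (coC f fun b => g (e b)) := by
  obtain ⟨w, w', p, rfl⟩ := exists_coA f
  obtain ⟨v, v', q, rfl⟩ := exists_coA_family g
  rw [coM_coA, coC_coA _ (spread_relabel confS e) (spread_relabel confS e) q _ _,
    coC_coA _ confS confS (fun b => q (e b)) _ _, coM_coA]
  refine coA_congr (compWord_outer e w v) (compWord_outer e w' v') fun t => ?_
  -- The width of the neighbourhoods is irrelevant, so it need not be compared after relabelling.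
  have key := (compat_insert (z := (CoB.relabelMap e (p t)).1) (x := Sigma.fst)
    (r' := radius (p t).1) (conf_tight _)
    ⟨(conf_tight (p t)).1, fun x y h => (conf_tight (p t)).2 _ _ (e.symm.injective.ne h)⟩
    (confP_norm_sigma fun b => q b t) (sigma_inj fun b => q b t))
  refine key.congr rfl ?_
  funext ⟨b, d⟩
  obtain ⟨b, rfl⟩ := e.surjective b
  change (_ + _) / 2 = (_ + _) / 2
  have h1 : (Equiv.sigmaCongrLeft (β := D) e).symm ⟨e b, d⟩ = ⟨b, d⟩ := by
    rw [Equiv.symm_apply_eq]; rfl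
  rw [h1]
  simp [CoB.relabelMap]

theorem coC_inner [Finite B] {D D' : B → Type}
    (e : ∀ b, D b ≃ D' b) (f : Arrow (CoB B)) (g : ∀ b, Arrow (CoB (D b))) :
    coC f (fun b => coM (e b) (g b))
      = coM (Equiv.sigmaCongrRight e) (coC f g) := by
  obtain ⟨w, w', p, rfl⟩ := exists_coA f
  obtain ⟨v, v', q, rfl⟩ := exists_coA_family g
  simp only [coM_coA]
  rw [coC_coA _ confS confS (fun b => (q b).map (CoB.relabelMap (e b)).continuous) _ _,
    coC_coA _ confS confS q _ _, coM_coA]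
  exact coA_congr (compWord_inner e w v) (compWord_inner e w' v') fun t =>
    Compat.refl (CoB.compMap D' (p t, fun b => CoB.relabelMap (e b) (q b t))).2.1

theorem one_coC (f : Arrow (CoB B)) :
    coC co1 (fun _ => f) = coM (unitEquiv B) f := by
  obtain ⟨w, w', p, rfl⟩ := exists_coA f
  rw [co1_eq, coC_coA _ confS confS (fun _ => p) _ _, coM_coA]
  exact coA_congr (compWord_one_left w) (compWord_one_left w') fun t =>
    compat_insert_const (fun _ _ => rfl) ((p t).2.1.comp (unitEquiv B).symm.injective)
      (conf_tight _).1

theorem coC_one [Finite B] (f : Arrow (CoB B)) :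
    coC f (fun _ => co1) = coM (unitEquiv' B) f := by
  obtain ⟨w, w', p, rfl⟩ := exists_coA f
  rw [co1_eq, coC_coA _ confS confS (fun _ => Path.refl clOneWord.conf) _ _, coM_coA]
  exact coA_congr (compWord_one_right w) (compWord_one_right w') fun t =>
    compat_insert_of_injective (unitEquiv' B).symm.injective (conf_tight (p t))
      (confP_norm_sigma fun _ => clOneWord.conf)

/-- The two iterated insertions of configurations of the disk are joined by a linear path. -/
theorem compat_comp_comp [Finite B] {D : B → Type} [∀ b, Finite (D b)] (E : ∀ b, D b → Type)
    (z : Conf B) (y : ∀ b, Conf (D b)) (e : ∀ b d, Conf (E b d)) :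
    Compat (CoB.relabelMap (Equiv.sigmaAssoc E) (CoB.compMap _ (CoB.compMap D (z, y),
        fun bd : Σ b, D b => e bd.1 bd.2))).1
      (CoB.compMap _ (z, fun b => CoB.compMap (E b) (y b, e b))).1 := by
  have hd := confP_norm_sigma y
  have h1 := nest_insert_insert (x := Sigma.fst) (y := fun t => ((Equiv.sigmaAssoc E).symm t).1)
    (e := fun t' => (e t'.1 t'.2.1).1 t'.2.2) hd (conf_tight z) (conf_tight (CoB.compMap D (z, y)))
  have h2 : Nest Sigma.fst (fun t => ((Equiv.sigmaAssoc E).symm t).1) z.1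
      (fun t : Σ b, D b => (y t.1).1 t.2) (fun t' => (e t'.1 t'.2.1).1 t'.2.2)
      (insert z.1 (radius z.1) (fun t => ((Equiv.sigmaAssoc E).symm t).1.1)
        fun t' => (CoB.compMap (E t'.1) (y t'.1, e t'.1)).1 t'.2) :=
    nest_insert (x := Sigma.fst) (d := fun t : Σ b, D b => (y t.1).1 t.2)
      (ρ := fun y' => radius (y y'.1).1)
      (conf_tight z)
      (fun y' => (conf_tight (y y'.1)).1) (fun y' => radius_le_quarter (y y'.1).2.2) (by
        rintro ⟨b, d⟩ ⟨b', d'⟩ hne h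
        obtain rfl : b = b' := h
        exact (conf_tight (y b)).2 _ _ fun h => hne (congrArg _ h)) (fun _ => rfl) fun _ => rfl
  refine Nest.compat hd (fun t' => (e t'.1 t'.2.1).2.2 _) ?_ h1 h2
  rintro ⟨b, d, x⟩ ⟨b', d', x'⟩ hst h
  obtain ⟨rfl, h2⟩ := Sigma.mk.inj hst
  obtain rfl := eq_of_heq h2
  have := (e b d).2.1 h
  subst this
  rfl

theorem coC_assoc [Finite B] {D : B → Type} [∀ b, Finite (D b)] (E : ∀ b, D b → Type)
    (f : Arrow (CoB B)) (g : ∀ b, Arrow (CoB (D b)))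
    (h : ∀ b d, Arrow (CoB (E b d))) :
    coM (Equiv.sigmaAssoc E) (coC (coC f g) fun bd => h bd.1 bd.2)
      = coC f fun b => coC (g b) (h b) := by
  obtain ⟨w, w', p, rfl⟩ := exists_coA f
  obtain ⟨v, v', q, rfl⟩ := exists_coA_family g
  choose u u' s hs using fun b => exists_coA_family (h b)
  obtain rfl : h = _ := funext hs
  have h1 : ∀ b, coC (coA (q b) (srt_conf (v b)) (srt_conf (v' b)))
      (fun d => coA (s b d) (srt_conf (u b d)) (srt_conf (u' b d))) = _ := fun b =>
    coC_coA _ confS confS (s b) (fun _ => srt_conf _) (fun _ => srt_conf _)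
  simp only [h1]
  rw [coC_coA _ confS confS q _ _,
    coC_coA _ (spread_comp (spread_conf w) fun b => spread_conf (v b))
      (spread_comp (spread_conf w') fun b => spread_conf (v' b))
      (fun bd : Σ b, D b => s bd.1 bd.2) (fun _ => srt_conf _) (fun _ => srt_conf _),
    coC_coA _ confS confS (fun b => mapPath (CoB.compMap (E b)) (q b) (s b)) _ _, coM_coA]
  refine coA_congr (compWord_assoc E w v u) (compWord_assoc E w' v' u') fun t => ?_
  exact compat_comp_comp E (p t) (fun b => q b t) (fun b d => s b d t)

end closed

/-! ### Iterated insertions in the half disk -/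

section geometry

variable {A B : Type}

theorem modPos_inj {D : B → Type} (y : ∀ b, Conf (D b)) (s t : A ⊕ Σ b, D b)
    (h : Sum.map id Sigma.fst s = Sum.map id Sigma.fst t) (h' : modPos A y s = modPos A y t) :
    s = t := by
  rcases s with a | ⟨b, d⟩ <;> rcases t with a' | ⟨b', d'⟩
  · simpa using h
  · simp at h
  · simp at h
  · obtain rfl : b = b' := by simpa using h
    exact congrArg _ (congrArg _ ((y b).2.1 h'))

/-- The point of a configuration in whose neighbourhood a point is inserted by
`CoPB.opCompMap`. -/
abbrev opIdx (B : Type) (C D : A → Type) : (Σ a, C a) ⊕ (B ⊕ Σ a, D a) → A ⊕ B :=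
  Sum.elim (fun t => Sum.inl t.1) (Sum.elim Sum.inr fun t => Sum.inl t.1)

theorem opPos_inj {C D : A → Type} (y : ∀ a, HConf (C a) (D a)) (s t : (Σ a, C a) ⊕ (B ⊕ Σ a, D a))
    (h : opIdx B C D s = opIdx B C D t) (h' : opPos B y s = opPos B y t) : s = t := by
  rcases s with ⟨a, c⟩ | b | ⟨a, d⟩ <;> rcases t with ⟨a', c'⟩ | b' | ⟨a', d'⟩
  · obtain rfl : a = a' := by simpa using h
    have hc : c = c' := Sum.inl_injective ((y a).2.1 h')
    rw [hc]
  · simp at h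
  · obtain rfl : a = a' := by simpa using h
    have := (y a).2.1 h'
    simp at this
  · simp at h
  · have : b = b' := by simpa using h
    rw [this]
  · simp at h
  · obtain rfl : a = a' := by simpa using h
    have := (y a).2.1 h'
    simp at this
  · simp at h
  · obtain rfl : a = a' := by simpa using h
    have hc : d = d' := Sum.inr_injective ((y a).2.1 h')
    rw [hc]

variable [Finite A] [Finite B]

/-- The two iterated insertions at aerial points are joined by a linear path. -/
theorem compat_modComp_comp {D : B → Type} [∀ b, Finite (D b)] (E : ∀ b, D b → Type)
    (z : HConf A B) (y : ∀ b, Conf (D b)) (e : ∀ b d, Conf (E b d)) :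
    Compat (CoPB.relabelMap (Equiv.refl A) (Equiv.sigmaAssoc E)
        (CoPB.modCompMap A _ (CoPB.modCompMap A D (z, y), fun bd : Σ b, D b => e bd.1 bd.2))).1
      (CoPB.modCompMap A _ (z, fun b => CoB.compMap (E b) (y b, e b))).1 := by
  let σ := Equiv.sumCongr (Equiv.refl A) (Equiv.sigmaAssoc E)
  let e' : ∀ bd : Σ b, D b, Conf (E bd.1 bd.2) := fun bd => e bd.1 bd.2
  have hd := modPos_norm A y
  have h1 := nest_insert_insert (x := Sum.map id Sigma.fst)
    (y := fun t => Sum.map id Sigma.fst (σ.symm t)) (e := fun t => modPos A e' (σ.symm t))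
    hd (tight_hradius z) (tight_hradius (CoPB.modCompMap A D (z, y)))
  have h2 : Nest (Sum.map id Sigma.fst) (fun t => Sum.map id Sigma.fst (σ.symm t)) z.1
      (modPos A y) (fun t => modPos A e' (σ.symm t))
      (insert z.1 (hradius z.1) (Sum.map id Sigma.fst)
        (modPos A fun b => CoB.compMap (E b) (y b, e b))) :=
    -- Nothing is inserted at a terrestrial point, so its inner scale is arbitrary.
    nest_insert (ρ := Sum.elim (fun _ => 1 / 4) fun t => radius (y t.1).1) (tight_hradius z)
      (by
        rintro (a | t)
        · norm_num
        · exact (conf_tight (y t.1)).1)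
      (by
        rintro (a | t)
        · exact le_rfl
        · exact radius_le_quarter (y t.1).2.2)
      (by
        rintro (a | ⟨b, d⟩) (a' | ⟨b', d'⟩) hne h
        · exact absurd (by simpa using h) hne
        · simp at h
        · simp at h
        · obtain rfl : b = b' := by simpa using h
          exact (conf_tight (y b)).2 _ _ fun h => hne (congrArg _ (congrArg _ h)))
      (by rintro (a | ⟨b, d, x⟩) <;> rfl)
      (by
        rintro (a | ⟨b, d, x⟩)
        · change (0 : ℂ) = (0 + _ * 0) / 2
          simp
        · rfl)
  exact Nest.compat hd (fun t => modPos_norm A e' _)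
    (fun s t h h' => σ.symm.injective (modPos_inj e' _ _ h h')) h1 h2

/-- The two iterated insertions at terrestrial points are joined by a linear path. -/
theorem compat_opComp_opComp {C D : A → Type} [∀ a, Finite (C a)] [∀ a, Finite (D a)]
    (C' D' : ∀ a, C a → Type) (z : HConf A B) (y : ∀ a, HConf (C a) (D a))
    (e : ∀ a c, HConf (C' a c) (D' a c)) :
    Compat (CoPB.relabelMap (Equiv.sigmaAssoc C') (assocEquiv D')
        (CoPB.opCompMap _ _ _ (CoPB.opCompMap B C D (z, y),
          fun ac : Σ a, C a => e ac.1 ac.2))).1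
      (CoPB.opCompMap B _ _ (z, fun a => CoPB.opCompMap (D a) (C' a) (D' a) (y a, e a))).1 := by
  let σ := Equiv.sumCongr (Equiv.sigmaAssoc C') (assocEquiv (B := B) (D := D) D')
  let e' : ∀ ac : Σ a, C a, HConf (C' ac.1 ac.2) (D' ac.1 ac.2) := fun ac => e ac.1 ac.2
  have hd := opPos_norm B y
  have h1 := nest_insert_insert (x := opIdx B C D)
    (y := fun t => opIdx _ _ _ (σ.symm t)) (e := fun t => opPos _ e' (σ.symm t))
    hd (hconf_tight z) (hconf_tight (CoPB.opCompMap B C D (z, y)))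
  have h2 : Nest (opIdx B C D) (fun t => opIdx _ _ _ (σ.symm t)) z.1
      (opPos B y) (fun t => opPos _ e' (σ.symm t))
      (insert z.1 (radius z.1) (opIdx _ _ _)
        (opPos B fun a => CoPB.opCompMap (D a) (C' a) (D' a) (y a, e a))) :=
    nest_insert (ρ := Sum.elim (fun t => radius (y t.1).1)
        (Sum.elim (fun _ => 1 / 4) fun t => radius (y t.1).1)) (hconf_tight z)
      (by
        rintro (t | b | t)
        · exact (hconf_tight (y t.1)).1
        · norm_num
        · exact (hconf_tight (y t.1)).1)
      (by
        rintro (t | b | t)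
        · exact radius_le_quarter (y t.1).2.2.1
        · exact le_rfl
        · exact radius_le_quarter (y t.1).2.2.1)
      (by
        rintro (⟨a, c⟩ | b | ⟨a, c⟩) (⟨a', c'⟩ | b' | ⟨a', c'⟩) hne h
        · obtain rfl : a = a' := by simpa using h
          exact (hconf_tight (y a)).2 (Sum.inl c) (Sum.inl c') (by simpa using hne)
        · simp at h
        · obtain rfl : a = a' := by simpa using h
          exact (hconf_tight (y a)).2 (Sum.inl c) (Sum.inr c') (by simp)
        · simp at h
        · exact absurd (by simpa using h) hne
        · simp at h
        · obtain rfl : a = a' := by simpa using h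
          exact (hconf_tight (y a)).2 (Sum.inr c) (Sum.inl c') (by simp)
        · simp at h
        · obtain rfl : a = a' := by simpa using h
          exact (hconf_tight (y a)).2 (Sum.inr c) (Sum.inr c') (by simpa using hne))
      (by rintro (⟨a, c, x⟩ | b | ⟨a, d | ⟨c, x⟩⟩) <;> rfl)
      (by
        rintro (⟨a, c, x⟩ | b | ⟨a, d | ⟨c, x⟩⟩)
        · rfl
        · change (0 : ℂ) = (0 + _ * 0) / 2
          simp
        · rfl
        · rfl)
  exact Nest.compat hd (fun t => opPos_norm _ e' _)
    (fun s t h h' => σ.symm.injective (opPos_inj e' _ _ h h')) h1 h2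

/-- Insertion in neighbourhoods of the terrestrial and of the aerial points, in either order. -/
theorem compat_modComp_opComp {C D : A → Type} [∀ a, Finite (C a)] [∀ a, Finite (D a)]
    (E : (B ⊕ Σ a, D a) → Type) [∀ x, Finite (E x)] (z : HConf A B)
    (y : ∀ a, HConf (C a) (D a)) (e : ∀ x, Conf (E x)) :
    Compat (CoPB.relabelMap (Equiv.refl _) (modEquiv E)
        (CoPB.modCompMap _ E (CoPB.opCompMap B C D (z, y), e))).1
      (CoPB.opCompMap _ _ _ (CoPB.modCompMap A _ (z, fun b => e (Sum.inl b)),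
        fun a => CoPB.modCompMap (C a) _ (y a, fun d => e (Sum.inr ⟨a, d⟩)))).1 := by
  let σ := Equiv.sumCongr (Equiv.refl (Σ a, C a)) (modEquiv E)
  have hd := opPos_norm B y
  have h1 := nest_insert_insert (x := opIdx B C D)
    (y := fun t => Sum.map id Sigma.fst (σ.symm t)) (e := fun t => modPos _ e (σ.symm t))
    hd (hconf_tight z) (tight_hradius (CoPB.opCompMap B C D (z, y)))
  set z' := CoPB.modCompMap A _ (z, fun b => e (Sum.inl b)) with hz'
  have hR := hconf_tight z'
  have hH := tight_hradius z
  have h2 : Nest (opIdx B C D) (fun t => Sum.map id Sigma.fst (σ.symm t)) z.1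
      (opPos B y) (fun t => modPos _ e (σ.symm t))
      (CoPB.opCompMap _ _ _ (z',
        fun a => CoPB.modCompMap (C a) _ (y a, fun d => e (Sum.inr ⟨a, d⟩)))).1 := by
    set R := radius z'.1
    set h := hradius z.1
    have hR0 := hR.1
    have hh0 := hH.1
    have hy : ∀ a, 0 < hradius (y a).1 := fun a => (tight_hradius (y a)).1
    have hy' : ∀ a, hradius (y a).1 ≤ 1 / 4 := fun a =>
      (hradius_le (y a)).trans (radius_le_quarter (y a).2.2.1)
    refine ⟨1 / 4, Sum.elim (fun _ => R / 4) (Sum.elim (fun _ => 0) fun _ => R / 4),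
      Sum.elim (fun t => R / 4 * hradius (y t.1).1)
        (Sum.elim (fun _ => h / 4) fun t => R / 4 * hradius (y t.1).1), ?_, ?_, ?_, ?_, ?_⟩
    · rintro (⟨a, c⟩ | ⟨b, x⟩ | ⟨a, d, x⟩)
      · change ((z.1 (Sum.inl a) + (h : ℂ) * 0) / 2 + (R : ℂ) *
          (((y a).1 (Sum.inl c) + (hradius (y a).1 : ℂ) * 0) / 2)) / 2
            = ((1 / 4 : ℝ) : ℂ) * z.1 (Sum.inl a) + (((R / 4 : ℝ) : ℂ) * (y a).1 (Sum.inl c)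
              + ((R / 4 * hradius (y a).1 : ℝ) : ℂ) * 0)
        push_cast
        ring
      · change ((z.1 (Sum.inr b) + (h : ℂ) * (e (Sum.inl b)).1 x) / 2 + (R : ℂ) * 0) / 2
            = ((1 / 4 : ℝ) : ℂ) * z.1 (Sum.inr b) + (((0 : ℝ) : ℂ) * 0
              + ((h / 4 : ℝ) : ℂ) * (e (Sum.inl b)).1 x)
        push_cast
        ring
      · change ((z.1 (Sum.inl a) + (h : ℂ) * 0) / 2 + (R : ℂ) *
          (((y a).1 (Sum.inr d) + (hradius (y a).1 : ℂ) * (e (Sum.inr ⟨a, d⟩)).1 x) / 2)) / 2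
            = ((1 / 4 : ℝ) : ℂ) * z.1 (Sum.inl a) + (((R / 4 : ℝ) : ℂ) * (y a).1 (Sum.inr d)
              + ((R / 4 * hradius (y a).1 : ℝ) : ℂ) * (e (Sum.inr ⟨a, d⟩)).1 x)
        push_cast
        ring
    · rintro (⟨a, c⟩ | ⟨b, x⟩ | ⟨a, d, x⟩)
      · exact (by positivity : 0 ≤ R / 4)
      · exact le_rfl
      · exact (by positivity : 0 ≤ R / 4)
    · rintro (⟨a, c⟩ | ⟨b, x⟩ | ⟨a, d, x⟩)
      · exact mul_pos (by positivity) (hy a)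
      · exact (by positivity : 0 < h / 4)
      · exact mul_pos (by positivity) (hy a)
    · -- The block of `z'` that contains a point of the iterated insertion.
      let j : (Σ a, C a) ⊕ ((Σ b, E (Sum.inl b)) ⊕ Σ a, Σ d, E (Sum.inr ⟨a, d⟩)) →
          A ⊕ Σ b, E (Sum.inl b) :=
        Sum.elim (fun t => Sum.inl t.1) (Sum.elim Sum.inr fun t => Sum.inl t.1)
      have hj : ∀ t, Sum.map id Sigma.fst (j t)
          = opIdx B C D (Sum.map id Sigma.fst (σ.symm t)) := by
        rintro (⟨a, c⟩ | ⟨b, x⟩ | ⟨a, d, x⟩) <;> rfl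
      intro s t hst
      have hsum : ∀ t, Sum.elim (fun _ => R / 4) (Sum.elim (fun _ => 0) fun _ => R / 4)
          (Sum.map id Sigma.fst (σ.symm t)) +
            Sum.elim (fun t => R / 4 * hradius (y t.1).1) (Sum.elim (fun _ => h / 4) fun t =>
              R / 4 * hradius (y t.1).1) (Sum.map id Sigma.fst (σ.symm t))
          ≤ 5 / 16 * R + h / 4 := by
        rintro (⟨a, c⟩ | ⟨b, x⟩ | ⟨a, d, x⟩)
        · change R / 4 + R / 4 * hradius (y a).1 ≤ _
          nlinarith [hy' a]
        · change 0 + h / 4 ≤ _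
          linarith
        · change R / 4 + R / 4 * hradius (y a).1 ≤ _
          nlinarith [hy' a]
      have h3 := hR.2 (j s) (j t) fun h => hst (by rw [← hj, ← hj, h])
      have h4 := norm_insert_sub_le (z := z.1) (p := Sum.map id Sigma.fst) hh0.le
        (modPos_norm A fun b => e (Sum.inl b)) (j s) (j t)
      rw [hj, hj] at h4
      have h5 := hH.2 _ _ hst
      have h6 : R ≤ _ := h3.trans (div_le_div_of_nonneg_right h4 (by norm_num))
      linarith [hsum s, hsum t]
    · intro s t
      dsimp only
      generalize Sum.map id Sigma.fst (σ.symm s) = u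
      generalize Sum.map id Sigma.fst (σ.symm t) = v
      have key : ∀ a (k k' : C a ⊕ D a), k ≠ k' → R / 4 * hradius (y a).1 +
          R / 4 * hradius (y a).1 < R / 4 * ‖(y a).1 k - (y a).1 k'‖ := fun a k k' hk => by
        have h5 := (tight_hradius (y a)).2 k k' hk
        nlinarith [hy a]
      rcases u with ⟨a, c⟩ | b | ⟨a, c⟩ <;> rcases v with ⟨a', c'⟩ | b' | ⟨a', c'⟩ <;> intro hne h
      · obtain rfl : a = a' := by simpa using h
        exact ⟨rfl, key a (Sum.inl c) (Sum.inl c') (by simpa using hne)⟩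
      · simp at h
      · obtain rfl : a = a' := by simpa using h
        exact ⟨rfl, key a (Sum.inl c) (Sum.inr c') (by simp)⟩
      · simp at h
      · exact absurd (by simpa using h) hne
      · simp at h
      · obtain rfl : a = a' := by simpa using h
        exact ⟨rfl, key a (Sum.inr c) (Sum.inl c') (by simp)⟩
      · simp at h
      · obtain rfl : a = a' := by simpa using h
        exact ⟨rfl, key a (Sum.inr c) (Sum.inr c') (by simpa using hne)⟩
  exact Nest.compat hd (fun t => modPos_norm _ e _)
    (fun s t h h' => σ.symm.injective (modPos_inj e _ _ h h')) h1 h2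

end geometry

/-! ### The open part of `CoPB₊` -/

section open_part

variable {A A' B B' : Type}

theorem hconf_htight [Finite A] [Finite B] (z : HConf A B) : Tight z.1 (hradius z.1) :=
  tight_hradius z

theorem Tight.comp_injective {X Y : Type} {z : X → ℂ} {r : ℝ} (h : Tight z r) {f : Y → X}
    (hf : Function.Injective f) : Tight (fun y => z (f y)) r :=
  ⟨h.1, fun _ _ hxy => h.2 _ _ (hf.ne hxy)⟩

theorem hcoM_refl (q : Arrow (CoPB A B)) : hcoM (Equiv.refl A) (Equiv.refl B) q = q := by
  obtain ⟨w, w', p, rfl⟩ := exists_hcoA q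
  rw [hcoM_hcoA]
  refine hcoA_congr ?_ ?_ fun t => ?_
  · ext1
    simp [Word.map]
  · ext1
    simp [Word.map]
  · refine (Compat.refl (p t).2.1).congr ?_ rfl
    funext x
    rcases x with a | b <;> rfl

theorem hcoM_trans {A'' B'' : Type} (eA : A ≃ A') (eA' : A' ≃ A'') (eB : B ≃ B') (eB' : B' ≃ B'')
    (q : Arrow (CoPB A B)) :
    hcoM (eA.trans eA') (eB.trans eB') q = hcoM eA' eB' (hcoM eA eB q) := by
  obtain ⟨w, w', p, rfl⟩ := exists_hcoA q
  rw [hcoM_hcoA, hcoM_hcoA, hcoM_hcoA]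
  refine hcoA_congr ?_ ?_ fun t => ?_
  · ext1
    simp [Word.map]
  · ext1
    simp [Word.map]
  · refine (Compat.refl (CoPB.relabelMap (eA.trans eA') (eB.trans eB') (p t)).2.1).congr rfl ?_
    funext x
    rcases x with a | b <;> rfl

theorem hcoMod_outer [Finite A] [Finite A'] [Finite B] [Finite B'] {D : B' → Type} (eA : A ≃ A')
    (eB : B ≃ B') (q : Arrow (CoPB A B)) (g : ∀ b, Arrow (CoB (D b))) :
    hcoMod (hcoM eA eB q) g
      = hcoM eA (Equiv.sigmaCongrLeft eB) (hcoMod q fun b => g (eB b)) := by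
  obtain ⟨w, w', p, rfl⟩ := exists_hcoA q
  obtain ⟨v, v', q, rfl⟩ := exists_coA_family g
  rw [hcoM_hcoA, hcoMod_hcoA _ (spread_hrelabel hconfS eA eB) (spread_hrelabel hconfS eA eB) q _ _,
    hcoMod_hcoA _ hconfS hconfS (fun b => q (eB b)) _ _, hcoM_hcoA]
  refine hcoA_congr (modCompWord_outer eA eB w v) (modCompWord_outer eA eB w' v') fun t => ?_
  refine (compat_insert (hconf_htight (CoPB.relabelMap eA eB (p t)))
    ((hconf_htight (p t)).comp_injective (Equiv.sumCongr eA eB).symm.injective)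
    (modPos_norm A' fun b => q b t) (modPos_inj fun b => q b t)).congr rfl ?_
  funext x
  obtain ⟨x, rfl⟩ := (Equiv.sumCongr eA (Equiv.sigmaCongrLeft eB)).surjective x
  change _ = (CoPB.modCompMap A _ (p t, fun b => q (eB b) t)).1
    ((Equiv.sumCongr eA (Equiv.sigmaCongrLeft eB)).symm _)
  rw [Equiv.symm_apply_apply]
  rcases x with a | ⟨b, d⟩ <;> simp [insert, CoPB.modCompMap, CoPB.relabelMap]

theorem hcoMod_inner [Finite A] [Finite B] {D D' : B → Type} (e : ∀ b, D b ≃ D' b)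
    (q : Arrow (CoPB A B)) (g : ∀ b, Arrow (CoB (D b))) :
    hcoMod q (fun b => coM (e b) (g b))
      = hcoM (Equiv.refl A) (Equiv.sigmaCongrRight e) (hcoMod q g) := by
  obtain ⟨w, w', p, rfl⟩ := exists_hcoA q
  obtain ⟨v, v', q, rfl⟩ := exists_coA_family g
  simp only [coM_coA]
  rw [hcoMod_hcoA _ hconfS hconfS (fun b => (q b).map (CoB.relabelMap (e b)).continuous) _ _,
    hcoMod_hcoA _ hconfS hconfS q _ _, hcoM_hcoA]
  refine hcoA_congr (modCompWord_inner e w v) (modCompWord_inner e w' v') fun t => ?_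
  refine (Compat.refl (CoPB.modCompMap A D' (p t, fun b => CoB.relabelMap (e b) (q b t))).2.1).congr
    rfl ?_
  funext x
  rcases x with a | b <;> rfl

theorem hcoMod_one [Finite A] [Finite B] (q : Arrow (CoPB A B)) :
    hcoMod q (fun _ => co1) = hcoM (Equiv.refl A) (unitEquiv' B) q := by
  obtain ⟨w, w', p, rfl⟩ := exists_hcoA q
  rw [co1_eq, hcoMod_hcoA _ hconfS hconfS (fun _ => Path.refl clOneWord.conf) _ _, hcoM_hcoA]
  refine hcoA_congr (modCompWord_one w) (modCompWord_one w') fun t => ?_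
  refine (compat_insert_of_injective (x := (Equiv.sumCongr (Equiv.refl A) (unitEquiv' B)).symm)
    (Equiv.injective _) (hconf_htight (p t))
      (modPos_norm A fun _ => clOneWord.conf)).congr ?_ rfl
  funext x
  rcases x with a | ⟨b, _⟩ <;> rfl

theorem hcoMod_assoc [Finite A] [Finite B] {D : B → Type} [∀ b, Finite (D b)]
    (E : ∀ b, D b → Type) (f : Arrow (CoPB A B)) (g : ∀ b, Arrow (CoB (D b)))
    (h : ∀ b d, Arrow (CoB (E b d))) :
    hcoM (Equiv.refl A) (Equiv.sigmaAssoc E) (hcoMod (hcoMod f g) fun bd => h bd.1 bd.2)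
      = hcoMod f fun b => coC (g b) (h b) := by
  obtain ⟨w, w', p, rfl⟩ := exists_hcoA f
  obtain ⟨v, v', q, rfl⟩ := exists_coA_family g
  choose u u' s hs using fun b => exists_coA_family (h b)
  obtain rfl : h = _ := funext hs
  have h1 : ∀ b, coC (coA (q b) (srt_conf (v b)) (srt_conf (v' b)))
      (fun d => coA (s b d) (srt_conf (u b d)) (srt_conf (u' b d))) = _ := fun b =>
    coC_coA _ confS confS (s b) (fun _ => srt_conf _) (fun _ => srt_conf _)
  simp only [h1]
  rw [hcoMod_hcoA _ hconfS hconfS q _ _,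
    hcoMod_hcoA _ (spread_modComp (spread_hconf w) fun b => spread_conf (v b))
      (spread_modComp (spread_hconf w') fun b => spread_conf (v' b))
      (fun bd : Σ b, D b => s bd.1 bd.2) (fun _ => srt_conf _) (fun _ => srt_conf _),
    hcoMod_hcoA _ hconfS hconfS (fun b => mapPath (CoB.compMap (E b)) (q b) (s b)) _ _, hcoM_hcoA]
  refine hcoA_congr (modCompWord_assoc E w v u) (modCompWord_assoc E w' v' u') fun t => ?_
  exact compat_modComp_comp E (p t) (fun b => q b t) (fun b d => s b d t)

theorem hcoC_outer [Finite A] [Finite A'] [Finite B] [Finite B'] {C D : A' → Type} (eA : A ≃ A')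
    (eB : B ≃ B') (q : Arrow (CoPB A B)) (r : ∀ a, Arrow (CoPB (C a) (D a))) :
    hcoC (hcoM eA eB q) r
      = hcoM (Equiv.sigmaCongrLeft eA) (Equiv.sumCongr eB (Equiv.sigmaCongrLeft eA))
          (hcoC q fun a => r (eA a)) := by
  obtain ⟨w, w', p, rfl⟩ := exists_hcoA q
  obtain ⟨v, v', q, rfl⟩ := exists_hcoA_family r
  rw [hcoM_hcoA, hcoC_hcoA _ (spread_hrelabel hconfS eA eB) (spread_hrelabel hconfS eA eB) q _ _,
    hcoC_hcoA _ hconfS hconfS (fun b => q (eA b)) _ _, hcoM_hcoA]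
  refine hcoA_congr (opCompWord_outer eA eB w v) (opCompWord_outer eA eB w' v') fun t => ?_
  refine (compat_insert (hconf_tight (CoPB.relabelMap eA eB (p t)))
    ((hconf_tight (p t)).comp_injective (Equiv.sumCongr eA eB).symm.injective)
    (opPos_norm B' fun b => q b t) (opPos_inj fun b => q b t)).congr rfl ?_
  funext x
  obtain ⟨x, rfl⟩ := (Equiv.sumCongr (Equiv.sigmaCongrLeft eA)
    (Equiv.sumCongr eB (Equiv.sigmaCongrLeft eA))).surjective x
  change _ = (CoPB.opCompMap B _ _ (p t, fun a => q (eA a) t)).1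
    ((Equiv.sumCongr (Equiv.sigmaCongrLeft eA)
      (Equiv.sumCongr eB (Equiv.sigmaCongrLeft eA))).symm _)
  rw [Equiv.symm_apply_apply]
  rcases x with a | b | ⟨b, d⟩ <;> simp [insert, CoPB.opCompMap, CoPB.relabelMap]

theorem hcoC_inner [Finite A] [Finite B] {C C' D D' : A → Type} (eC : ∀ a, C a ≃ C' a)
    (eD : ∀ a, D a ≃ D' a) (q : Arrow (CoPB A B)) (r : ∀ a, Arrow (CoPB (C a) (D a))) :
    hcoC q (fun a => hcoM (eC a) (eD a) (r a))
      = hcoM (Equiv.sigmaCongrRight eC) (Equiv.sumCongr (Equiv.refl B) (Equiv.sigmaCongrRight eD))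
          (hcoC q r) := by
  obtain ⟨w, w', p, rfl⟩ := exists_hcoA q
  obtain ⟨v, v', q, rfl⟩ := exists_hcoA_family r
  simp only [hcoM_hcoA]
  rw [hcoC_hcoA _ hconfS hconfS
      (fun a => (q a).map (CoPB.relabelMap (eC a) (eD a)).continuous) _ _,
    hcoC_hcoA _ hconfS hconfS q _ _, hcoM_hcoA]
  refine hcoA_congr (opCompWord_inner eC eD w v) (opCompWord_inner eC eD w' v') fun t => ?_
  refine (Compat.refl (CoPB.opCompMap B C' D'
    (p t, fun a => CoPB.relabelMap (eC a) (eD a) (q a t))).2.1).congr rfl ?_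
  funext x
  rcases x with a | b | d <;> rfl

theorem one_hcoC [Finite A] [Finite B] (q : Arrow (CoPB A B)) :
    hcoC hco1 (fun _ => q)
      = hcoM (unitEquiv A) ((unitEquiv B).trans (Equiv.emptySum Empty _).symm) q := by
  obtain ⟨w, w', p, rfl⟩ := exists_hcoA q
  rw [hco1_eq, hcoC_hcoA _ hconfS hconfS (fun _ => p) _ _, hcoM_hcoA]
  refine hcoA_congr (opCompWord_one_left w) (opCompWord_one_left w') fun t => ?_
  refine (compat_insert_const (x := opIdx Empty (fun _ : Unit => A) fun _ => B)
    (z := opOneWord.hconf.1) ?_ ((p t).2.1.comp (Equiv.sumCongr (unitEquiv A)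
    ((unitEquiv B).trans (Equiv.emptySum Empty _).symm)).symm.injective)
      (hconf_tight opOneWord.hconf).1).congr ?_ rfl
  · rintro (a | ⟨⟨⟩⟩ | b) (a' | ⟨⟨⟩⟩ | b') <;> rfl
  · funext x
    rcases x with a | ⟨⟨⟩⟩ | b <;> rfl

theorem hcoC_one [Finite A] [Finite B] (q : Arrow (CoPB A B)) :
    hcoC q (fun _ => hco1) = hcoM (unitEquiv' A) (unitEquiv'' A B) q := by
  obtain ⟨w, w', p, rfl⟩ := exists_hcoA q
  rw [hco1_eq, hcoC_hcoA _ hconfS hconfS (fun _ => Path.refl opOneWord.hconf) _ _, hcoM_hcoA]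
  refine hcoA_congr (opCompWord_one_right w) (opCompWord_one_right w') fun t => ?_
  refine (compat_insert_of_injective
    (x := (Equiv.sumCongr (unitEquiv' A) (unitEquiv'' A B)).symm)
    (Equiv.injective _) (hconf_tight (p t))
      (opPos_norm B fun _ => opOneWord.hconf)).congr ?_ rfl
  funext x
  rcases x with a | b | ⟨a, ⟨⟩⟩ <;> rfl

theorem hcoC_assoc [Finite A] [Finite B] {C D : A → Type} (C' D' : ∀ a, C a → Type)
    [∀ a, Finite (C a)] [∀ a, Finite (D a)]
    (f : Arrow (CoPB A B)) (g : ∀ a, Arrow (CoPB (C a) (D a)))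
    (h : ∀ a c, Arrow (CoPB (C' a c) (D' a c))) :
    hcoM (Equiv.sigmaAssoc C') (assocEquiv D') (hcoC (hcoC f g) fun ac => h ac.1 ac.2)
      = hcoC f fun a => hcoC (g a) (h a) := by
  obtain ⟨w, w', p, rfl⟩ := exists_hcoA f
  obtain ⟨v, v', q, rfl⟩ := exists_hcoA_family g
  choose u u' s hs using fun b => exists_hcoA_family (h b)
  obtain rfl : h = _ := funext hs
  have h1 : ∀ b, hcoC (hcoA (q b) (srt_hconf (v b)) (srt_hconf (v' b)))
      (fun d => hcoA (s b d) (srt_hconf (u b d)) (srt_hconf (u' b d))) = _ := fun b =>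
    hcoC_hcoA _ hconfS hconfS (s b) (fun _ => srt_hconf _) (fun _ => srt_hconf _)
  simp only [h1]
  rw [hcoC_hcoA _ hconfS hconfS q _ _,
    hcoC_hcoA _ (spread_opComp (spread_hconf w) fun b => spread_hconf (v b))
      (spread_opComp (spread_hconf w') fun b => spread_hconf (v' b))
      (fun bd : Σ b, C b => s bd.1 bd.2) (fun _ => srt_hconf _) (fun _ => srt_hconf _),
    hcoC_hcoA _ hconfS hconfS (fun b => mapPath (CoPB.opCompMap (D b) (C' b) (D' b)) (q b) (s b))
      _ _, hcoM_hcoA]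
  refine hcoA_congr (opCompWord_assoc C' D' w v u) (opCompWord_assoc C' D' w' v' u') fun t => ?_
  exact compat_opComp_opComp C' D' (p t) (fun b => q b t) (fun b d => s b d t)

theorem hcoMod_hcoC [Finite A] [Finite B] {C D : A → Type} (E : (B ⊕ Σ a, D a) → Type)
    [∀ a, Finite (C a)] [∀ a, Finite (D a)] [∀ x, Finite (E x)]
    (f : Arrow (CoPB A B)) (g : ∀ a, Arrow (CoPB (C a) (D a)))
    (h : ∀ x, Arrow (CoB (E x))) :
    hcoM (Equiv.refl _) (modEquiv E) (hcoMod (hcoC f g) h)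
      = hcoC (hcoMod f fun b => h (Sum.inl b))
          fun a => hcoMod (g a) fun d => h (Sum.inr ⟨a, d⟩) := by
  obtain ⟨w, w', p, rfl⟩ := exists_hcoA f
  obtain ⟨v, v', q, rfl⟩ := exists_hcoA_family g
  obtain ⟨u, u', s, rfl⟩ := exists_coA_family h
  have h1 : ∀ a, hcoMod (hcoA (q a) (srt_hconf (v a)) (srt_hconf (v' a)))
      (fun d => coA (s (Sum.inr ⟨a, d⟩)) (srt_conf (u (Sum.inr ⟨a, d⟩)))
        (srt_conf (u' (Sum.inr ⟨a, d⟩)))) = _ := fun a =>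
    hcoMod_hcoA _ hconfS hconfS (fun d => s (Sum.inr ⟨a, d⟩)) (fun _ => srt_conf _)
      (fun _ => srt_conf _)
  simp only [h1]
  rw [hcoC_hcoA _ hconfS hconfS q _ _,
    hcoMod_hcoA _ (spread_opComp (spread_hconf w) fun b => spread_hconf (v b))
      (spread_opComp (spread_hconf w') fun b => spread_hconf (v' b)) s _ _,
    hcoMod_hcoA _ hconfS hconfS (fun b => s (Sum.inl b)) _ _,
    hcoC_hcoA _ (spread_modComp (spread_hconf w) fun b => spread_conf _)
      (spread_modComp (spread_hconf w') fun b => spread_conf _)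
      (fun a => mapPath (CoPB.modCompMap (C a) _) (q a) fun d => s (Sum.inr ⟨a, d⟩)) _ _, hcoM_hcoA]
  refine hcoA_congr (modCompWord_opCompWord E w v u) (modCompWord_opCompWord E w' v' u')
    fun t => ?_
  exact compat_modComp_opComp E (p t) (fun b => q b t) (fun x => s x t)

/-- `CoPB₊` is a relative operad over `CoB₊`. -/
theorem isRelOperad_coPBPlus : CoPBPlus.IsRelOperad where
  clM_refl _ _ f := coM_refl f
  clM_trans _ _ _ _ _ _ e e' f := coM_trans e e' f
  clC_outer _ _ _ _ _ _ e f g := coC_outer e f g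
  clC_inner _ _ _ _ _ _ e f g := coC_inner e f g
  one_clC _ _ f := one_coC f
  clC_one _ _ f := coC_one f
  clC_assoc _ _ E _ _ _ f g h := coC_assoc E f g h
  opM_refl _ _ _ _ q := hcoM_refl q
  opM_trans _ _ _ _ _ _ _ _ _ _ _ _ eA eA' eB eB' q := hcoM_trans eA eA' eB eB' q
  modC_outer _ _ _ _ _ _ _ _ _ _ eA eB q g := hcoMod_outer eA eB q g
  modC_inner _ _ _ _ _ _ _ _ e q g := hcoMod_inner e q g
  modC_one _ _ _ _ q := hcoMod_one q
  modC_assoc _ _ _ E _ _ _ _ q g h := hcoMod_assoc E q g h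
  opC_outer _ _ _ _ _ _ _ _ _ _ _ _ eA eB q r := hcoC_outer eA eB q r
  opC_inner _ _ _ _ _ _ _ _ _ _ _ _ eC eD q r := hcoC_inner eC eD q r
  one_opC _ _ _ _ q := one_hcoC q
  opC_one _ _ _ _ q := hcoC_one q
  opC_assoc _ _ _ _ C' D' _ _ _ _ _ _ q r s := hcoC_assoc C' D' q r s
  modC_opC _ _ _ _ E _ _ _ _ _ q r g := hcoMod_hcoC E q r g

end open_part

/-! ### Restriction to the aerial points, and the inverse of `ζ` -/

section aerial

variable {A B : Type}

/-- Terrestrial and aerial points never collide: compatibility can be checked on each colour. -/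
theorem compat_of_colours {z z' : HConf A B}
    (h : Compat (fun a => z.1 (Sum.inl a)) fun a => z'.1 (Sum.inl a))
    (h' : Compat (fun b => z.1 (Sum.inr b)) fun b => z'.1 (Sum.inr b)) : Compat z.1 z'.1 := by
  intro t h0 h1
  have ha : ∀ a, (lin t z.1 z'.1 (Sum.inl a)).im = 0 := fun a => by
    rw [lin_im, z.2.2.2.1 a, z'.2.2.2.1 a]
    ring
  have hb : ∀ b, 0 < (lin t z.1 z'.1 (Sum.inr b)).im := fun b => by
    have := lt_convex (z.2.2.2.2 b) (z'.2.2.2.2 b) h0 h1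
    rw [lin_im]
    simpa using this
  rintro (a | b) (a' | b') hij
  · exact congrArg _ (h t h0 h1 hij)
  · have := congrArg Complex.im hij
    linarith [ha a, hb b']
  · have := congrArg Complex.im hij
    linarith [ha a', hb b]
  · exact congrArg _ (h' t h0 h1 hij)

/-- The terrestrial points of `z` occur in the order of `w`, and so do the aerial points; nothing
is required of the interleaving of the two colours. -/
def SepSrt (w : Word (A ⊕ B)) (z : A ⊕ B → ℂ) : Prop :=
  Srt w.resL (fun a => z (Sum.inl a)) ∧ Srt w.resR fun b => z (Sum.inr b)

theorem Srt.sep {w : Word (A ⊕ B)} {z : A ⊕ B → ℂ} (h : Srt w z) : SepSrt w z :=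
  ⟨Word.Sorted.resL h, Word.Sorted.resR h⟩

theorem SepSrt.compat {w : Word (A ⊕ B)} {z z' : HConf A B} (h : SepSrt w z.1)
    (h' : SepSrt w z'.1) : Compat z.1 z'.1 :=
  compat_of_colours (h.1.compat h'.1) (h.2.compat h'.2)

theorem SepSrt.lin {w : Word (A ⊕ B)} {z z' : A ⊕ B → ℂ} (h : SepSrt w z) (h' : SepSrt w z')
    {t : ℝ} (h0 : 0 ≤ t) (h1 : t ≤ 1) : SepSrt w (lin t z z') :=
  ⟨Srt.lin h.1 h'.1 h0 h1, Srt.lin h.2 h'.2 h0 h1⟩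

theorem sep_hconf (w : Word (A ⊕ B)) : SepSrt w w.hconf.1 := (srt_hconf w).sep

/-- The linear path between two configurations that are separately sorted by the same word. -/
def sepIso {w : Word (A ⊕ B)} {z z' : HConf A B} (h : SepSrt w z.1) (h' : SepSrt w z'.1) :
    (⟨z⟩ : FundamentalGroupoid (HConf A B)) ≅ ⟨z'⟩ :=
  (Groupoid.isoEquivHom _ _).symm (seg (segClosed_hconfP A B) z z' (h.compat h'))

theorem sepIso_comp {w : Word (A ⊕ B)} {z₁ z₂ z₃ : HConf A B} (h₁ : SepSrt w z₁.1)
    (h₂ : SepSrt w z₂.1) (h₃ : SepSrt w z₃.1) :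
    (sepIso h₁ h₂).hom ≫ (sepIso h₂ h₃).hom = (sepIso h₁ h₃).hom :=
  seg_comp_seg (segClosed_hconfP A B) _ _ _ fun _ h0 h1 => SepSrt.compat (w := w)
    (z := ⟨_, segClosed_hconfP A B _ _ z₁.2 z₂.2 (h₁.compat h₂) _ h0 h1⟩) (h₁.lin h₂ h0 h1) h₃

theorem sepIso_self {w : Word (A ⊕ B)} {z : HConf A B} (h : SepSrt w z.1) :
    (sepIso h h).hom = 𝟙 _ := seg_self _ _ _

theorem sepIso_inv {w : Word (A ⊕ B)} {z z' : HConf A B} (h : SepSrt w z.1) (h' : SepSrt w z'.1) :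
    (sepIso h h').inv = (sepIso h' h).hom := by
  rw [← cancel_epi (sepIso h h').hom, Iso.hom_inv_id, sepIso_comp, sepIso_self]

/-- The arrow of `CoPB` from `w` to `w'` represented by a path of configurations whose ends are
separately sorted by `w` and by `w'`. -/
def hcoS {w w' : Word (A ⊕ B)} {z z' : HConf A B} (p : Path z z') (h : SepSrt w z.1)
    (h' : SepSrt w' z'.1) : Arrow (CoPB A B) :=
  Arrow.mk (X := (w : CoPB A B)) (Y := (w' : CoPB A B))
    (InducedCategory.homMk ((sepIso (sep_hconf w) h).hom ≫ cls p ≫ (sepIso (sep_hconf w') h').inv))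

theorem exists_hcoS (f : Arrow (CoPB A B)) : ∃ (w w' : Word (A ⊕ B)) (p : Path w.hconf w'.hconf),
    f = hcoS p (sep_hconf w) (sep_hconf w') := exists_hcoA f

theorem hcoS_congr {w₁ w₁' w₂ w₂' : Word (A ⊕ B)} {z z' y y' : HConf A B} {p : Path z z'}
    {q : Path y y'} {h : SepSrt w₁ z.1} {h' : SepSrt w₁' z'.1} {k : SepSrt w₂ y.1}
    {k' : SepSrt w₂' y'.1} (hw : w₁ = w₂) (hw' : w₁' = w₂')
    (hpq : ∀ t, Compat (p t).1 (q t).1) : hcoS p h h' = hcoS q k k' := by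
  subst hw hw'
  unfold hcoS
  congr 2
  have key : cls p ≫ (sepIso h' k').hom = (sepIso h k).hom ≫ cls q :=
    cls_comp_seg (segClosed_hconfP A B) p q hpq
  rw [← sepIso_comp (sep_hconf w₁) h k, Category.assoc, ← reassoc_of% key]
  congr 2
  rw [Iso.eq_comp_inv, Iso.inv_comp_eq]
  exact (sepIso_comp (sep_hconf w₁') h' k').symm

/-- The configuration of the aerial points. -/
def aerMap (A B : Type) : C(HConf A B, Conf B) where
  toFun z := ⟨fun b => z.1 (Sum.inr b), z.2.1.comp Sum.inr_injective, fun _ => z.2.2.1 _⟩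
  continuous_toFun := by
    exact Continuous.subtype_mk (continuous_pi fun j => continuous_point continuous_id _) _

/-- Restriction of coloured permutations and braids to the aerial strands. -/
def aer (A B : Type) : CoPB A B ⥤ CoB B :=
  liftTo (inducedFunctor _ ⋙ FundamentalGroupoid.map (aerMap A B)) _ (fun w => Word.resR w)
    fun w => srtIso (segClosed_confP B) (w := Word.resR w) (z := aerMap A B (Word.hconf w))
      (z' := (Word.resR w).conf) (sep_hconf w).2 (srt_conf _)

/-- The aerial strands of a represented arrow are represented by the path of aerial configurations;
only the order of the aerial points at the ends matters. -/
theorem arr_aer_hcoS {w w' : Word (A ⊕ B)} {z z' : HConf A B} (p : Path z z') (h : SepSrt w z.1)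
    (h' : SepSrt w' z'.1) :
    arr (aer A B) (hcoS p h h') = coA (p.map (aerMap A B).continuous) h.2 h'.2 := by
  have key : ∀ (w : Word (A ⊕ B)) (z : HConf A B) (h : SepSrt w z.1),
      (FundamentalGroupoid.map (aerMap A B)).map (sepIso (sep_hconf w) h).hom
        = (srtIso (segClosed_confP B) (w := w.resR) (z := aerMap A B w.hconf)
            (z' := w.resR.conf) (sep_hconf w).2 (srt_conf _)).hom ≫
          (srtIso (segClosed_confP B) (z' := aerMap A B z) (srt_conf w.resR) h.2).hom :=
    fun w z h => by
    refine Eq.trans ?_ (srtIso_comp _ _ _ _).symm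
    refine map_seg (segClosed_hconfP A B) (segClosed_confP B) (aerMap A B) _ _
      fun t h0 h1 => Srt.compat (w := w.resR) ?_ ?_
    · exact ((sep_hconf w).lin h h0 h1).2
    · exact (sep_hconf w).2.lin h.2 h0 h1
  have key' : ∀ (w : Word (A ⊕ B)) (z : HConf A B) (h : SepSrt w z.1),
      (FundamentalGroupoid.map (aerMap A B)).map (sepIso (sep_hconf w) h).inv
        = (srtIso (segClosed_confP B) (z' := aerMap A B z) (srt_conf w.resR) h.2).inv ≫
          (srtIso (segClosed_confP B) (w := w.resR) (z := aerMap A B w.hconf)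
            (z' := w.resR.conf) (sep_hconf w).2 (srt_conf _)).inv := fun w z h => by
    have := key w z h
    rw [← Functor.mapIso_hom, ← Iso.trans_hom] at this
    exact congrArg Iso.inv (Iso.ext this)
  refine congrArg (fun m => Arrow.mk (T := CoB B) (X := w.resR) (Y := w'.resR)
    (InducedCategory.homMk m)) ?_
  refine Eq.trans ?_ (conj_comp _ _ (key w z h) (key' w' z' h') _)
  refine congrArg (fun m => (srtIso (segClosed_confP B) (sep_hconf w).2 (srt_conf w.resR)).inv ≫ m ≫
    (srtIso (segClosed_confP B) (sep_hconf w').2 (srt_conf w'.resR)).hom) ?_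
  change (FundamentalGroupoid.map (aerMap A B)).map
    ((sepIso (sep_hconf w) h).hom ≫ cls p ≫ (sepIso (sep_hconf w') h').inv) = _
  refine ((FundamentalGroupoid.map (aerMap A B)).map_comp _ _).trans ?_
  exact congrArg (fun m => _ ≫ m) ((FundamentalGroupoid.map (aerMap A B)).map_comp _ _)

/-- Terrestrial points move on a line without collisions, so their order is constant. -/
theorem terrestrial_order {z z' : HConf A B} (p : Path z z') {u : Word A}
    (h : Srt u fun a => z.1 (Sum.inl a)) (t : unitInterval) :
    Srt u fun a => (p t).1 (Sum.inl a) := by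
  refine h.imp fun {a a'} haa' => ?_
  by_contra hlt
  have hc : Continuous fun s => ((p s).1 (Sum.inl a')).re - ((p s).1 (Sum.inl a)).re :=
    (Complex.continuous_re.comp (continuous_point p.continuous _)).sub
      (Complex.continuous_re.comp (continuous_point p.continuous _))
  -- If the order changed, two terrestrial points would have the same real part at some time.
  obtain ⟨s, hs⟩ := mem_range_of_exists_le_of_exists_ge (c := 0) hc ⟨t, by linarith⟩
    ⟨0, by rw [p.source]; linarith⟩
  have h1 : (p s).1 (Sum.inl a) = (p s).1 (Sum.inl a') := by
    refine Complex.ext (by linarith) ?_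
    rw [(p s).2.2.2.1, (p s).2.2.2.1]
  have h2 : a = a' := Sum.inl_injective ((p s).2.1 h1)
  rw [h2] at haa'
  exact haa'.false

theorem resL_eq {w w' : Word (A ⊕ B)} (p : Path w.hconf w'.hconf) : w.resL = w'.resL := by
  have h1 : Srt w.resL fun a => w'.hconf.1 (Sum.inl a) := by
    have := terrestrial_order p (sep_hconf w).1 1
    rwa [p.target] at this
  have h2 := (sep_hconf w').1
  ext1
  exact List.Perm.eq_of_pairwise (fun a b _ _ hab hba => (lt_asymm hab hba).elim) h1 h2
    ((List.perm_ext_iff_of_nodup w.resL.nodup w'.resL.nodup).2 fun a =>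
      iff_of_true (w.resL.complete a) (w'.resL.complete a))

theorem compat_scale {z : B → ℂ} (hz : Function.Injective z) (c : ℂ) :
    Compat (fun b => z b / 4 + c) z := by
  refine Compat.of_vector fun i j hij => ⟨z i - z j, 1 / 4, 1, ?_, ?_⟩
  · have := norm_pos_iff.2 (sub_ne_zero.2 fun h => hij (hz h))
    rw [show z i / 4 + c - (z j / 4 + c) - ((1 / 4 : ℝ) : ℂ) * (z i - z j) = 0 by
      push_cast; ring, norm_zero]
    positivity
  · have := norm_pos_iff.2 (sub_ne_zero.2 fun h => hij (hz h))
    simpa using this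

theorem srt_scale {x : Word B} {z : B → ℂ} (h : Srt x z) (c : ℂ) :
    Srt x fun b => z b / 4 + c := by
  refine h.imp fun {a b} hab => ?_
  simp
  linarith

theorem srt_place (u : Word A) : Srt u fun a => ((u.pos a - 1 : ℝ) : ℂ) := by
  refine u.pos_sorted.imp fun {a b} hab => ?_
  change ((u.pos a - 1 : ℝ) : ℂ).re < ((u.pos b - 1 : ℝ) : ℂ).re
  rw [Complex.ofReal_re, Complex.ofReal_re]
  linarith

theorem sep_append {w : Word (A ⊕ B)} {u : Word A} {z : Conf B} (hu : w.resL = u)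
    (h : Srt w.resR z.1) : SepSrt w (HConf.append u z).1 :=
  ⟨hu ▸ srt_place _, srt_scale h _⟩

/-- The functor that places a permutation and a coloured braid side by side. -/
abbrev placeFunctor (A B : Type) : CoP A × CoB B ⥤ FundamentalGroupoid (HConf A B) :=
  Functor.uncurry.obj (Discrete.functor fun u : Word A =>
    inducedFunctor (fun w : Word B => (⟨w.conf⟩ : FundamentalGroupoid (Conf B))) ⋙
      FundamentalGroupoid.map (HConf.append u))

theorem placeFunctor_map {u u' : Word A} {x x' : Word B}
    (m : ((⟨u⟩, x) : CoP A × CoB B) ⟶ (⟨u'⟩, x')) (hu : u' = u) {w' : Word (A ⊕ B)}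
    (hw' : w'.resL = u') (k : Srt w'.resR x'.conf.1) :
    (placeFunctor A B).map m ≫ (sepIso (sep_append hw' k) (sep_hconf w')).hom
      = (FundamentalGroupoid.map (HConf.append u)).map m.2.hom ≫
        (sepIso (sep_append (hw'.trans hu) k) (sep_hconf w')).hom := by
  subst hu
  refine congrArg (fun m => m ≫ (sepIso (sep_append hw' k) (sep_hconf w')).hom) ?_
  obtain ⟨m1, m2⟩ := m
  obtain rfl : m1 = 𝟙 _ := Subsingleton.elim _ _
  simp only [placeFunctor, Functor.uncurry_obj_map]
  rw [CategoryTheory.Functor.map_id]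
  exact Category.id_comp _

theorem map_append_srtIso {w : Word (A ⊕ B)} {u : Word A} (hu : w.resL = u) {z z' : Conf B}
    (h : Srt w.resR z.1) (h' : Srt w.resR z'.1) :
    (FundamentalGroupoid.map (HConf.append u)).map (srtIso (segClosed_confP B) h h').hom
      = (sepIso (sep_append hu h) (sep_append hu h')).hom :=
  map_seg (segClosed_confP B) (segClosed_hconfP A B) (HConf.append u) (h.compat h')
    ((sep_append hu h).compat (sep_append hu h')) fun t h0 h1 => SepSrt.compat (w := w)
      (z := HConf.append u ⟨_, segClosed_confP B _ _ z.2 z'.2 (h.compat h') t h0 h1⟩)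
      (z' := ⟨_, segClosed_hconfP A B _ _ (HConf.append u z).2 (HConf.append u z').2
        ((sep_append hu h).compat (sep_append hu h')) t h0 h1⟩)
      (sep_append hu (Srt.lin h h' h0 h1)) ((sep_append hu h).lin (sep_append hu h') h0 h1)

theorem hconf_iso_eq {w : Word (A ⊕ B)} {z z' : HConf A B} (h : SepSrt w z.1)
    (h' : SepSrt w z'.1) : HConf.iso w.resL w.resR h.1 h'.1 h.2 h'.2 = sepIso h h' := rfl

/-- The linear path from the base configurations of the subwords of `w`, placed side by side, to the
base configuration of `w`. -/
def appIso (w : Word (A ⊕ B)) : (placeFunctor A B).obj (⟨w.resL⟩, w.resR) ≅ ⟨w.hconf⟩ :=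
  HConf.iso w.resL w.resR (z := HConf.append w.resL w.resR.conf) (srt_place w.resL)
    w.hconf_sorted.resL (srt_scale (srt_conf w.resR) _) w.hconf_sorted.resR

theorem appIso_eq (w : Word (A ⊕ B)) : appIso w =
    sepIso (w := w) (z := HConf.append w.resL w.resR.conf) (sep_append rfl (srt_conf w.resR))
      (sep_hconf w) :=
  hconf_iso_eq (sep_append (w := w) rfl (srt_conf w.resR)) (sep_hconf w)

theorem zeta_map_hom {w w' : Word (A ⊕ B)}
    (m : (show CoBal A B from w) ⟶ (show CoBal A B from w')) :
    ((zeta A B).map m).hom = (appIso w).inv ≫ (placeFunctor A B).map m.hom ≫ (appIso w').hom := rfl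

/-- The arrow of `CoPB` that `ζ` assigns to a coloured braid of the aerial strands. -/
theorem arr_zeta {w w' : Word (A ⊕ B)} (m : (show CoBal A B from w) ⟶ (show CoBal A B from w'))
    {z z' : Conf B} (q : Path z z') (h : Srt w.resR z.1) (h' : Srt w'.resR z'.1)
    (hm : m.hom.2 = (coA q h h').hom) (hL : w'.resL = w.resL) :
    Arrow.mk ((zeta A B).map m) = hcoS (q.map (HConf.append w.resL).continuous)
      (sep_append rfl h) (sep_append hL h') := by
  refine congrArg (fun m => Arrow.mk (T := CoPB A B) (X := w) (Y := w')
    (InducedCategory.homMk m)) ?_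
  refine (zeta_map_hom m).trans ?_
  rw [appIso_eq, appIso_eq]
  refine (congrArg (fun k => (sepIso (sep_append rfl (srt_conf w.resR)) (sep_hconf w)).inv ≫ k)
    (placeFunctor_map m.hom hL rfl (srt_conf _))).trans ?_
  have hm' : m.hom.2.hom = (srtIso (segClosed_confP B) (srt_conf w.resR) h).hom ≫ cls q ≫
      (srtIso (segClosed_confP B) (srt_conf w'.resR) h').inv := congrArg (fun k => k.hom) hm
  rw [hm']
  have key : (FundamentalGroupoid.map (HConf.append w.resL)).map
      (srtIso (segClosed_confP B) (srt_conf w.resR) h).hom =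
      (sepIso (sep_append rfl (srt_conf w.resR)) (sep_hconf w)).hom ≫
        (sepIso (sep_hconf w) (sep_append rfl h)).hom := by
    rw [sepIso_comp, map_append_srtIso rfl]
  have key' : (FundamentalGroupoid.map (HConf.append w.resL)).map
      (srtIso (segClosed_confP B) (srt_conf w'.resR) h').inv =
      (sepIso (sep_hconf w') (sep_append hL h')).inv ≫
        (sepIso (sep_append hL (srt_conf w'.resR)) (sep_hconf w')).inv := by
    have h2 : (FundamentalGroupoid.map (HConf.append w.resL)).map
      (srtIso (segClosed_confP B) (srt_conf w'.resR) h').hom =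
      (sepIso (sep_append hL (srt_conf w'.resR)) (sep_hconf w')).hom ≫
        (sepIso (sep_hconf w') (sep_append hL h')).hom := by
      rw [sepIso_comp, map_append_srtIso hL]
    rw [← Functor.mapIso_hom, ← Iso.trans_hom] at h2
    exact congrArg Iso.inv (Iso.ext h2)
  refine Eq.trans ?_ (conj_comp _ _ key key' _)
  refine congrArg (fun m => (sepIso (sep_append rfl (srt_conf w.resR)) (sep_hconf w)).inv ≫ m ≫
    (sepIso (sep_append hL (srt_conf w'.resR)) (sep_hconf w')).hom) ?_
  change (FundamentalGroupoid.map (HConf.append w.resL)).map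
    ((srtIso (segClosed_confP B) (srt_conf w.resR) h).hom ≫ cls q ≫
      (srtIso (segClosed_confP B) (srt_conf w'.resR) h').inv) = _
  refine ((FundamentalGroupoid.map (HConf.append w.resL)).map_comp _ _).trans ?_
  exact congrArg (fun m => _ ≫ m) ((FundamentalGroupoid.map (HConf.append w.resL)).map_comp _ _)

/-- A morphism of `CoPB` does not change the order of the terrestrial points. -/
theorem resL_eq_of_hom {w w' : Word (A ⊕ B)}
    (f : (show CoPB A B from w) ⟶ (show CoPB A B from w')) : w.resL = w'.resL := by
  obtain ⟨p, -⟩ := Path.Homotopic.Quotient.mk_surjective f.hom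
  exact resL_eq p

/-- The inverse of `ζ`: the aerial strands are retained. -/
def zetaInv (A B : Type) : CoPB A B ⥤ CoBal A B where
  obj w := w
  map f := InducedCategory.homMk
    (eqToHom (congrArg Discrete.mk (resL_eq_of_hom f)), (aer A B).map f)
  map_id w := InducedCategory.hom_ext (Prod.ext (Subsingleton.elim _ _) ((aer A B).map_id w))
  map_comp f g :=
    InducedCategory.hom_ext (Prod.ext (Subsingleton.elim _ _) ((aer A B).map_comp f g))

/-- Functors that agree on arrows are equal. -/
theorem functor_ext_arr {C D : Type} [Category.{0} C] [Category.{0} D] {F G : C ⥤ D}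
    (h : ∀ f : Arrow C, arr F f = arr G f) : F = G :=
  CategoryTheory.Functor.hext (fun x => congrArg (fun a : Arrow D => a.left) (h (Arrow.mk (𝟙 x))))
    fun _ _ f => congr_arg_heq (fun a : Arrow D => a.hom) (h (Arrow.mk f))

/-- The aerial strands of a morphism of the balanced product. -/
def coPart (A B : Type) : CoBal A B ⥤ CoB B := inducedFunctor _ ⋙ CategoryTheory.Prod.snd _ _

/-- `ζ` followed by restriction to the aerial strands retains the coloured braid. -/
theorem arr_aer_zeta (f : Arrow (CoBal A B)) :
    arr (aer A B) (arr (zeta A B) f) = arr (coPart A B) f := by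
  obtain ⟨q, hq⟩ := exists_mkA (segClosed_confP B) Word.conf Word.conf_sorted
    (Arrow.mk f.hom.hom.2)
  have hL : Word.resL f.right = Word.resL f.left := (Discrete.eq_of_hom f.hom.hom.1).symm
  have h1 : arr (zeta A B) f = _ := arr_zeta (w := f.left) (w' := f.right) f.hom q (srt_conf _)
    (srt_conf _) ((Arrow.mk_inj _ _).1 hq) hL
  rw [h1, arr_aer_hcoS]
  refine Eq.trans ?_ hq.symm
  exact coA_congr rfl rfl fun t => compat_scale (q t).2.1 _

theorem arr_comp {C D E : Type} [Category.{0} C] [Category.{0} D] [Category.{0} E] (F : C ⥤ D)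
    (G : D ⥤ E) (f : Arrow C) : arr (F ⋙ G) f = arr G (arr F f) := rfl

theorem arr_mk {C D : Type} [Category.{0} C] [Category.{0} D] (F : C ⥤ D) {X Y : C} (f : X ⟶ Y) :
    arr F (Arrow.mk f) = Arrow.mk (F.map f) := rfl

theorem arr_id {C : Type} [Category.{0} C] (f : Arrow C) : arr (𝟭 C) f = f := rfl

theorem arr_coPart_zetaInv (f : Arrow (CoPB A B)) :
    arr (coPart A B) (arr (zetaInv A B) f) = arr (aer A B) f := rfl

/-- A morphism of the balanced product is determined by its coloured braid. -/
theorem arrow_ext_coPart {f g : Arrow (CoBal A B)} (hl : f.left = g.left) (hr : f.right = g.right)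
    (h : arr (coPart A B) f = arr (coPart A B) g) : f = g := by
  obtain ⟨w, w', f⟩ := f
  obtain ⟨v, v', g⟩ := g
  obtain rfl : w = v := hl
  obtain rfl : w' = v' := hr
  obtain rfl : f = g :=
    InducedCategory.hom_ext (Prod.ext (Subsingleton.elim _ _) ((Arrow.mk_inj _ _).1 h))
  rfl

theorem arr_zetaInv_zeta (f : Arrow (CoBal A B)) : arr (zetaInv A B) (arr (zeta A B) f) = f :=
  arrow_ext_coPart rfl rfl ((arr_coPart_zetaInv _).trans (arr_aer_zeta f))

theorem arr_zeta_zetaInv (f : Arrow (CoPB A B)) : arr (zeta A B) (arr (zetaInv A B) f) = f := by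
  obtain ⟨w, w', p, hf⟩ := exists_hcoS f
  obtain ⟨v, v', f⟩ := f
  obtain rfl : v = w := congrArg (fun a : Arrow (CoPB A B) => a.left) hf
  obtain rfl : v' = w' := congrArg (fun a : Arrow (CoPB A B) => a.right) hf
  have h0 : (aer A B).map f = (coA (p.map (aerMap A B).continuous) (sep_hconf v).2
      (sep_hconf v').2).hom :=
    (Arrow.mk_inj _ _).1 ((congrArg (arr (aer A B)) hf).trans (arr_aer_hcoS _ _ _))
  have h1 := arr_zeta ((zetaInv A B).map f) _ _ _ h0 (resL_eq p).symm
  have h2 : hcoS ((p.map (aerMap A B).continuous).map (HConf.append v.resL).continuous)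
      (sep_append rfl (sep_hconf v).2) (sep_append (resL_eq p).symm (sep_hconf v').2)
      = hcoS p (sep_hconf v) (sep_hconf v') := hcoS_congr rfl rfl fun t => compat_of_colours
    ((srt_place _).compat (terrestrial_order p (sep_hconf _).1 t))
    (compat_scale ((p t).2.1.comp Sum.inr_injective) _)
  exact (congrArg (arr (zeta A B)) (arr_mk (zetaInv A B) f)).trans
    ((arr_mk (zeta A B) ((zetaInv A B).map f)).trans (h1.trans (h2.trans hf.symm)))

theorem zeta_zetaInv (A B : Type) : zeta A B ⋙ zetaInv A B = 𝟭 _ :=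
  functor_ext_arr fun f => (arr_comp _ _ f).trans ((arr_zetaInv_zeta f).trans (arr_id f).symm)

theorem zetaInv_zeta (A B : Type) : zetaInv A B ⋙ zeta A B = 𝟭 _ :=
  functor_ext_arr fun f => (arr_comp _ _ f).trans ((arr_zeta_zetaInv f).trans (arr_id f).symm)

/-- A morphism of `CoPB` is determined by its aerial strands. -/
theorem arrow_ext_aer {f g : Arrow (CoPB A B)} (hl : f.left = g.left) (hr : f.right = g.right)
    (h : arr (aer A B) f = arr (aer A B) g) : f = g := by
  have h2 : arr (zetaInv A B) f = arr (zetaInv A B) g := arrow_ext_coPart hl hr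
    ((arr_coPart_zetaInv f).trans (h.trans (arr_coPart_zetaInv g).symm))
  rw [← arr_zeta_zetaInv f, ← arr_zeta_zetaInv g, h2]

end aerial

/-! ### The structure maps of `CoPB₊` on the aerial strands -/

section aerial_rules

variable {A A' B B' : Type}

theorem srt_aer {w : Word (A ⊕ B)} {z : HConf A B} (h : Srt w z.1) :
    Srt w.resR (aerMap A B z).1 := h.sep.2

theorem arr_aer_hcoA {w w' : Word (A ⊕ B)} {z z' : HConf A B} (p : Path z z') (h : Srt w z.1)
    (h' : Srt w' z'.1) :
    arr (aer A B) (hcoA p h h') = coA (p.map (aerMap A B).continuous) (srt_aer h) (srt_aer h') :=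
  arr_aer_hcoS p h.sep h'.sep

theorem aer_hcoM (e : A ≃ A') (e' : B ≃ B') (q : Arrow (CoPB A B)) :
    arr (aer A' B') (hcoM e e' q) = coM e' (arr (aer A B) q) := by
  obtain ⟨w, w', p, rfl⟩ := exists_hcoA q
  rw [hcoM_hcoA, arr_aer_hcoA, arr_aer_hcoA, coM_coA]
  exact coA_congr (Word.resR_map e e' w) (Word.resR_map e e' w')
    fun t => Compat.refl (CoB.relabelMap e' (aerMap A B (p t))).2.1

theorem filterMap_getRight_flatMap {A B A' B' : Type} (l : List (A ⊕ B))
    (k : A ⊕ B → List (A' ⊕ B')) (hk : ∀ a, (k (Sum.inl a)).filterMap Sum.getRight? = []) :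
    (l.flatMap k).filterMap Sum.getRight?
      = (l.filterMap Sum.getRight?).flatMap fun b => (k (Sum.inr b)).filterMap Sum.getRight? := by
  induction l with
  | nil => rfl
  | cons x xs ih =>
    rcases x with a | b
    · simp [ih, hk, filterMap_inl]
    · simp [ih]

theorem resR_modCompWord {D : B → Type} (w : Word (A ⊕ B)) (v : ∀ b, Word (D b)) :
    (CoPB.modCompWord w v).resR = CoB.compWord w.resR v := by
  ext1
  refine (filterMap_getRight_flatMap _ _ fun a => rfl).trans ?_
  refine List.flatMap_congr fun b _ => ?_
  simp only [Sum.elim_inr, List.filterMap_map]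
  rw [← List.filterMap_eq_map]
  rfl

theorem Spread.resR {κ : ℝ} {w : Word (A ⊕ B)} {z : A ⊕ B → ℂ} (h : Spread κ w z) :
    Spread κ w.resR fun b => z (Sum.inr b) := by
  unfold Spread Word.resR
  rw [List.pairwise_filterMap]
  refine List.Pairwise.imp ?_ h
  rintro (a | b) (a' | b') hab <;> simp_all

theorem spread_aer {w : Word (A ⊕ B)} {z : HConf A B} (h : Spread 3 w z.1) :
    Spread 3 w.resR (aerMap A B z).1 := Spread.resR h

theorem aer_hcoMod [Finite A] [Finite B] {D : B → Type} (q : Arrow (CoPB A B))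
    (g : ∀ b, Arrow (CoB (D b))) :
    arr (aer A (Σ b, D b)) (hcoMod q g) = coC (arr (aer A B) q) g := by
  obtain ⟨w, w', p, rfl⟩ := exists_hcoA q
  obtain ⟨v, v', q, rfl⟩ := exists_coA_family g
  rw [hcoMod_hcoA _ hconfS hconfS q _ _, arr_aer_hcoA, arr_aer_hcoA,
    coC_coA _ (spread_aer hconfS) (spread_aer hconfS) q _ _]
  exact coA_congr (resR_modCompWord w v) (resR_modCompWord w' v') fun t =>
    compat_insert (z := (aerMap A B (p t)).1)
      ((hconf_htight (p t)).comp_injective Sum.inr_injective)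
      (conf_tight (aerMap A B (p t))) (confP_norm_sigma fun b => q b t) (sigma_inj fun b => q b t)

/-- The family of coloured braids to be substituted in the coloured braid of all of the strands. -/
def aerFamily (B : Type) {D : A → Type} (r : ∀ a, Arrow (CoB (D a))) :
    ∀ x, Arrow (CoB (PaPB'.opInputs B D x))
  | Sum.inl a => r a
  | Sum.inr _ => co1

/-- The analogue of `aerFamily` for words. -/
def aerWord (B : Type) {D : A → Type} (v : ∀ a, Word (D a)) : ∀ x, Word (PaPB'.opInputs B D x)
  | Sum.inl a => v a
  | Sum.inr _ => clOneWord

/-- The analogue of `aerFamily` for configurations. -/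
def aerConf (B : Type) {D : A → Type} (y : ∀ a, Conf (D a)) : ∀ x, Conf (PaPB'.opInputs B D x)
  | Sum.inl a => y a
  | Sum.inr _ => clOneWord.conf

/-- The analogue of `aerFamily` for paths. -/
def aerPath (B : Type) {D : A → Type} {y y' : ∀ a, Conf (D a)} (q : ∀ a, Path (y a) (y' a)) :
    ∀ x, Path (aerConf B y x) (aerConf B y' x)
  | Sum.inl a => q a
  | Sum.inr _ => Path.refl clOneWord.conf

theorem srt_aerWord {D : A → Type} {v : ∀ a, Word (D a)} {y : ∀ a, Conf (D a)}
    (h : ∀ a, Srt (v a) (y a).1) : ∀ x, Srt (aerWord B v x) (aerConf B y x).1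
  | Sum.inl a => h a
  | Sum.inr _ => srt_conf clOneWord

theorem aerFamily_coA {D : A → Type} {v v' : ∀ a, Word (D a)} {y y' : ∀ a, Conf (D a)}
    (q : ∀ a, Path (y a) (y' a)) (h : ∀ a, Srt (v a) (y a).1) (h' : ∀ a, Srt (v' a) (y' a).1) :
    aerFamily B (fun a => coA (q a) (h a) (h' a))
      = fun x => coA (aerPath B q x) (srt_aerWord h x) (srt_aerWord h' x) := by
  funext x
  rcases x with a | b
  · rfl
  · exact co1_eq

theorem resR_opCompWord {C D : A → Type} (w : Word (A ⊕ B)) (v : ∀ a, Word (C a ⊕ D a)) :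
    (CoPB.opCompWord w v).resR
      = (CoB.compWord w (aerWord B fun a => (v a).resR)).map (PaPB'.opEquiv B D) := by
  ext1
  simp only [Word.resR, CoPB.opCompWord, CoB.compWord, Word.bind, Word.map, List.map_flatMap,
    List.filterMap_flatMap]
  refine List.flatMap_congr ?_
  rintro (a | b) -
  · simp only [Sum.elim_inl, aerWord]
    exact (filterMap_getRight_map _ _ _).trans (List.map_map
      (f := fun d : D a => (⟨Sum.inl a, d⟩ : Σ x, PaPB'.opInputs B D x))
      (g := PaPB'.opEquiv B D)).symm
  · rfl

/-- The aerial strands of a composite at terrestrial inputs: the aerial strands of the operations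
`r a` are inserted in the braid of all of the strands of `q`, since they follow the terrestrial
strands of `q`. -/
theorem aer_hcoC [Finite A] [Finite B] {C D : A → Type} (q : Arrow (CoPB A B))
    (r : ∀ a, Arrow (CoPB (C a) (D a))) :
    arr (aer (Σ a, C a) (B ⊕ Σ a, D a)) (hcoC q r) = coM (PaPB'.opEquiv B D)
      (coC (arr (CoPB.forget A B) q) (aerFamily B fun a => arr (aer (C a) (D a)) (r a))) := by
  obtain ⟨w, w', p, rfl⟩ := exists_hcoA q
  obtain ⟨v, v', q, rfl⟩ := exists_hcoA_family r
  have h1 : ∀ a, arr (aer (C a) (D a)) (hcoA (q a) (srt_hconf (v a)) (srt_hconf (v' a))) = _ :=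
    fun a => arr_aer_hcoA (q a) (srt_hconf (v a)) (srt_hconf (v' a))
  simp only [h1]
  rw [hcoC_hcoA _ hconfS hconfS q _ _, arr_aer_hcoA, arr_forget_hcoA, aerFamily_coA,
    coC_coA (z := CoPB.forgetMap A B w.hconf) (z' := CoPB.forgetMap A B w'.hconf) _ hconfS hconfS
      (aerPath B fun a => (q a).map (aerMap (C a) (D a)).continuous) _ _, coM_coA]
  refine coA_congr (resR_opCompWord w v) (resR_opCompWord w' v') fun t => ?_
  let d : B ⊕ (Σ a, D a) → ℂ := fun s => opPos B (fun a => q a t) (Sum.inr s)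
  let d' : B ⊕ (Σ a, D a) → ℂ := fun s =>
    (aerConf B (fun a => aerMap (C a) (D a) (q a t)) ((PaPB'.opEquiv B D).symm s).1).1
      ((PaPB'.opEquiv B D).symm s).2
  have key := compat_insert_of_block (x := fun s => opIdx B C D (Sum.inr s)) (d := d) (d' := d')
    (hconf_tight (p t)) (hconf_tight (p t)) (fun _ => opPos_norm B _ _)
    (fun s => (aerConf B (fun a => aerMap (C a) (D a) (q a t)) _).2.2 _) (by
      rintro (b | ⟨a, d⟩) (b' | ⟨a', d'⟩) h
      · obtain rfl : b = b' := by simpa using h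
        simp
      · simp at h
      · simp at h
      · obtain rfl : a = a' := by simpa using h
        rfl) fun s s' h h' => Sum.inr_injective (opPos_inj (fun a => q a t) _ _ h h')
  refine key.congr rfl ?_
  funext s
  rcases s with b | ⟨a, d⟩ <;> rfl

end aerial_rules

/-! ### The coloured braid of all of the strands -/

section forget

variable {A B : Type}

theorem srtIso_inv {I : Type} {P : (I → ℂ) → Prop} (hP : SegClosed P) {w : Word I}
    {z z' : Subtype P} (h : Srt w z.1) (h' : Srt w z'.1) :
    (srtIso hP h h').inv = (srtIso hP h' h).hom := by
  rw [← cancel_epi (srtIso hP h h').hom, Iso.hom_inv_id, srtIso_comp, srtIso_self]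

theorem SepSrt.of_eq {v w : Word (A ⊕ B)} (h : v.resL = w.resL) (h' : v.resR = w.resR)
    {z : A ⊕ B → ℂ} (hz : SepSrt w z) : SepSrt v z := by
  unfold SepSrt
  rw [h, h']
  exact hz

theorem shuffle_hom {v w : Word (A ⊕ B)} (h : v.resL = w.resL) (h' : v.resR = w.resR) :
    (CoPB.shuffle v w h h').hom.hom
      = (sepIso (sep_hconf v) (SepSrt.of_eq h h' (sep_hconf w))).hom := rfl

theorem shuffle_inv {v w : Word (A ⊕ B)} (h : v.resL = w.resL) (h' : v.resR = w.resR) :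
    (CoPB.shuffle v w h h').inv.hom
      = (sepIso (SepSrt.of_eq h h' (sep_hconf w)) (sep_hconf v)).hom := by
  rw [← sepIso_inv]
  rfl

/-- An arrow represented by a path with separately sorted ends is conjugate, by shuffles, to the
arrow between the words that sort the ends of the path. -/
theorem hcoS_hom {v v' w w' : Word (A ⊕ B)} {z z' : HConf A B} (p : Path z z')
    (h : SepSrt w z.1) (h' : SepSrt w' z'.1) (k : Srt v z.1) (k' : Srt v' z'.1)
    (hv : v.resL = w.resL) (hv' : v.resR = w.resR) (hw : v'.resL = w'.resL)
    (hw' : v'.resR = w'.resR) :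
    (hcoS p h h').hom = (CoPB.shuffle v w hv hv').inv ≫ (hcoA p k k').hom ≫
      (CoPB.shuffle v' w' hw hw').hom := by
  apply InducedCategory.hom_ext
  change (sepIso (sep_hconf w) h).hom ≫ cls p ≫ (sepIso (sep_hconf w') h').inv
    = (CoPB.shuffle v w hv hv').inv.hom ≫ ((sepIso (sep_hconf v) k.sep).hom ≫ cls p ≫
      (sepIso (sep_hconf v') k'.sep).inv) ≫ (CoPB.shuffle v' w' hw hw').hom.hom
  have e1 : (sepIso (sep_hconf w) h).hom = (CoPB.shuffle v w hv hv').inv.hom ≫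
      (sepIso (sep_hconf v) k.sep).hom := by
    rw [shuffle_inv, sepIso_comp]
    rfl
  have e2 : (sepIso (sep_hconf w') h').inv = (sepIso (sep_hconf v') k'.sep).inv ≫
      (CoPB.shuffle v' w' hw hw').hom.hom := by
    rw [shuffle_hom, sepIso_inv, sepIso_inv, sepIso_comp]
    rfl
  rw [e1, e2]
  simp only [Category.assoc]

/-- The concatenation of a permutation with a coloured braid. -/
abbrev concat (A B : Type) : CoP A × CoB B ⥤ CoB (A ⊕ B) :=
  (CoP.ι A).prod (𝟭 (CoB B)) ⋙ CoB.append A B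

theorem srt_appendMap {u : Word A} {x : Word B} {y : Conf A} {z : Conf B} (h : Srt u y.1)
    (h' : Srt x z.1) : Srt (u.append x) (CoB.appendMap A B (y, z)).1 := by
  refine Word.Sorted.append (h.imp fun {a b} h => ?_) (srt_scale h' _) fun a b => ?_
  · change (y.1 a / 4 - 1 / 2 : ℂ).re < (y.1 b / 4 - 1 / 2 : ℂ).re
    simp
    linarith
  · have h1 := (Complex.re_le_norm _).trans (y.2.2 a)
    have h2 := (Complex.abs_re_le_norm _).trans (z.2.2 b)
    have h3 := neg_abs_le (z.1 b).re
    change (y.1 a / 4 - 1 / 2 : ℂ).re < (z.1 b / 4 + 1 / 2 : ℂ).re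
    simp
    linarith

theorem concat_map {u u' : Word A} {x x' : Word B}
    (m : ((⟨u⟩, x) : CoP A × CoB B) ⟶ (⟨u'⟩, x')) (hu : u' = u) (q : Path x.conf x'.conf)
    (hq : m.2.hom = cls q) :
    Arrow.mk ((concat A B).map m)
      = coA (w := u.append x) (w' := u'.append x') (((Path.refl u.conf).prod q).map
          (CoB.appendMap A B).continuous) (srt_appendMap (srt_conf u) (srt_conf x))
          (srt_appendMap (hu ▸ srt_conf u') (srt_conf x')) := by
  subst hu
  obtain ⟨m1, m2⟩ := m
  obtain rfl : m1 = 𝟙 _ := Subsingleton.elim _ _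
  obtain ⟨m2⟩ := m2
  obtain rfl : m2 = cls q := hq
  refine congrArg (fun m => Arrow.mk (T := CoB (A ⊕ B)) (X := u'.append x) (Y := u'.append x')
    (InducedCategory.homMk m)) ?_
  have h1 : (CoP.ι A).map (𝟙 (⟨u'⟩ : CoP A)) = 𝟙 _ := CategoryTheory.Functor.map_id _ _
  have h2 : (srtIso (segClosed_confP (A ⊕ B)) (srt_conf (u'.append x))
      (srt_appendMap (srt_conf u') (srt_conf x))).hom = (srtIso (segClosed_confP (A ⊕ B))
      (srt_appendMap (srt_conf u') (srt_conf x)) (srt_conf (u'.append x))).inv :=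
    (srtIso_inv _ _ _).symm
  have h3 : (srtIso (segClosed_confP (A ⊕ B)) (srt_conf (u'.append x'))
      (srt_appendMap (srt_conf u') (srt_conf x'))).inv = (srtIso (segClosed_confP (A ⊕ B))
      (srt_appendMap (srt_conf u') (srt_conf x')) (srt_conf (u'.append x'))).hom :=
    srtIso_inv _ _ _
  rw [h2, h3]
  refine congrArg (fun m => (srtIso (segClosed_confP (A ⊕ B))
      (srt_appendMap (srt_conf u') (srt_conf x)) (srt_conf (u'.append x))).inv ≫ m ≫
      (srtIso (segClosed_confP (A ⊕ B)) (srt_appendMap (srt_conf u') (srt_conf x'))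
        (srt_conf (u'.append x'))).hom) ?_
  exact congrArg (fun k : (show CoB A from u') ⟶ (show CoB A from u') =>
    (FundamentalGroupoid.map (CoB.appendMap A B)).map (Path.Homotopic.prod k.hom (cls q))) h1

theorem lin_lt {a b c d : ℂ} (h : a.re < b.re) (h' : c.re < d.re) {t : ℝ} (h0 : 0 ≤ t)
    (h1 : t ≤ 1) : (1 - t : ℂ) * a + t * c ≠ (1 - t : ℂ) * b + t * d := fun heq => by
  have h2 := congrArg Complex.re heq
  rw [re_convex, re_convex] at h2
  exact (lt_convex h h' h0 h1).ne h2

/-- The two ways to place a permutation and a configuration side by side, in the half disk and in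
the disk, differ by a linear path. -/
theorem compat_append (u : Word A) (z : Conf B) :
    Compat (HConf.append u z).1 (CoB.appendMap A B (u.conf, z)).1 := by
  have hab : ∀ a b, ((HConf.append u z).1 (Sum.inl a)).re < ((HConf.append u z).1 (Sum.inr b)).re :=
    fun a b => by
    change ((u.pos a - 1 : ℝ) : ℂ).re < (z.1 b / 4 + (1 / 2 + Complex.I / 2) : ℂ).re
    have h1 := (Complex.abs_re_le_norm _).trans (z.2.2 b)
    have h2 := neg_abs_le (z.1 b).re
    have h3 := u.pos_lt_one a
    rw [Complex.ofReal_re]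
    simp
    linarith
  have hab' : ∀ a b, ((CoB.appendMap A B (u.conf, z)).1 (Sum.inl a)).re
      < ((CoB.appendMap A B (u.conf, z)).1 (Sum.inr b)).re := fun a b => by
    have h1 := (Complex.re_le_norm _).trans (u.conf.2.2 a)
    have h2 := (Complex.abs_re_le_norm _).trans (z.2.2 b)
    have h3 := neg_abs_le (z.1 b).re
    change (u.conf.1 a / 4 - 1 / 2 : ℂ).re < (z.1 b / 4 + 1 / 2 : ℂ).re
    simp
    linarith
  intro t h0 h1
  rintro (a | b) (a' | b') hij
  · refine congrArg _ ((srt_place u).compat (srt_scale (srt_conf u) (-(1 / 2))) t h0 h1 ?_)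
    have h2 : (1 - t : ℂ) * ((u.pos a - 1 : ℝ) : ℂ) + t * (u.conf.1 a / 4 - 1 / 2)
        = (1 - t : ℂ) * ((u.pos a' - 1 : ℝ) : ℂ) + t * (u.conf.1 a' / 4 - 1 / 2) := hij
    simpa only [lin, sub_eq_add_neg] using h2
  · exact (lin_lt (hab a b') (hab' a b') h0 h1 hij).elim
  · exact (lin_lt (hab a' b) (hab' a' b) h0 h1 hij.symm).elim
  · refine congrArg _ (z.2.1 ?_)
    have h2 : (1 - t : ℂ) * (z.1 b / 4 + (1 / 2 + Complex.I / 2)) + t * (z.1 b / 4 + 1 / 2)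
      = (1 - t : ℂ) * (z.1 b' / 4 + (1 / 2 + Complex.I / 2)) + t * (z.1 b' / 4 + 1 / 2) := hij
    linear_combination 4 * h2

theorem srt_append (u : Word A) {x : Word B} {z : Conf B} (h : Srt x z.1) :
    Srt (u.append x) (HConf.append u z).1 := by
  refine Word.Sorted.append (srt_place u) (srt_scale h _) fun a b => ?_
  change ((u.pos a - 1 : ℝ) : ℂ).re < (z.1 b / 4 + (1 / 2 + Complex.I / 2) : ℂ).re
  have h1 := (Complex.abs_re_le_norm _).trans (z.2.2 b)
  have h2 := neg_abs_le (z.1 b).re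
  have h3 := u.pos_lt_one a
  rw [Complex.ofReal_re]
  simp
  linarith

theorem rhoCo_map {w w' : Word (A ⊕ B)} (m : (show CoBal A B from w) ⟶ (show CoBal A B from w')) :
    (rhoCo A B).map m
      = (appendIso w).inv ≫ (concat A B).map m.hom ≫ (appendIso w').hom := rfl

theorem coA_base_hom {x x' : Word B} (q : Path x.conf x'.conf) :
    (coA q (srt_conf x) (srt_conf x')).hom.hom = cls q := by
  change (srtIso (segClosed_confP B) (srt_conf x) (srt_conf x)).hom ≫ cls q ≫
    (srtIso (segClosed_confP B) (srt_conf x') (srt_conf x')).inv = _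
  rw [srtIso_inv, srtIso_self, srtIso_self, Category.id_comp, Category.comp_id]

/-- The functor underlying `ρ` is `ζ`, followed by the map that forgets the colours. -/
theorem arr_forget_zeta (f : Arrow (CoBal A B)) :
    arr (CoPB.forget A B) (arr (zeta A B) f) = arr (rhoCo A B) f := by
  obtain ⟨w, w', m⟩ := f
  obtain ⟨q, hq⟩ := Path.Homotopic.Quotient.mk_surjective m.hom.2.hom
  have hL : Word.resL w' = Word.resL w := (Discrete.eq_of_hom m.hom.1).symm
  have h1 := arr_zeta m q (srt_conf _) (srt_conf _)
    (InducedCategory.hom_ext (hq.symm.trans (coA_base_hom q).symm)) hL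
  have h2 := hcoS_hom (v := (Word.resL w).append (Word.resR w))
    (v' := (Word.resL w').append (Word.resR w')) (q.map (HConf.append (Word.resL w)).continuous)
    (sep_append rfl (srt_conf _)) (sep_append hL (srt_conf _)) (srt_append _ (srt_conf _))
    (hL ▸ srt_append _ (srt_conf _)) (Word.resL_append _ _) (Word.resR_append _ _)
    (Word.resL_append _ _) (Word.resR_append _ _)
  have h3 := ((concat_map m.hom hL q hq.symm).trans (coA_congr rfl rfl fun t =>
    compat_append (Word.resL w) (q t)).symm).trans (arr_forget_hcoA
      (q.map (HConf.append (Word.resL w)).continuous) (srt_append _ (srt_conf _))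
      (hL ▸ srt_append _ (srt_conf _))).symm
  have h4 : (CoPB.forget A B).map ((zeta A B).map m) = (rhoCo A B).map m := by
    rw [(Arrow.mk_inj _ _).1 h1]
    refine (congrArg (fun k => (CoPB.forget A B).map k) h2).trans ?_
    refine Eq.trans ?_ (rhoCo_map m).symm
    rw [(Arrow.mk_inj _ _).1 h3]
    refine ((CoPB.forget A B).map_comp _ _).trans ?_
    refine (congrArg (fun k => _ ≫ k) ((CoPB.forget A B).map_comp _ _)).trans ?_
    rfl
  exact congrArg (fun k => Arrow.mk k) h4

end forget

/-! ### Operad laws for parenthesized words -/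

section trees

namespace UMagma

variable {I J : Type}

theorem bind_dvar (g : I → UMagma J) (i : I) : bind g (var i) = g i := by
  simp [bind, lift_var]

end UMagma

namespace SMagma

variable {A B A' B' A'' B'' : Type}

theorem bind_bind (g : A → SMagma A' B') (h : B → UMagma B') (g' : A' → SMagma A'' B'')
    (h' : B' → UMagma B'') (t : SMagma A B) :
    bind g' h' (bind g h t)
      = bind (fun a => bind g' h' (g a)) (fun b => UMagma.bind h' (h b)) t := by
  have key : (bind g' h').comp (bind g h)
      = bind (fun a => bind g' h' (g a)) fun b => UMagma.bind h' (h b) := by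
    apply hom_ext
    · intro a
      simp [bind_dvar]
    · intro t
      simp only [MonoidHom.comp_apply, bind_f, UMagma.bind_bind]
  exact DFunLike.congr_fun key t

theorem bind_var_var (t : SMagma A B) : bind var UMagma.var t = t := by
  have key : bind (var : A → SMagma A B) UMagma.var = MonoidHom.id _ := by
    apply hom_ext
    · intro a
      simp [bind_dvar]
    · intro t
      simp only [bind_f, UMagma.bind_var, MonoidHom.id_apply]
  exact DFunLike.congr_fun key t

end SMagma

namespace PWord

variable {I J B B' : Type}

theorem map_refl (t : PWord I) : t.map (Equiv.refl I) = t := by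
  ext1
  exact UMagma.bind_var _

theorem map_trans {K : Type} (e : I ≃ J) (e' : J ≃ K) (t : PWord I) :
    t.map (e.trans e') = (t.map e).map e' := by
  ext1
  simp only [map, UMagma.bind_bind, UMagma.bind_dvar]
  rfl

theorem comp_outer {D : B' → Type} (e : B ≃ B') (t : PWord B) (v : ∀ b, PWord (D b)) :
    (t.map e).comp v = (t.comp fun b => v (e b)).map (Equiv.sigmaCongrLeft e) := by
  ext1
  simp only [map, comp, bind, UMagma.bind_bind, UMagma.bind_dvar]
  rfl

theorem comp_inner {D D' : B → Type} (e : ∀ b, D b ≃ D' b) (t : PWord B) (v : ∀ b, PWord (D b)) :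
    t.comp (fun b => (v b).map (e b)) = (t.comp v).map (Equiv.sigmaCongrRight e) := by
  ext1
  simp only [map, comp, bind, UMagma.bind_bind, UMagma.bind_dvar]
  rfl

theorem one_comp (t : PWord B) : one.comp (fun _ => t) = t.map (unitEquiv B) := by
  ext1
  simp only [map, comp, bind, one, UMagma.bind_dvar]
  rfl

theorem comp_one (t : PWord B) : t.comp (fun _ => one) = t.map (unitEquiv' B) := by
  ext1
  simp only [map, comp, bind, one, UMagma.bind_dvar]
  rfl

theorem comp_assoc {D : B → Type} (E : ∀ b, D b → Type) (t : PWord B) (v : ∀ b, PWord (D b))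
    (u : ∀ b d, PWord (E b d)) :
    ((t.comp v).comp fun bd : Σ b, D b => u bd.1 bd.2).map (Equiv.sigmaAssoc E)
      = t.comp fun b => (v b).comp (u b) := by
  ext1
  simp only [map, comp, bind, UMagma.bind_bind, UMagma.bind_dvar]
  rfl

end PWord

namespace SWord

variable {A A' B B' : Type}

theorem map_refl (t : SWord A B) : t.map (Equiv.refl A) (Equiv.refl B) = t := by
  ext1
  exact SMagma.bind_var_var _

theorem map_trans {A'' B'' : Type} (e : A ≃ A') (e' : A' ≃ A'') (k : B ≃ B') (k' : B' ≃ B'')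
    (t : SWord A B) : t.map (e.trans e') (k.trans k') = (t.map e k).map e' k' := by
  ext1
  simp only [map, SMagma.bind_bind, UMagma.bind_dvar, SMagma.bind_dvar]
  rfl

theorem modComp_outer {D : B' → Type} (eA : A ≃ A') (eB : B ≃ B') (t : SWord A B)
    (v : ∀ b, PWord (D b)) :
    (t.map eA eB).modComp v
      = (t.modComp fun b => v (eB b)).map eA (Equiv.sigmaCongrLeft eB) := by
  ext1
  simp only [map, modComp, SMagma.bind_bind, UMagma.bind_bind, UMagma.bind_dvar, SMagma.bind_dvar]
  rfl

theorem modComp_inner {D D' : B → Type} (e : ∀ b, D b ≃ D' b) (t : SWord A B)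
    (v : ∀ b, PWord (D b)) :
    t.modComp (fun b => (v b).map (e b))
      = (t.modComp v).map (Equiv.refl A) (Equiv.sigmaCongrRight e) := by
  ext1
  simp only [map, modComp, PWord.map, SMagma.bind_bind, UMagma.bind_bind, UMagma.bind_dvar,
    SMagma.bind_dvar]
  rfl

theorem modComp_one (t : SWord A B) :
    t.modComp (fun _ => PWord.one) = t.map (Equiv.refl A) (unitEquiv' B) := by
  ext1
  simp only [map, modComp, PWord.one, UMagma.bind_dvar]
  rfl

theorem modComp_assoc {D : B → Type} (E : ∀ b, D b → Type) (t : SWord A B)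
    (v : ∀ b, PWord (D b)) (u : ∀ b d, PWord (E b d)) :
    ((t.modComp v).modComp fun bd : Σ b, D b => u bd.1 bd.2).map (Equiv.refl A)
        (Equiv.sigmaAssoc E)
      = t.modComp fun b => (v b).comp (u b) := by
  ext1
  simp only [map, modComp, PWord.comp, PWord.bind, SMagma.bind_bind, UMagma.bind_bind,
    UMagma.bind_dvar, SMagma.bind_dvar]
  rfl

theorem opComp_outer {C D : A' → Type} (eA : A ≃ A') (eB : B ≃ B') (t : SWord A B)
    (v : ∀ a, SWord (C a) (D a)) :
    (t.map eA eB).opComp v = (t.opComp fun a => v (eA a)).map (Equiv.sigmaCongrLeft eA)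
      (Equiv.sumCongr eB (Equiv.sigmaCongrLeft eA)) := by
  ext1
  simp only [map, opComp, SMagma.bind_bind, UMagma.bind_dvar, SMagma.bind_dvar]
  rfl

theorem opComp_inner {C C' D D' : A → Type} (eC : ∀ a, C a ≃ C' a) (eD : ∀ a, D a ≃ D' a)
    (t : SWord A B) (v : ∀ a, SWord (C a) (D a)) :
    t.opComp (fun a => (v a).map (eC a) (eD a)) = (t.opComp v).map (Equiv.sigmaCongrRight eC)
      (Equiv.sumCongr (Equiv.refl B) (Equiv.sigmaCongrRight eD)) := by
  ext1
  simp only [map, opComp, SMagma.bind_bind, UMagma.bind_dvar, SMagma.bind_dvar]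
  rfl

theorem one_opComp (t : SWord A B) :
    one.opComp (fun _ => t)
      = t.map (unitEquiv A) ((unitEquiv B).trans (Equiv.emptySum Empty _).symm) := by
  ext1
  simp only [map, opComp, one, SMagma.bind_dvar]
  rfl

theorem opComp_one (t : SWord A B) :
    t.opComp (fun _ => one) = t.map (unitEquiv' A) (unitEquiv'' A B) := by
  ext1
  simp only [map, opComp, one, SMagma.bind_dvar]
  rfl

theorem opComp_assoc {C D : A → Type} (C' D' : ∀ a, C a → Type) (t : SWord A B)
    (v : ∀ a, SWord (C a) (D a)) (u : ∀ a c, SWord (C' a c) (D' a c)) :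
    ((t.opComp v).opComp fun ac : Σ a, C a => u ac.1 ac.2).map (Equiv.sigmaAssoc C')
        (assocEquiv D')
      = t.opComp fun a => (v a).opComp (u a) := by
  ext1
  simp only [map, opComp, SMagma.bind_bind, UMagma.bind_dvar, SMagma.bind_dvar]
  rfl

theorem modComp_opComp {C D : A → Type} (E : (B ⊕ Σ a, D a) → Type) (t : SWord A B)
    (v : ∀ a, SWord (C a) (D a)) (u : ∀ x, PWord (E x)) :
    ((t.opComp v).modComp u).map (Equiv.refl _) (modEquiv E)
      = (t.modComp fun b => u (Sum.inl b)).opComp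
          fun a => (v a).modComp fun d => u (Sum.inr ⟨a, d⟩) := by
  ext1
  simp only [map, opComp, modComp, SMagma.bind_bind, UMagma.bind_bind, UMagma.bind_dvar,
    SMagma.bind_dvar]
  rfl

end SWord

end trees

/-! ### Projection of the parenthesized operads to the operads of braids -/

section projection

variable {A A' B B' : Type}

/-- A functor that changes objects only up to equality. -/
theorem liftTo_inducedFunctor {C D O : Type} [Category.{0} C] [Category.{0} D] (F : C ⥤ D)
    (p : O → D) (g : C → O) (h : ∀ c, F.obj c = p (g c)) :
    liftTo F p g (fun c => eqToIso (h c)) ⋙ inducedFunctor p = F :=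
  CategoryTheory.Functor.ext (fun c => (h c).symm) fun _ _ _ => rfl

theorem arr_eq_of_eq {C D : Type} [Category.{0} C] [Category.{0} D] {F G : C ⥤ D} (h : F = G)
    (f : Arrow C) : arr F f = arr G f := h ▸ rfl

/-- The projection from parenthesized braids to coloured braids. -/
abbrev paProj (B : Type) : PaB B ⥤ CoB B := inducedFunctor _

/-- Relabelling of arrows of `PaB`. -/
def paM (e : B ≃ B') : Arrow (PaB B) → Arrow (PaB B') := arr (PaB.map e)

/-- Composition of arrows of `PaB`. -/
def paC [Finite B] {D : B → Type} (f : Arrow (PaB B)) (g : ∀ b, Arrow (PaB (D b))) :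
    Arrow (PaB (Σ b, D b)) := arr (PaB.comp D) (arrTuple f g)

/-- The identity of the closed unit, as an arrow. -/
def pa1 : Arrow (PaB Unit) := Arrow.mk (𝟙 (show PaB Unit from PWord.one))

/-- Relabelling of arrows of `PaPB'`. -/
def hpaM (e : A ≃ A') (e' : B ≃ B') : Arrow (PaPB' A B) → Arrow (PaPB' A' B') :=
  arr (PaPB'.map e e')

/-- Composition of arrows of `PaPB'` with arrows of `PaB`. -/
def hpaMod [Finite B] {D : B → Type} (f : Arrow (PaPB' A B)) (g : ∀ b, Arrow (PaB (D b))) :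
    Arrow (PaPB' A (Σ b, D b)) := arr (PaPB'.modComp A D) (arrTuple f g)

/-- Composition of arrows of `PaPB'`. -/
def hpaC [Finite A] [Finite B] {C D : A → Type} (f : Arrow (PaPB' A B))
    (g : ∀ a, Arrow (PaPB' (C a) (D a))) : Arrow (PaPB' (Σ a, C a) (B ⊕ Σ a, D a)) :=
  arr (PaPB'.opComp B C D) (arrTuple f g)

/-- The identity of the open unit, as an arrow. -/
def hpa1 : Arrow (PaPB' Unit Empty) := Arrow.mk (𝟙 PaPB'.one)

theorem arr_paProj_paM (e : B ≃ B') (f : Arrow (PaB B)) :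
    arr (paProj B') (paM e f) = coM e (arr (paProj B) f) :=
  arr_eq_of_eq (liftTo_inducedFunctor (inducedFunctor _ ⋙ CoB.map e) _ _
    fun t => (PWord.word_map e t).symm) f

theorem arr_paProj_paC [Finite B] {D : B → Type} (f : Arrow (PaB B)) (g : ∀ b, Arrow (PaB (D b))) :
    arr (paProj _) (paC f g) = coC (arr (paProj B) f) fun b => arr (paProj (D b)) (g b) :=
  arr_eq_of_eq (liftTo_inducedFunctor
    ((inducedFunctor _).prod (Functor.pi fun _ => inducedFunctor _) ⋙ CoB.comp D) _ _
      fun q => (PWord.word_comp q.1 q.2).symm) (arrTuple f g)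

theorem one_word : PWord.one.word = clOneWord := by
  ext1
  exact UMagma.leaves_var ()

theorem arrow_one_congr {C : Type} [Category.{0} C] {x y : C} (h : x = y) :
    Arrow.mk (𝟙 x) = Arrow.mk (𝟙 y) := h ▸ rfl

theorem arr_paProj_pa1 : arr (paProj Unit) pa1 = co1 :=
  arrow_one_congr (C := CoB Unit) one_word

/-- The coloured braid of the aerial strands. -/
def paPart (A B : Type) : PaPB' A B ⥤ PaB B := PaPB'.base A B ⋙ CategoryTheory.Prod.snd _ _

/-- The projection from `PaPB'` to `CoPB`. -/
def toCoPB (A B : Type) : PaPB' A B ⥤ CoPB A B := inducedFunctor _ ⋙ balMap A B ⋙ zeta A B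

/-- The pair of components in `PaP` and in `PaB`. -/
abbrev paIncl (A B : Type) : PaBal A B ⥤ PaP A × PaB B := inducedFunctor _

/-- The pair of components in `CoP` and in `CoB`. -/
abbrev coIncl (A B : Type) : CoBal A B ⥤ CoP A × CoB B := inducedFunctor _

theorem balMap_coIncl :
    balMap A B ⋙ coIncl A B = paIncl A B ⋙ (inducedFunctor _).prod (paProj B) :=
  liftTo_inducedFunctor (paIncl A B ⋙ (inducedFunctor _).prod (inducedFunctor _))
    (fun w : Word (A ⊕ B) => ((⟨w.resL⟩, w.resR) : CoP A × CoB B))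
    (fun o : PaTriple A B => o.μ.word)
    fun o => Prod.ext (congrArg Discrete.mk o.hu.symm) o.hx.symm

theorem balMap_coPart : balMap A B ⋙ coPart A B
    = (paIncl A B ⋙ CategoryTheory.Prod.snd (PaP A) (PaB B)) ⋙ paProj B :=
  congrArg (fun G => G ⋙ CategoryTheory.Prod.snd (CoP A) (CoB B)) balMap_coIncl

theorem arr_toCoPB (f : Arrow (PaPB' A B)) :
    arr (toCoPB A B) f = arr (zeta A B) (arr (balMap A B) (arr (inducedFunctor _) f)) := rfl

/-- Projection to `CoPB`, followed by restriction to the aerial strands, retains the braid. -/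
theorem arr_aer_toCoPB (f : Arrow (PaPB' A B)) :
    arr (aer A B) (arr (toCoPB A B) f) = arr (paProj B) (arr (paPart A B) f) := by
  rw [arr_toCoPB, arr_aer_zeta, ← arr_comp (balMap A B), balMap_coPart]
  rfl

theorem lift_base {C : Type} [Category.{0} C] (F : C ⥤ PaP A × PaB B) (g : C → PaPB' A B)
    (h : ∀ c, F.obj c = (PaPB'.base A B).obj (g c)) :
    PaPB'.lift F g h ⋙ PaPB'.base A B = F := by
  have h1 := liftTo_inducedFunctor (liftTo F
    (fun o : PaTriple A B => ((o.u : PaP A), (o.x : PaB B))) (fun c => (g c).1)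
      fun c => eqToIso (h c))
    (fun o : {o : PaTriple A B // ∃ τ : Equiv.Perm B, o.μ.aerial = o.x.map τ} =>
      (o.1 : PaBal A B)) g (fun _ => rfl)
  have h2 := liftTo_inducedFunctor F
    (fun o : PaTriple A B => ((o.u : PaP A), (o.x : PaB B))) (fun c => (g c).1) h
  exact (congrArg (fun G => G ⋙ inducedFunctor _) h1).trans h2

theorem arr_paPart_lift {C : Type} [Category.{0} C] (F : C ⥤ PaP A × PaB B) (g : C → PaPB' A B)
    (h : ∀ c, F.obj c = (PaPB'.base A B).obj (g c)) (f : Arrow C) :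
    arr (paPart A B) (arr (PaPB'.lift F g h) f) = arr (F ⋙ CategoryTheory.Prod.snd _ _) f :=
  arr_eq_of_eq (congrArg (fun G => G ⋙ CategoryTheory.Prod.snd (PaP A) (PaB B))
    (lift_base F g h)) f

theorem arr_paPart_hpaM (e : A ≃ A') (e' : B ≃ B') (q : Arrow (PaPB' A B)) :
    arr (paPart A' B') (hpaM e e' q) = paM e' (arr (paPart A B) q) :=
  arr_paPart_lift _ _ _ q

theorem arr_paPart_hpaMod [Finite B] {D : B → Type} (q : Arrow (PaPB' A B))
    (g : ∀ b, Arrow (PaB (D b))) :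
    arr (paPart A _) (hpaMod q g) = paC (arr (paPart A B) q) g :=
  arr_paPart_lift _ _ _ (arrTuple q g)

/-- The family of braids to be substituted in `ρ`. -/
def paFamily (B : Type) {D : A → Type} (r : ∀ a, Arrow (PaB (D a))) :
    ∀ x, Arrow (PaB (PaPB'.opInputs B D x))
  | Sum.inl a => r a
  | Sum.inr _ => pa1

theorem arr_prod'_snd {C D E : Type} [Category.{0} C] [Category.{0} D] [Category.{0} E]
    (F : C ⥤ D) (G : C ⥤ E) (f : Arrow C) :
    arr (F.prod' G ⋙ CategoryTheory.Prod.snd D E) f = arr G f := rfl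

theorem arr_prod_arrTuple {C C' I J : Type} {D : I → Type} {D' : J → Type} [Category.{0} C]
    [Category.{0} C'] [∀ i, Category.{0} (D i)] [∀ j, Category.{0} (D' j)] (F : C ⥤ C')
    (G : (∀ i, D i) ⥤ ∀ j, D' j) (f : Arrow C) (g : ∀ i, Arrow (D i)) :
    arr (F.prod G) (arrTuple f g) = arrTuple (arr F f) fun j => Arrow.mk ((G.map
      (X := fun i => (g i).left) (Y := fun i => (g i).right) fun i => (g i).hom) j) := rfl

/-- The coloured braid of a composite in `PaPB'`. -/
theorem arr_paPart_hpaC [Finite A] [Finite B] {C D : A → Type} (q : Arrow (PaPB' A B))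
    (r : ∀ a, Arrow (PaPB' (C a) (D a))) :
    arr (paPart _ _) (hpaC q r) = paM (PaPB'.opEquiv B D)
      (paC (arr (PaPB'.rho A B) q) (paFamily B fun a => arr (paPart (C a) (D a)) (r a))) := by
  refine (arr_paPart_lift _ _ _ (arrTuple q r)).trans ?_
  rw [arr_prod'_snd, arr_comp, arr_comp, arr_prod_arrTuple]
  refine congrArg (fun g => arr (PaB.map (PaPB'.opEquiv B D)) (arr (PaB.comp _) g)) ?_
  refine congrArg (arrTuple (arr (PaPB'.rho A B) q)) ?_
  funext x
  rcases x with a | b <;> rfl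

theorem rho_paProj : PaPB'.rho A B ⋙ paProj (A ⊕ B) = PaPB'.toCoBal A B ⋙ rhoCo A B :=
  liftTo_inducedFunctor (PaPB'.toCoBal A B ⋙ rhoCo A B)
    (fun t : PWord (A ⊕ B) => (t.word : CoB (A ⊕ B)))
    (fun o : PaPB' A B => o.1.μ.U) fun o => o.1.μ.word_U.symm

/-- `ρ` is the projection to `CoPB`, followed by the functor that forgets the colours. -/
theorem arr_paProj_rho (q : Arrow (PaPB' A B)) : arr (paProj _) (arr (PaPB'.rho A B) q)
    = arr (CoPB.forget A B) (arr (toCoPB A B) q) := by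
  rw [arr_toCoPB, arr_forget_zeta, ← arr_comp (PaPB'.rho A B), rho_paProj]
  rfl

end projection

section map_laws

variable {A A' B B' : Type}

/-! ### The projection respects the operadic structures -/

theorem toCoPB_hpaM (eA : A ≃ A') (eB : B ≃ B') (q : Arrow (PaPB' A B)) :
    arr (toCoPB A' B') (hpaM eA eB q) = hcoM eA eB (arr (toCoPB A B) q) := by
  refine arrow_ext_aer (SWord.word_map eA eB q.left.1.μ) (SWord.word_map eA eB q.right.1.μ) ?_
  rw [arr_aer_toCoPB, arr_paPart_hpaM, arr_paProj_paM, aer_hcoM, arr_aer_toCoPB]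

theorem word_modComp {D : B → Type} (t : SWord A B) (v : ∀ b, PWord (D b)) :
    (t.modComp v).word = CoPB.modCompWord t.word fun b => (v b).word :=
  Word.ext (SWord.leaves_modComp t v)

theorem word_opComp {C D : A → Type} (t : SWord A B) (v : ∀ a, SWord (C a) (D a)) :
    (t.opComp v).word = CoPB.opCompWord t.word fun a => (v a).word :=
  Word.ext (SWord.leaves_opComp t v)

theorem toCoPB_hpaMod [Finite A] [Finite B] {D : B → Type} (q : Arrow (PaPB' A B))
    (g : ∀ b, Arrow (PaB (D b))) : arr (toCoPB A _) (hpaMod q g)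
      = hcoMod (arr (toCoPB A B) q) fun b => arr (paProj (D b)) (g b) := by
  refine arrow_ext_aer (word_modComp q.left.1.μ fun b => (g b).left)
    (word_modComp q.right.1.μ fun b => (g b).right) ?_
  rw [arr_aer_toCoPB, arr_paPart_hpaMod, arr_paProj_paC, aer_hcoMod, arr_aer_toCoPB]

theorem toCoPB_hpaC [Finite A] [Finite B] {C D : A → Type} (q : Arrow (PaPB' A B))
    (r : ∀ a, Arrow (PaPB' (C a) (D a))) : arr (toCoPB _ _) (hpaC q r)
      = hcoC (arr (toCoPB A B) q) fun a => arr (toCoPB (C a) (D a)) (r a) := by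
  refine arrow_ext_aer (word_opComp q.left.1.μ fun a => (r a).left.1.μ)
    (word_opComp q.right.1.μ fun a => (r a).right.1.μ) ?_
  rw [arr_aer_toCoPB, arr_paPart_hpaC, arr_paProj_paM, arr_paProj_paC, arr_paProj_rho, aer_hcoC]
  congr 2
  funext x
  rcases x with a | b
  · exact (arr_aer_toCoPB (r a)).symm
  · exact arr_paProj_pa1

theorem swordOne_word : SWord.one.word = opOneWord := by
  ext1
  exact SMagma.leaves_var ()

theorem toCoPB_hpa1 : arr (toCoPB Unit Empty) hpa1 = hco1 := by
  have h : hpa1 = Arrow.mk (𝟙 PaPB'.one) := rfl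
  rw [h, arr_mk, CategoryTheory.Functor.map_id]
  exact arrow_one_congr (C := CoPB Unit Empty) swordOne_word

/-! ### The relative operad of parenthesized permutations and braids -/

theorem arrow_ext_paProj {f g : Arrow (PaB B)} (hl : f.left = g.left) (hr : f.right = g.right)
    (h : arr (paProj B) f = arr (paProj B) g) : f = g := by
  obtain ⟨t, t', f⟩ := f
  obtain ⟨v, v', g⟩ := g
  obtain rfl : t = v := hl
  obtain rfl : t' = v' := hr
  obtain rfl : f = g := InducedCategory.hom_ext ((Arrow.mk_inj _ _).1 h)
  rfl

theorem PaPB'.ext {o o' : PaPB' A B} (hu : o.1.u = o'.1.u) (hμ : o.1.μ = o'.1.μ) : o = o' := by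
  have hx : o.1.x = o'.1.x := by rw [← PaPB'.aerial_eq o, hμ, PaPB'.aerial_eq]
  obtain ⟨⟨u, x, μ, _, _⟩, _⟩ := o
  obtain ⟨⟨u', x', μ', _, _⟩, _⟩ := o'
  obtain rfl : u = u' := hu
  obtain rfl : μ = μ' := hμ
  obtain rfl : x = x' := hx
  rfl

theorem arrow_ext_paPart {f g : Arrow (PaPB' A B)} (hl : f.left = g.left)
    (hr : f.right = g.right) (h : arr (paPart A B) f = arr (paPart A B) g) : f = g := by
  obtain ⟨t, t', f⟩ := f
  obtain ⟨v, v', g⟩ := g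
  obtain rfl : t = v := hl
  obtain rfl : t' = v' := hr
  obtain rfl : f = g := InducedCategory.hom_ext (InducedCategory.hom_ext
    (Prod.ext (InducedCategory.hom_ext (Subsingleton.elim _ _)) ((Arrow.mk_inj _ _).1 h)))
  rfl

/-- A morphism of `PaPB'` is determined by its projection to `CoPB`. -/
theorem arrow_ext_toCoPB {f g : Arrow (PaPB' A B)} (hlu : f.left.1.u = g.left.1.u)
    (hlμ : f.left.1.μ = g.left.1.μ) (hru : f.right.1.u = g.right.1.u)
    (hrμ : f.right.1.μ = g.right.1.μ)
    (h : arr (toCoPB A B) f = arr (toCoPB A B) g) : f = g := by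
  have hl := PaPB'.ext hlu hlμ
  have hr := PaPB'.ext hru hrμ
  refine arrow_ext_paPart hl hr (arrow_ext_paProj (congrArg (paPart A B).obj hl)
    (congrArg (paPart A B).obj hr) ?_)
  rw [← arr_aer_toCoPB, ← arr_aer_toCoPB, h]

theorem paM_refl (f : Arrow (PaB B)) : paM (Equiv.refl B) f = f :=
  arrow_ext_paProj (PWord.map_refl _) (PWord.map_refl _) (by rw [arr_paProj_paM, coM_refl])

theorem paM_trans {B'' : Type} (e : B ≃ B') (e' : B' ≃ B'') (f : Arrow (PaB B)) :
    paM (e.trans e') f = paM e' (paM e f) :=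
  arrow_ext_paProj (PWord.map_trans _ _ _) (PWord.map_trans _ _ _)
    (by simp only [arr_paProj_paM, coM_trans])

theorem paC_outer [Finite B] [Finite B'] {D : B' → Type} (e : B ≃ B') (f : Arrow (PaB B))
    (g : ∀ b, Arrow (PaB (D b))) :
    paC (paM e f) g = paM (Equiv.sigmaCongrLeft e) (paC f fun b => g (e b)) :=
  arrow_ext_paProj (PWord.comp_outer e f.left fun b => (g b).left)
    (PWord.comp_outer e f.right fun b => (g b).right)
    (by simp only [arr_paProj_paM, arr_paProj_paC, coC_outer])

theorem paC_inner [Finite B] {D D' : B → Type} (e : ∀ b, D b ≃ D' b) (f : Arrow (PaB B))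
    (g : ∀ b, Arrow (PaB (D b))) :
    paC f (fun b => paM (e b) (g b)) = paM (Equiv.sigmaCongrRight e) (paC f g) :=
  arrow_ext_paProj (PWord.comp_inner e f.left fun b => (g b).left)
    (PWord.comp_inner e f.right fun b => (g b).right)
    (by simp only [arr_paProj_paM, arr_paProj_paC, coC_inner])

theorem one_paC (f : Arrow (PaB B)) : paC pa1 (fun _ => f) = paM (unitEquiv B) f :=
  arrow_ext_paProj (PWord.one_comp f.left) (PWord.one_comp f.right)
    (by simp only [arr_paProj_paM, arr_paProj_paC, arr_paProj_pa1, one_coC])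

theorem paC_one [Finite B] (f : Arrow (PaB B)) : paC f (fun _ => pa1) = paM (unitEquiv' B) f :=
  arrow_ext_paProj (PWord.comp_one f.left) (PWord.comp_one f.right)
    (by simp only [arr_paProj_paM, arr_paProj_paC, arr_paProj_pa1, coC_one])

theorem paC_assoc [Finite B] {D : B → Type} [∀ b, Finite (D b)] (E : ∀ b, D b → Type)
    (f : Arrow (PaB B)) (g : ∀ b, Arrow (PaB (D b))) (h : ∀ b d, Arrow (PaB (E b d))) :
    paM (Equiv.sigmaAssoc E) (paC (paC f g) fun bd => h bd.1 bd.2)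
      = paC f fun b => paC (g b) (h b) :=
  arrow_ext_paProj (PWord.comp_assoc E f.left (fun b => (g b).left) fun b d => (h b d).left)
    (PWord.comp_assoc E f.right (fun b => (g b).right) fun b d => (h b d).right)
    (by
      simp only [arr_paProj_paM, arr_paProj_paC]
      exact coC_assoc E (arr (paProj B) f) (fun b => arr (paProj (D b)) (g b))
        fun b d => arr (paProj (E b d)) (h b d))

theorem hpaM_refl (q : Arrow (PaPB' A B)) : hpaM (Equiv.refl A) (Equiv.refl B) q = q :=
  arrow_ext_toCoPB (PWord.map_refl _) (SWord.map_refl _) (PWord.map_refl _) (SWord.map_refl _)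
    (by rw [toCoPB_hpaM, hcoM_refl])

theorem hpaM_trans {A'' B'' : Type} (eA : A ≃ A') (eA' : A' ≃ A'') (eB : B ≃ B') (eB' : B' ≃ B'')
    (q : Arrow (PaPB' A B)) :
    hpaM (eA.trans eA') (eB.trans eB') q = hpaM eA' eB' (hpaM eA eB q) :=
  arrow_ext_toCoPB (PWord.map_trans _ _ _) (SWord.map_trans _ _ _ _ _) (PWord.map_trans _ _ _)
    (SWord.map_trans _ _ _ _ _) (by simp only [toCoPB_hpaM, hcoM_trans])

variable [Finite A] [Finite A'] [Finite B] [Finite B']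

theorem hpaMod_outer {D : B' → Type} (eA : A ≃ A') (eB : B ≃ B') (q : Arrow (PaPB' A B))
    (g : ∀ b, Arrow (PaB (D b))) :
    hpaMod (hpaM eA eB q) g = hpaM eA (Equiv.sigmaCongrLeft eB) (hpaMod q fun b => g (eB b)) :=
  arrow_ext_toCoPB rfl (SWord.modComp_outer eA eB q.left.1.μ fun b => (g b).left) rfl
    (SWord.modComp_outer eA eB q.right.1.μ fun b => (g b).right)
    (by simp only [toCoPB_hpaM, toCoPB_hpaMod, hcoMod_outer])

theorem hpaMod_inner {D D' : B → Type} (e : ∀ b, D b ≃ D' b) (q : Arrow (PaPB' A B))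
    (g : ∀ b, Arrow (PaB (D b))) :
    hpaMod q (fun b => paM (e b) (g b))
      = hpaM (Equiv.refl A) (Equiv.sigmaCongrRight e) (hpaMod q g) :=
  arrow_ext_toCoPB (PWord.map_refl q.left.1.u).symm
    (SWord.modComp_inner e q.left.1.μ fun b => (g b).left) (PWord.map_refl q.right.1.u).symm
    (SWord.modComp_inner e q.right.1.μ fun b => (g b).right)
    (by simp only [toCoPB_hpaM, toCoPB_hpaMod, arr_paProj_paM, hcoMod_inner])

theorem hpaMod_one (q : Arrow (PaPB' A B)) :
    hpaMod q (fun _ => pa1) = hpaM (Equiv.refl A) (unitEquiv' B) q :=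
  arrow_ext_toCoPB (PWord.map_refl q.left.1.u).symm (SWord.modComp_one q.left.1.μ)
    (PWord.map_refl q.right.1.u).symm (SWord.modComp_one q.right.1.μ)
    (by simp only [toCoPB_hpaM, toCoPB_hpaMod, arr_paProj_pa1, hcoMod_one])

theorem hpaMod_assoc {D : B → Type} [∀ b, Finite (D b)] (E : ∀ b, D b → Type)
    (f : Arrow (PaPB' A B)) (g : ∀ b, Arrow (PaB (D b))) (h : ∀ b d, Arrow (PaB (E b d))) :
    hpaM (Equiv.refl A) (Equiv.sigmaAssoc E) (hpaMod (hpaMod f g) fun bd => h bd.1 bd.2)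
      = hpaMod f fun b => paC (g b) (h b) :=
  arrow_ext_toCoPB (PWord.map_refl f.left.1.u)
    (SWord.modComp_assoc E f.left.1.μ (fun b => (g b).left) fun b d => (h b d).left)
    (PWord.map_refl f.right.1.u)
    (SWord.modComp_assoc E f.right.1.μ (fun b => (g b).right) fun b d => (h b d).right)
    (by
      simp only [toCoPB_hpaM, toCoPB_hpaMod, arr_paProj_paC]
      exact hcoMod_assoc E (arr (toCoPB A B) f) (fun b => arr (paProj (D b)) (g b))
        fun b d => arr (paProj (E b d)) (h b d))

theorem hpaC_outer {C D : A' → Type} (eA : A ≃ A') (eB : B ≃ B') (q : Arrow (PaPB' A B))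
    (r : ∀ a, Arrow (PaPB' (C a) (D a))) :
    hpaC (hpaM eA eB q) r
      = hpaM (Equiv.sigmaCongrLeft eA) (Equiv.sumCongr eB (Equiv.sigmaCongrLeft eA))
          (hpaC q fun a => r (eA a)) :=
  arrow_ext_toCoPB (PWord.comp_outer eA q.left.1.u fun a => (r a).left.1.u)
    (SWord.opComp_outer eA eB q.left.1.μ fun a => (r a).left.1.μ)
    (PWord.comp_outer eA q.right.1.u fun a => (r a).right.1.u)
    (SWord.opComp_outer eA eB q.right.1.μ fun a => (r a).right.1.μ)
    (by simp only [toCoPB_hpaM, toCoPB_hpaC, hcoC_outer])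

theorem hpaC_inner {C C' D D' : A → Type} (eC : ∀ a, C a ≃ C' a) (eD : ∀ a, D a ≃ D' a)
    (q : Arrow (PaPB' A B)) (r : ∀ a, Arrow (PaPB' (C a) (D a))) :
    hpaC q (fun a => hpaM (eC a) (eD a) (r a))
      = hpaM (Equiv.sigmaCongrRight eC) (Equiv.sumCongr (Equiv.refl B) (Equiv.sigmaCongrRight eD))
          (hpaC q r) :=
  arrow_ext_toCoPB (PWord.comp_inner eC q.left.1.u fun a => (r a).left.1.u)
    (SWord.opComp_inner eC eD q.left.1.μ fun a => (r a).left.1.μ)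
    (PWord.comp_inner eC q.right.1.u fun a => (r a).right.1.u)
    (SWord.opComp_inner eC eD q.right.1.μ fun a => (r a).right.1.μ)
    (by simp only [toCoPB_hpaM, toCoPB_hpaC, hcoC_inner])

theorem one_hpaC (q : Arrow (PaPB' A B)) :
    hpaC hpa1 (fun _ => q)
      = hpaM (unitEquiv A) ((unitEquiv B).trans (Equiv.emptySum Empty _).symm) q :=
  arrow_ext_toCoPB (PWord.one_comp q.left.1.u) (SWord.one_opComp q.left.1.μ)
    (PWord.one_comp q.right.1.u) (SWord.one_opComp q.right.1.μ)
    (by simp only [toCoPB_hpaM, toCoPB_hpaC, toCoPB_hpa1, one_hcoC])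

theorem hpaC_one (q : Arrow (PaPB' A B)) :
    hpaC q (fun _ => hpa1) = hpaM (unitEquiv' A) (unitEquiv'' A B) q :=
  arrow_ext_toCoPB (PWord.comp_one q.left.1.u) (SWord.opComp_one q.left.1.μ)
    (PWord.comp_one q.right.1.u) (SWord.opComp_one q.right.1.μ)
    (by simp only [toCoPB_hpaM, toCoPB_hpaC, toCoPB_hpa1, hcoC_one])

theorem hpaC_assoc {C D : A → Type} (C' D' : ∀ a, C a → Type) [∀ a, Finite (C a)]
    [∀ a, Finite (D a)] (f : Arrow (PaPB' A B)) (g : ∀ a, Arrow (PaPB' (C a) (D a)))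
    (h : ∀ a c, Arrow (PaPB' (C' a c) (D' a c))) :
    hpaM (Equiv.sigmaAssoc C') (assocEquiv D') (hpaC (hpaC f g) fun ac => h ac.1 ac.2)
      = hpaC f fun a => hpaC (g a) (h a) :=
  arrow_ext_toCoPB
    (PWord.comp_assoc C' f.left.1.u (fun a => (g a).left.1.u) fun a c => (h a c).left.1.u)
    (SWord.opComp_assoc C' D' f.left.1.μ (fun a => (g a).left.1.μ) fun a c => (h a c).left.1.μ)
    (PWord.comp_assoc C' f.right.1.u (fun a => (g a).right.1.u) fun a c => (h a c).right.1.u)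
    (SWord.opComp_assoc C' D' f.right.1.μ (fun a => (g a).right.1.μ) fun a c => (h a c).right.1.μ)
    (by
      simp only [toCoPB_hpaM, toCoPB_hpaC]
      exact hcoC_assoc C' D' _ _ fun a c => arr (toCoPB (C' a c) (D' a c)) (h a c))

theorem hpaMod_hpaC {C D : A → Type} (E : (B ⊕ Σ a, D a) → Type) [∀ a, Finite (C a)]
    [∀ a, Finite (D a)] [∀ x, Finite (E x)] (f : Arrow (PaPB' A B))
    (g : ∀ a, Arrow (PaPB' (C a) (D a))) (h : ∀ x, Arrow (PaB (E x))) :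
    hpaM (Equiv.refl _) (modEquiv E) (hpaMod (hpaC f g) h)
      = hpaC (hpaMod f fun b => h (Sum.inl b))
          fun a => hpaMod (g a) fun d => h (Sum.inr ⟨a, d⟩) :=
  arrow_ext_toCoPB (PWord.map_refl (f.left.1.u.comp fun a => (g a).left.1.u))
    (SWord.modComp_opComp E f.left.1.μ (fun a => (g a).left.1.μ) fun x => (h x).left)
    (PWord.map_refl (f.right.1.u.comp fun a => (g a).right.1.u))
    (SWord.modComp_opComp E f.right.1.μ (fun a => (g a).right.1.μ) fun x => (h x).right)
    (by
      simp only [toCoPB_hpaM, toCoPB_hpaMod, toCoPB_hpaC]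
      exact hcoMod_hcoC E _ _ _)

theorem isRelOperad_paPBPrimePlus : PaPBPrimePlus.IsRelOperad where
  clM_refl _ _ f := paM_refl f
  clM_trans _ _ _ _ _ _ e e' f := paM_trans e e' f
  clC_outer _ _ _ _ _ _ e f g := paC_outer e f g
  clC_inner _ _ _ _ _ _ e f g := paC_inner e f g
  one_clC _ _ f := one_paC f
  clC_one _ _ f := paC_one f
  clC_assoc _ _ E _ _ _ f g h := paC_assoc E f g h
  opM_refl _ _ _ _ q := hpaM_refl q
  opM_trans _ _ _ _ _ _ _ _ _ _ _ _ eA eA' eB eB' q := hpaM_trans eA eA' eB eB' q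
  modC_outer _ _ _ _ _ _ _ _ _ _ eA eB q g := hpaMod_outer eA eB q g
  modC_inner _ _ _ _ _ _ _ _ e q g := hpaMod_inner e q g
  modC_one _ _ _ _ q := hpaMod_one q
  modC_assoc _ _ _ E _ _ _ _ q g h := hpaMod_assoc E q g h
  opC_outer _ _ _ _ _ _ _ _ _ _ _ _ eA eB q r := hpaC_outer eA eB q r
  opC_inner _ _ _ _ _ _ _ _ _ _ _ _ eC eD q r := hpaC_inner eC eD q r
  one_opC _ _ _ _ q := one_hpaC q
  opC_one _ _ _ _ q := hpaC_one q
  opC_assoc _ _ _ _ C' D' _ _ _ _ _ _ q r s := hpaC_assoc C' D' q r s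
  modC_opC _ _ _ _ E _ _ _ _ _ q r g := hpaMod_hpaC E q r g

end map_laws

section equivalence

variable {A B : Type}

/-! ### The categorical equivalence -/

theorem exists_pword (w : Word B) : ∃ t : PWord B, t.word = w := by
  have key : ∀ l : List B, UMagma.leaves (l.foldr (fun b t => UMagma.var b * t) 1) = l := by
    intro l
    induction l with
    | nil => rfl
    | cons b l ih =>
      rw [List.foldr_cons, UMagma.leaves, map_mul, FreeMonoid.toList_mul]
      exact congrArg₂ (· ++ ·) (UMagma.leaves_var b) ih
  exact ⟨⟨_, (key w.list).symm ▸ w.nodup, (key w.list).symm ▸ w.complete⟩, Word.ext (key w.list)⟩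

theorem exists_sword (w : Word (A ⊕ B)) : ∃ t : SWord A B, t.word = w := by
  have key : ∀ l : List (A ⊕ B), SMagma.leaves (l.foldr (fun x t =>
      Sum.elim SMagma.var (fun b => SMagma.f (UMagma.var b)) x * t) 1) = l := by
    intro l
    induction l with
    | nil => rfl
    | cons x l ih =>
      rw [List.foldr_cons, SMagma.leaves, map_mul, FreeMonoid.toList_mul]
      refine congrArg₂ (· ++ ·) (x' := [x]) ?_ ih
      rcases x with a | b
      · exact SMagma.leaves_var a
      · refine (congrArg FreeMonoid.toList (SMagma.letters_f (UMagma.var b))).trans ?_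
        exact congrArg (List.map Sum.inr) (UMagma.leaves_var b)
  exact ⟨⟨_, (key w.list).symm ▸ w.nodup, (key w.list).symm ▸ w.complete⟩, Word.ext (key w.list)⟩

instance paProj_essSurj : (paProj B).EssSurj where
  mem_essImage w := by
    obtain ⟨t, rfl⟩ := exists_pword w
    exact ⟨t, ⟨Iso.refl _⟩⟩

theorem paProj_isEquivalence : (paProj B).IsEquivalence where

/-- The projection of the components in `PaP` and in `PaB`. -/
abbrev paInclProj (A B : Type) : PaBal A B ⥤ CoP A × CoB B :=
  paIncl A B ⋙ (inducedFunctor _).prod (paProj B)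

instance paInclProj_faithful : (paInclProj A B).Faithful where
  map_injective h := InducedCategory.hom_ext (Prod.ext
    (InducedCategory.hom_ext (congrArg Prod.fst h)) (InducedCategory.hom_ext (congrArg Prod.snd h)))

instance paInclProj_full : (paInclProj A B).Full where
  map_surjective f :=
    ⟨InducedCategory.homMk (InducedCategory.homMk f.1, InducedCategory.homMk f.2), rfl⟩

instance balMap_faithful : (balMap A B).Faithful :=
  have : (balMap A B ⋙ coIncl A B).Faithful := by
    rw [balMap_coIncl]
    infer_instance
  Functor.Faithful.of_comp _ (coIncl A B)

instance balMap_full : (balMap A B).Full :=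
  have : (balMap A B ⋙ coIncl A B).Full := by
    rw [balMap_coIncl]
    infer_instance
  Functor.Full.of_comp_faithful _ (coIncl A B)

instance zeta_isEquivalence [Finite A] [Finite B] : (zeta A B).IsEquivalence :=
  (CategoryTheory.Equivalence.mk (zeta A B) (zetaInv A B) (eqToIso (zeta_zetaInv A B).symm)
    (eqToIso (zetaInv_zeta A B))).isEquivalence_functor

instance toCoPB_essSurj : (toCoPB A B).EssSurj where
  mem_essImage w := by
    obtain ⟨u, hu⟩ := exists_pword (Word.resL w)
    obtain ⟨μ, rfl⟩ := exists_sword w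
    exact ⟨PaPB'.mk' u μ.aerial μ hu.symm rfl, ⟨Iso.refl _⟩⟩

theorem toCoPB_isEquivalence [Finite A] [Finite B] : (toCoPB A B).IsEquivalence where
  faithful := by
    unfold toCoPB
    infer_instance
  full := by
    unfold toCoPB
    infer_instance

/-- The projection of `PaPB'₊` to `CoPB₊`. -/
def projectionHom : RelOperadHom PaPBPrimePlus CoPBPlus where
  cl B := paProj B
  op A B := toCoPB A B
  map_clM _ _ _ _ e f := arr_paProj_paM e f
  map_opM _ _ _ _ _ _ _ _ eA eB q := toCoPB_hpaM eA eB q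
  map_cl1 := one_word
  map_op1 := swordOne_word
  map_clC _ _ _ _ f g := arr_paProj_paC f g
  map_modC _ _ _ _ _ _ q g := toCoPB_hpaMod q g
  map_opC _ _ _ _ _ _ _ _ q r := toCoPB_hpaC q r

theorem projectionHom_isCategoricalEquivalence : projectionHom.IsCategoricalEquivalence :=
  ⟨fun _ _ => paProj_isEquivalence, fun _ _ _ _ => toCoPB_isEquivalence⟩

end equivalence

/-! ### The balanced products are coinvariants -/

/-- If a functor `q` that is invariant under the action has a section `s` such that each arrow `f`
is moved to `s (q f)` by the action, then `q` is the quotient by the action. -/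
theorem isCoinvariants_of_section {G C N : Type} [Category.{0} C] [Category.{0} N]
    {act : G → C ⥤ C} {q : C ⥤ N} (s : N ⥤ C) (hq : ∀ g f, arr q (arr (act g) f) = arr q f)
    (hs : ∀ f, arr q (arr s f) = f) (hact : ∀ f, ∃ g, arr (act g) f = arr s (arr q f)) :
    IsCoinvariants act q := by
  refine ⟨fun g => functor_ext_arr (hq g), fun D _ F hF => ⟨s ⋙ F, ?_, fun F' hF' => ?_⟩⟩
  · refine functor_ext_arr fun f => ?_
    obtain ⟨g, hg⟩ := hact f
    rw [arr_comp, arr_comp, ← hg, ← arr_comp, hF g]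
  · subst hF'
    refine functor_ext_arr fun f => ?_
    rw [arr_comp, arr_comp, hs]

namespace Word

variable {n : ℕ}

theorem perm_eq {w : Word (Fin n)} {σ : Equiv.Perm (Fin n)} (h : w.list = List.ofFn σ) :
    w.perm = σ :=
  Equiv.coe_fn_injective (List.ofFn_injective (w.list_eq_ofFn.symm.trans h))

theorem perm_map (e : Equiv.Perm (Fin n)) (w : Word (Fin n)) : (w.map e).perm = e * w.perm := by
  apply perm_eq
  change w.list.map e = _
  rw [list_eq_ofFn, List.map_ofFn]
  rfl

theorem perm_injective {w w' : Word (Fin n)} (h : w.perm = w'.perm) : w = w' := by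
  ext1
  rw [list_eq_ofFn, list_eq_ofFn, h]

/-- The word `1 2 … n`. -/
def std (n : ℕ) : Word (Fin n) :=
  ⟨List.ofFn id, List.nodup_ofFn.2 Function.injective_id, fun i => List.mem_ofFn.2 ⟨i, rfl⟩⟩

theorem perm_std (n : ℕ) : (std n).perm = 1 := perm_eq rfl

theorem map_perm_inv (w : Word (Fin n)) : w.map w.perm⁻¹ = std n :=
  perm_injective (by rw [perm_map, perm_std, inv_mul_cancel])

end Word

theorem arr_uncurry_discrete {C D I : Type} [Category.{0} C] [Category.{0} D] (F : I → C ⥤ D)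
    (f : Arrow (Discrete I × C)) : arr (Functor.uncurry.obj (Discrete.functor F)) f
      = arr (F f.left.1.as) (arr (CategoryTheory.Prod.snd _ _) f) := by
  obtain ⟨⟨⟨i⟩, x⟩, ⟨⟨j⟩, y⟩, ⟨⟨⟨h⟩⟩, f⟩⟩ := f
  obtain rfl : i = j := h
  refine (Arrow.mk_inj _ _).2 ?_
  change ((Discrete.functor F).map (𝟙 _)).app x ≫ (F i).map f = (F i).map f
  rw [CategoryTheory.Functor.map_id]
  exact Category.id_comp _

theorem word_map_map {I J K : Type} (e : I ≃ J) (e' : J ≃ K) (w : Word I) :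
    (w.map e).map e' = w.map (e.trans e') :=
  Word.ext (List.map_map ..)

section coinvariants

variable {n m : ℕ}

/-- The braid of a triple. -/
def coBraid (n m : ℕ) : (CoP (Fin n) × CoB (Fin m)) × Sh (Fin n) (Fin m) ⥤ CoB (Fin m) :=
  CategoryTheory.Prod.fst _ _ ⋙ CategoryTheory.Prod.snd _ _

theorem coQuot_coIncl : coQuot n m ⋙ coIncl (Fin n) (Fin m)
    = CategoryTheory.Prod.swap _ _ ⋙ (inducedFunctor _).prod (𝟭 _) ⋙
      Functor.uncurry.obj (Discrete.functor fun p : Word (Fin n) × Word (Fin m) =>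
        (CoP.map p.1.perm).prod (CoB.map p.2.perm)) :=
  liftTo_inducedFunctor _ _ _ _

theorem arr_coPart_coQuot (f : Arrow ((CoP (Fin n) × CoB (Fin m)) × Sh (Fin n) (Fin m))) :
    arr (coPart _ _) (arr (coQuot n m) f)
      = coM (Word.resR f.left.2).perm (arr (coBraid n m) f) := by
  have h1 := arr_eq_of_eq (coQuot_coIncl (n := n) (m := m)) f
  refine (congrArg (arr (CategoryTheory.Prod.snd _ _)) h1).trans ?_
  rw [arr_comp, arr_comp, arr_uncurry_discrete]
  rfl

theorem arrow_ext_triple {f g : Arrow ((CoP (Fin n) × CoB (Fin m)) × Sh (Fin n) (Fin m))}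
    (hl : f.left = g.left) (hr : f.right = g.right)
    (h : arr (coBraid n m) f = arr (coBraid n m) g) : f = g := by
  obtain ⟨t, t', f⟩ := f
  obtain ⟨v, v', g⟩ := g
  obtain rfl : t = v := hl
  obtain rfl : t' = v' := hr
  obtain rfl : f = g := Prod.ext (Prod.ext (Subsingleton.elim _ _) ((Arrow.mk_inj _ _).1 h))
    (InducedCategory.hom_ext (Subsingleton.elim _ _))
  rfl

/-- The shuffle with the same pattern as the word `w`, and with the letters of each colour in the
standard order. -/
def stdShuffle (n m : ℕ) : CoBal (Fin n) (Fin m) ⥤ Sh (Fin n) (Fin m) :=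
  liftTo ((Functor.const _).obj ⟨(Word.std n, Word.std m)⟩) _
    (fun w => Word.map (Equiv.sumCongr (Word.resL w).perm⁻¹ (Word.resR w).perm⁻¹) w)
    fun w => eqToIso (congrArg Discrete.mk (Prod.ext
      ((Word.resL_map _ _ w).trans (Word.map_perm_inv _)).symm
      ((Word.resR_map _ _ w).trans (Word.map_perm_inv _)).symm))

/-- The section of `coQuot` that labels the shuffle in the standard order. -/
def coSection (n m : ℕ) :
    CoBal (Fin n) (Fin m) ⥤ (CoP (Fin n) × CoB (Fin m)) × Sh (Fin n) (Fin m) :=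
  (coIncl _ _).prod' (stdShuffle n m)

theorem arr_coBraid_coAct (g : Equiv.Perm (Fin n) × Equiv.Perm (Fin m))
    (f : Arrow ((CoP (Fin n) × CoB (Fin m)) × Sh (Fin n) (Fin m))) :
    arr (coBraid n m) (arr (coAct n m g) f) = coM g.2 (arr (coBraid n m) f) := rfl

theorem arr_coBraid_coSection (f : Arrow (CoBal (Fin n) (Fin m))) :
    arr (coBraid n m) (arr (coSection n m) f) = arr (coPart _ _) f := rfl

theorem map_sumCongr_congr {A B A' B' : Type} {e e' : A ≃ A'} {k k' : B ≃ B'}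
    (w : Word (A ⊕ B)) (h : e = e') (h' : k = k') :
    w.map (Equiv.sumCongr e k) = w.map (Equiv.sumCongr e' k') := by rw [h, h']

theorem map_sumCongr_map {A B A' B' A'' B'' : Type} (e : A ≃ A') (e' : A' ≃ A'') (k : B ≃ B')
    (k' : B' ≃ B'') (w : Word (A ⊕ B)) : (w.map (Equiv.sumCongr e k)).map (Equiv.sumCongr e' k')
      = w.map (Equiv.sumCongr (e.trans e') (k.trans k')) := by
  rw [word_map_map, Equiv.sumCongr_trans]

theorem perm_placeAct (s : Equiv.Perm (Fin n)) (w : Word (Fin n)) :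
    (w.map (w.placeAct s)).perm = w.perm * s⁻¹ := by
  rw [Word.perm_map, Word.placeAct]
  group

theorem perm_resL_placeAct (g : Equiv.Perm (Fin n) × Equiv.Perm (Fin m))
    (w : Word (Fin n ⊕ Fin m)) :
    (w.map (Equiv.sumCongr (w.resL.placeAct g.1) (w.resR.placeAct g.2))).resL.perm
      = w.resL.perm * g.1⁻¹ := by
  rw [Word.resL_map, perm_placeAct]

theorem perm_resR_placeAct (g : Equiv.Perm (Fin n) × Equiv.Perm (Fin m))
    (w : Word (Fin n ⊕ Fin m)) :
    (w.map (Equiv.sumCongr (w.resL.placeAct g.1) (w.resR.placeAct g.2))).resR.perm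
      = w.resR.perm * g.2⁻¹ := by
  rw [Word.resR_map, perm_placeAct]

theorem placeAct_trans_compAct (s : Equiv.Perm (Fin n)) (u w w' : Word (Fin n))
    (h : w'.perm = w.perm * s⁻¹) :
    (w.placeAct s).trans (Word.compAct (u.map s) w') = Word.compAct u w := by
  change Word.compAct (u.map s) w' * w.placeAct s = _
  rw [Word.compAct, Word.compAct, h, Word.perm_map, Word.placeAct]
  group

theorem coQuot_obj_coAct (g : Equiv.Perm (Fin n) × Equiv.Perm (Fin m))
    (c : (CoP (Fin n) × CoB (Fin m)) × Sh (Fin n) (Fin m)) :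
    (coQuot n m).obj ((coAct n m g).obj c) = (coQuot n m).obj c :=
  (map_sumCongr_map _ _ _ _ _).trans (map_sumCongr_congr _
    (placeAct_trans_compAct _ _ _ _ (perm_resL_placeAct g c.2))
    (placeAct_trans_compAct _ _ _ _ (perm_resR_placeAct g c.2)))

theorem coM_perm_congr {σ σ' : Equiv.Perm (Fin m)} (h : σ = σ') (f : Arrow (CoB (Fin m))) :
    coM σ f = coM σ' f := by rw [h]

theorem compAct_std (u w : Word (Fin n)) (h : w = Word.std n) :
    Word.compAct u w = u.perm := by
  rw [h, Word.compAct, Word.perm_std]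
  group

theorem isCoinvariants_coQuot : IsCoinvariants (coAct n m) (coQuot n m) := by
  refine isCoinvariants_of_section (coSection n m) (fun g f => ?_) (fun f => ?_) fun f => ?_
  · refine arrow_ext_coPart (coQuot_obj_coAct g f.left) (coQuot_obj_coAct g f.right) ?_
    rw [arr_coPart_coQuot, arr_coPart_coQuot, arr_coBraid_coAct, ← coM_trans]
    refine coM_perm_congr ?_ _
    change (Word.resR _).perm * g.2 = _
    refine (congrArg (· * g.2) (perm_resR_placeAct g f.left.2)).trans ?_
    group
  · have hobj : ∀ w : CoBal (Fin n) (Fin m), (coQuot n m).obj ((coSection n m).obj w) = w := by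
      intro w
      refine (map_sumCongr_map _ _ _ _ _).trans ?_
      refine (map_sumCongr_congr (e' := Equiv.refl _) (k' := Equiv.refl _) w ?_ ?_).trans ?_
      · refine (congrArg _ (compAct_std _ _ ((Word.resL_map _ _ w).trans
          (Word.map_perm_inv _)))).trans ?_
        exact Equiv.symm_trans_self _
      · refine (congrArg _ (compAct_std _ _ ((Word.resR_map _ _ w).trans
          (Word.map_perm_inv _)))).trans ?_
        exact Equiv.symm_trans_self _
      · ext1
        simp [Word.map]
    refine arrow_ext_coPart (hobj f.left) (hobj f.right) ?_
    rw [arr_coPart_coQuot, arr_coBraid_coSection]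
    refine (coM_perm_congr (σ' := Equiv.refl _) ?_ _).trans (coM_refl _)
    exact (congrArg Word.perm ((Word.resR_map _ _ f.left).trans (Word.map_perm_inv _))).trans
      (Word.perm_std m)
  · -- The group element is read off from the shuffle, whose subwords are the same at both ends.
    have hL : Word.resL f.left.2 = Word.resL f.right.2 :=
      congrArg Prod.fst (Discrete.eq_of_hom f.hom.2.hom)
    have hR : Word.resR f.left.2 = Word.resR f.right.2 :=
      congrArg Prod.snd (Discrete.eq_of_hom f.hom.2.hom)
    have hobj : ∀ c : (CoP (Fin n) × CoB (Fin m)) × Sh (Fin n) (Fin m),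
        (coAct n m ((Word.resL c.2).perm, (Word.resR c.2).perm)).obj c
          = (coSection n m).obj ((coQuot n m).obj c) := by
      intro c
      have h1 : Word.resL ((coQuot n m).obj c) = c.1.1.as.map (Word.resL c.2).perm :=
        (Word.resL_map _ _ _).trans (Word.map_compAct _ _)
      have h2 : Word.resR ((coQuot n m).obj c) = Word.map (Word.resR c.2).perm c.1.2 :=
        (Word.resR_map _ _ _).trans (Word.map_compAct _ _)
      refine Prod.ext (Prod.ext (congrArg Discrete.mk h1.symm) h2.symm) ?_
      refine Eq.symm ((map_sumCongr_map _ _ _ _ _).trans (map_sumCongr_congr _ ?_ ?_))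
      · change (Word.resL ((coQuot n m).obj c)).perm⁻¹ * Word.compAct _ _ = _
        rw [h1, Word.perm_map, Word.compAct, Word.placeAct]
        group
      · change (Word.resR ((coQuot n m).obj c)).perm⁻¹ * Word.compAct _ _ = _
        rw [h2, Word.perm_map, Word.compAct, Word.placeAct]
        group
    refine ⟨((Word.resL f.left.2).perm, (Word.resR f.left.2).perm),
      arrow_ext_triple (hobj f.left) ?_ ?_⟩
    · refine Eq.trans ?_ (hobj f.right)
      change (coAct n m _).obj f.right = _
      rw [hL, hR]
    · rw [arr_coBraid_coAct, arr_coBraid_coSection, arr_coPart_coQuot]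

/-- The braid of a triple. -/
def paBraid (n m : ℕ) : (PaP (Fin n) × PaB (Fin m)) × PaSh (Fin n) (Fin m) ⥤ PaB (Fin m) :=
  CategoryTheory.Prod.fst _ _ ⋙ CategoryTheory.Prod.snd _ _

/-- The braid of a class of triples. -/
def balBraid (A B : Type) : PaBal A B ⥤ PaB B := paIncl A B ⋙ CategoryTheory.Prod.snd _ _

theorem liftTo_inducedFunctor_of_eq {C D O : Type} [Category.{0} C] [Category.{0} D] (F : C ⥤ D)
    (p : O → D) (g : C → O) (e : ∀ c, F.obj c ≅ p (g c)) (h : ∀ c, F.obj c = p (g c))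
    (he : ∀ c, e c = eqToIso (h c)) : liftTo F p g e ⋙ inducedFunctor p = F := by
  obtain rfl : e = fun c => eqToIso (h c) := funext he
  exact liftTo_inducedFunctor F p g h

theorem paQuot_paIncl : paQuot n m ⋙ paIncl (Fin n) (Fin m)
    = CategoryTheory.Prod.swap _ _ ⋙ (inducedFunctor _ ⋙ inducedFunctor _).prod (𝟭 _) ⋙
      Functor.uncurry.obj (Discrete.functor fun p : Word (Fin n) × Word (Fin m) =>
        (PaP.map p.1.perm).prod (PaB.map p.2.perm)) := by
  unfold paQuot
  apply liftTo_inducedFunctor_of_eq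
  case h => exact fun _ => rfl
  case he => exact fun _ => rfl

theorem arr_balBraid_paQuot (f : Arrow ((PaP (Fin n) × PaB (Fin m)) × PaSh (Fin n) (Fin m))) :
    arr (balBraid _ _) (arr (paQuot n m) f)
      = paM (SWord.word f.left.2).resR.perm (arr (paBraid n m) f) := by
  have h1 := arr_eq_of_eq (paQuot_paIncl (n := n) (m := m)) f
  refine (congrArg (arr (CategoryTheory.Prod.snd _ _)) h1).trans ?_
  rw [arr_comp, arr_comp, arr_uncurry_discrete]
  rfl

theorem PaTriple.ext' {A B : Type} {o o' : PaTriple A B} (hu : o.u = o'.u) (hx : o.x = o'.x)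
    (hμ : o.μ = o'.μ) : o = o' := by
  obtain ⟨u, x, μ, _, _⟩ := o
  obtain ⟨u', x', μ', _, _⟩ := o'
  obtain rfl : u = u' := hu
  obtain rfl : μ = μ' := hμ
  obtain rfl : x = x' := hx
  rfl

theorem arrow_ext_balBraid {A B : Type} {f g : Arrow (PaBal A B)} (hl : f.left = g.left)
    (hr : f.right = g.right) (h : arr (balBraid A B) f = arr (balBraid A B) g) : f = g := by
  obtain ⟨t, t', f⟩ := f
  obtain ⟨v, v', g⟩ := g
  obtain rfl : t = v := hl
  obtain rfl : t' = v' := hr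
  obtain rfl : f = g := InducedCategory.hom_ext
    (Prod.ext (InducedCategory.hom_ext (Subsingleton.elim _ _)) ((Arrow.mk_inj _ _).1 h))
  rfl

theorem arrow_ext_paTriple {f g : Arrow ((PaP (Fin n) × PaB (Fin m)) × PaSh (Fin n) (Fin m))}
    (hl : f.left = g.left) (hr : f.right = g.right)
    (h : arr (paBraid n m) f = arr (paBraid n m) g) : f = g := by
  obtain ⟨t, t', f⟩ := f
  obtain ⟨v, v', g⟩ := g
  obtain rfl : t = v := hl
  obtain rfl : t' = v' := hr
  obtain rfl : f = g := Prod.ext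
    (Prod.ext (InducedCategory.hom_ext (Subsingleton.elim _ _)) ((Arrow.mk_inj _ _).1 h))
    (InducedCategory.hom_ext (InducedCategory.hom_ext (Subsingleton.elim _ _)))
  rfl

/-- The parenthesized version of `stdShuffle`. -/
def stdPaShuffle (n m : ℕ) : PaBal (Fin n) (Fin m) ⥤ PaSh (Fin n) (Fin m) :=
  liftTo (balMap _ _ ⋙ stdShuffle n m) _
    (fun o => SWord.map (SWord.word o.μ).resL.perm⁻¹ (SWord.word o.μ).resR.perm⁻¹ o.μ)
    fun o => eqToIso (SWord.word_map _ _ o.μ).symm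

/-- The section of `paQuot` that labels the parenthesized shuffle in the standard order. -/
def paSection (n m : ℕ) :
    PaBal (Fin n) (Fin m) ⥤ (PaP (Fin n) × PaB (Fin m)) × PaSh (Fin n) (Fin m) :=
  (paIncl _ _).prod' (stdPaShuffle n m)

theorem arr_paBraid_paAct (g : Equiv.Perm (Fin n) × Equiv.Perm (Fin m))
    (f : Arrow ((PaP (Fin n) × PaB (Fin m)) × PaSh (Fin n) (Fin m))) :
    arr (paBraid n m) (arr (paAct n m g) f) = paM g.2 (arr (paBraid n m) f) := rfl

theorem arr_paBraid_paSection (f : Arrow (PaBal (Fin n) (Fin m))) :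
    arr (paBraid n m) (arr (paSection n m) f) = arr (balBraid _ _) f := rfl

theorem sword_map_congr {A B A' B' : Type} {e e' : A ≃ A'} {k k' : B ≃ B'} (t : SWord A B)
    (h : e = e') (h' : k = k') : t.map e k = t.map e' k' := by rw [h, h']

theorem pword_map_perm_congr {σ σ' : Equiv.Perm (Fin n)} (h : σ = σ') (t : PWord (Fin n)) :
    t.map σ = t.map σ' := by rw [h]

theorem paM_perm_congr {σ σ' : Equiv.Perm (Fin m)} (h : σ = σ') (f : Arrow (PaB (Fin m))) :
    paM σ f = paM σ' f := by rw [h]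

theorem paQuot_obj_paAct (g : Equiv.Perm (Fin n) × Equiv.Perm (Fin m)) (u : PWord (Fin n))
    (x : PWord (Fin m)) (μ : SWord (Fin n) (Fin m)) :
    PaTriple.mk' (u.map g.1) (x.map g.2)
        (μ.map (μ.word.resL.placeAct g.1) (μ.word.resR.placeAct g.2))
      = PaTriple.mk' u x μ := by
  have h1 : (μ.map (μ.word.resL.placeAct g.1) (μ.word.resR.placeAct g.2)).word.resL.perm
      = μ.word.resL.perm * g.1⁻¹ := by rw [SWord.word_map, perm_resL_placeAct]
  have h2 : (μ.map (μ.word.resL.placeAct g.1) (μ.word.resR.placeAct g.2)).word.resR.perm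
      = μ.word.resR.perm * g.2⁻¹ := by rw [SWord.word_map, perm_resR_placeAct]
  refine PaTriple.ext' ?_ ?_ ?_
  · refine (PWord.map_trans _ _ u).symm.trans (pword_map_perm_congr ?_ u)
    change (SWord.word _).resL.perm * g.1 = _
    rw [h1]
    group
  · refine (PWord.map_trans _ _ x).symm.trans (pword_map_perm_congr ?_ x)
    change (SWord.word _).resR.perm * g.2 = _
    rw [h2]
    group
  · refine (SWord.map_trans _ _ _ _ μ).symm.trans (sword_map_congr μ ?_ ?_)
    · rw [PWord.word_map]
      exact placeAct_trans_compAct _ _ _ _ h1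
    · rw [PWord.word_map]
      exact placeAct_trans_compAct _ _ _ _ h2

theorem paQuot_obj_paSection (o : PaTriple (Fin n) (Fin m)) :
    PaTriple.mk' o.u o.x (o.μ.map o.μ.word.resL.perm⁻¹ o.μ.word.resR.perm⁻¹) = o := by
  have h1 : (o.μ.map o.μ.word.resL.perm⁻¹ o.μ.word.resR.perm⁻¹).word.resL = Word.std n := by
    rw [SWord.word_map, Word.resL_map, Word.map_perm_inv]
  have h2 : (o.μ.map o.μ.word.resL.perm⁻¹ o.μ.word.resR.perm⁻¹).word.resR = Word.std m := by
    rw [SWord.word_map, Word.resR_map, Word.map_perm_inv]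
  refine PaTriple.ext' ?_ ?_ ?_
  · refine (pword_map_perm_congr (σ' := Equiv.refl _) ?_ o.u).trans (PWord.map_refl _)
    rw [h1]
    exact Word.perm_std n
  · refine (pword_map_perm_congr (σ' := Equiv.refl _) ?_ o.x).trans (PWord.map_refl _)
    rw [h2]
    exact Word.perm_std m
  · refine (SWord.map_trans _ _ _ _ o.μ).symm.trans
      ((sword_map_congr o.μ ?_ ?_).trans (SWord.map_refl o.μ))
    · rw [compAct_std _ _ h1, ← o.hu]
      exact Equiv.symm_trans_self _
    · rw [compAct_std _ _ h2, ← o.hx]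
      exact Equiv.symm_trans_self _

theorem isCoinvariants_paQuot : IsCoinvariants (paAct n m) (paQuot n m) := by
  refine isCoinvariants_of_section (paSection n m) (fun g f => ?_) (fun f => ?_) fun f => ?_
  · refine arrow_ext_balBraid
      (paQuot_obj_paAct g f.left.1.1 f.left.1.2 f.left.2)
      (paQuot_obj_paAct g f.right.1.1 f.right.1.2 f.right.2) ?_
    rw [arr_balBraid_paQuot, arr_balBraid_paQuot, arr_paBraid_paAct, ← paM_trans]
    refine paM_perm_congr ?_ _
    change (SWord.word (SWord.map _ _ _)).resR.perm * g.2 = _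
    rw [SWord.word_map]
    refine (congrArg (· * g.2) (perm_resR_placeAct g (SWord.word f.left.2))).trans ?_
    group
  · refine arrow_ext_balBraid (paQuot_obj_paSection f.left) (paQuot_obj_paSection f.right) ?_
    rw [arr_balBraid_paQuot, arr_paBraid_paSection]
    refine (paM_perm_congr (σ' := Equiv.refl _) ?_ _).trans (paM_refl _)
    change (SWord.word (SWord.map _ _ _)).resR.perm = _
    rw [SWord.word_map]
    exact (congrArg Word.perm ((Word.resR_map _ _ (SWord.word f.left.μ)).trans
      (Word.map_perm_inv _))).trans (Word.perm_std m)
  · -- As for `coQuot`, the group element is read off from the shuffle.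
    have hL : (SWord.word f.left.2).resL = (SWord.word f.right.2).resL :=
      congrArg Prod.fst (Discrete.eq_of_hom f.hom.2.hom.hom)
    have hR : (SWord.word f.left.2).resR = (SWord.word f.right.2).resR :=
      congrArg Prod.snd (Discrete.eq_of_hom f.hom.2.hom.hom)
    have hobj : ∀ c : (PaP (Fin n) × PaB (Fin m)) × PaSh (Fin n) (Fin m),
        (paAct n m ((SWord.word c.2).resL.perm, (SWord.word c.2).resR.perm)).obj c
          = (paSection n m).obj ((paQuot n m).obj c) := by
      rintro ⟨⟨u, x⟩, μ⟩
      refine Prod.ext rfl ?_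
      refine Eq.symm ((SWord.map_trans _ _ _ _ μ).symm.trans (sword_map_congr μ ?_ ?_))
      · change (SWord.word (PaTriple.mk' u x μ).μ).resL.perm⁻¹ * Word.compAct _ _ = _
        rw [(PaTriple.mk' u x μ).hu, PaTriple.mk', PWord.word_map, Word.perm_map, Word.compAct,
          Word.placeAct]
        group
      · change (SWord.word (PaTriple.mk' u x μ).μ).resR.perm⁻¹ * Word.compAct _ _ = _
        rw [(PaTriple.mk' u x μ).hx, PaTriple.mk', PWord.word_map, Word.perm_map, Word.compAct,
          Word.placeAct]
        group
    refine ⟨((SWord.word f.left.2).resL.perm, (SWord.word f.left.2).resR.perm),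
      arrow_ext_paTriple (hobj f.left) ?_ ?_⟩
    · refine Eq.trans ?_ (hobj f.right)
      change (paAct n m _).obj f.right = _
      rw [hL, hR]
    · rw [arr_paBraid_paAct, arr_paBraid_paSection, arr_balBraid_paQuot]

theorem paQuot_balMap : paQuot n m ⋙ balMap (Fin n) (Fin m) = tripleMap n m ⋙ coQuot n m := by
  have hobj : ∀ c : (PaP (Fin n) × PaB (Fin m)) × PaSh (Fin n) (Fin m),
      (balMap _ _).obj ((paQuot n m).obj c) = (coQuot n m).obj ((tripleMap n m).obj c) :=
    fun c => SWord.word_map _ _ (show SWord _ _ from c.2)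
  refine functor_ext_arr fun f => arrow_ext_coPart (hobj f.left) (hobj f.right) ?_
  rw [arr_comp, arr_comp, arr_coPart_coQuot, ← arr_comp (balMap _ _), balMap_coPart, arr_comp]
  refine (congrArg (arr (paProj _)) (arr_balBraid_paQuot f)).trans ?_
  rw [arr_paProj_paM]
  rfl

end coinvariants

end SwissCheese

end

theorem mainTheorem7 :
    (∀ n m : ℕ, SwissCheese.IsCoinvariants (SwissCheese.coAct n m) (SwissCheese.coQuot n m) ∧
      SwissCheese.IsCoinvariants (SwissCheese.paAct n m) (SwissCheese.paQuot n m) ∧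
      SwissCheese.paQuot n m ⋙ SwissCheese.balMap (Fin n) (Fin m) =
        SwissCheese.tripleMap n m ⋙ SwissCheese.coQuot n m) ∧
    (∀ (A B : Type) [Finite A] [Finite B],
      ∃ ξ : SwissCheese.CoPB A B ⥤ SwissCheese.CoBal A B,
        SwissCheese.zeta A B ⋙ ξ = 𝟭 _ ∧ ξ ⋙ SwissCheese.zeta A B = 𝟭 _) ∧
    SwissCheese.PaPBPrimePlus.IsRelOperad ∧ SwissCheese.CoPBPlus.IsRelOperad ∧
    ∃ F : SwissCheese.RelOperadHom SwissCheese.PaPBPrimePlus SwissCheese.CoPBPlus,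
      F.IsCategoricalEquivalence ∧
      (∀ (B : Type) [Finite B], F.cl B =
        (inducedFunctor _ : SwissCheese.PaB B ⥤ SwissCheese.CoB B)) ∧
      ∀ (A B : Type) [Finite A] [Finite B], F.op A B =
        (inducedFunctor _ : SwissCheese.PaPB' A B ⥤ SwissCheese.PaBal A B) ⋙
          SwissCheese.balMap A B ⋙ SwissCheese.zeta A B :=
  ⟨fun _ _ => ⟨SwissCheese.isCoinvariants_coQuot, SwissCheese.isCoinvariants_paQuot,
      SwissCheese.paQuot_balMap⟩,
    fun A B _ _ => ⟨SwissCheese.zetaInv A B, SwissCheese.zeta_zetaInv A B,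
      SwissCheese.zetaInv_zeta A B⟩,
    SwissCheese.isRelOperad_paPBPrimePlus, SwissCheese.isRelOperad_coPBPlus,
    SwissCheese.projectionHom, SwissCheese.projectionHom_isCategoricalEquivalence,
    fun _ _ => rfl, fun _ _ _ _ => rfl⟩
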